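/- Let $m,N\ge 1$ be integers with $N+1\ge m$, let $a<b$ be real, $h=(b-a)/N$, and let $\omega\in\mathbb R$ with $\omega h\notin\mathbb Z$. Let $L_2^{(m)}[a,b]$ be the space of complex-valued functions $\varphi$ on $[a,b]$ whose derivative of order $m-1$ is absolutely continuous and whose derivative of order $m$ is square integrable, with $\|\varphi\|=\big(\int_a^b|\varphi^{(m)}(x)|^2dx\big)^{1/2}$. For $C=(C_0,\dots,C_N)\in\mathbb C^{N+1}$ let $$(\ell_C,\varphi)=\int_a^b e^{2\pi i\omega x}\varphi(x)\,dx-\sum_{\beta=0}^N C_\beta\,\varphi(h\beta+a),\qquad \|\ell_C\|=\sup\{|(\ell_C,\varphi)|:\varphi\in L_2^{(m)}[a,b],\ \|\varphi\|\le 1\}\in[0,\infty].$$ Call $C$ optimal (in the sense of Sard) if $(\ell_C,x^\alpha)=0$ for $\alpha=0,\dots,m-1$ and $\|\ell_C\|=\inf_{C'\in\mathbb C^{N+1}}\|\ell_{C'}\|$. Let $E_k(x)=\frac{(1-x)^{k+2}}{x}\left(x\frac{d}{dx}\right)^k\frac{x}{(1-x)^2}$ be the Euler-Frobenius polynomials,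 $\Delta^t0^j=\sum_{l=1}^t(-1)^{t-l}\binom tl l^j$, $\mathrm a_\alpha=\sum_{j=0}^{\alpha}(-1)^j\binom{2m}{j}(\alpha+1-j)^{2m-1}$, and $$K_{\omega,m}=\left(\frac{\sin\pi\omega h}{\pi\omega h}\right)^{2m}\frac{(2m-1)!}{2\sum_{\alpha=0}^{m-2}\mathrm a_\alpha\cos[2\pi\omega h(m-1-\alpha)]+\mathrm a_{m-1}}.$$ Then $E_{2m-2}$ has exactly $m-1$ distinct complex roots of modulus less than $1$, all of them real; let $q_1<\dots<q_{m-1}$ be these roots. The following system of $2m-2$ linear equations in $a_1,\dots,a_{m-1},b_1,\dots,b_{m-1}\in\mathbb C$ has exactly one solution: for $j=1,\dots,m-1$, $$\sum_{k=1}^{m-1}a_k\sum_{t=1}^{j}\frac{q_k\Delta^t0^j}{(q_k-1)^{t+1}}+\sum_{k=1}^{m-1}b_k\sum_{t=1}^j\frac{q_k^{N+t}\Delta^t0^{j}}{(1-q_k)^{t+1}}=\frac{j!\,e^{2\pi i\omega a}}{(2\pi i\omega h)^{j+1}}-\sum_{t=1}^j\frac{e^{2\pi i\omega (a+h)}K_{\omega,m}\Delta^t0^j}{(e^{2\pi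 i\omega h}-1)^{t+1}},$$ and for $j=1,\dots,m-1$, $$\begin{aligned}&\sum_{k=1}^{m-1}a_k\Big[\sum_{t=1}^j\frac{q_k^t\Delta^t0^j}{(1-q_k)^{t+1}}-\sum_{\alpha=1}^{j}\big(\tfrac{h}{b-a}\big)^{\alpha-j}\tbinom j\alpha\sum_{t=1}^{\alpha}\frac{q_k^{N+t}\Delta^t0^{\alpha}}{(1-q_k)^{t+1}}\Big]\\&+\sum_{k=1}^{m-1}b_k\Big[\sum_{t=1}^j\frac{q_k^{N+1}\Delta^t0^j}{(q_k-1)^{t+1}}-\sum_{\alpha=1}^{j}\big(\tfrac{h}{b-a}\big)^{\alpha-j}\tbinom j\alpha\sum_{t=1}^{\alpha}\frac{q_k\Delta^t0^{\alpha}}{(q_k-1)^{t+1}}\Big]\\&=\frac{(-1)^{j+1}j!\,e^{2\pi i\omega a}}{(2\pi i\omega h)^{j+1}}+\sum_{\alpha=1}^{j}\big(\tfrac{h}{b-a}\big)^{\alpha-j}\frac{(-1)^{\alpha}j!\,e^{2\pi i\omega b}}{(j-\alpha)!(2\pi i\omega h)^{\alpha+1}}-\frac{K_{\omega,m}e^{2\pi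 i\omega a}}{1-e^{2\pi i\omega h}}\sum_{t=1}^j\Big(\frac{e^{2\pi i\omega h}}{1-e^{2\pi i\omega h}}\Big)^t\Delta^t0^j\\&\quad+\frac{K_{\omega,m}e^{2\pi i\omega b}}{1-e^{2\pi i\omega h}}\sum_{\alpha=1}^{j}\big(\tfrac{h}{b-a}\big)^{\alpha-j}\tbinom j\alpha\sum_{t=1}^{\alpha}\Big(\frac{e^{2\pi i\omega h}}{1-e^{2\pi i\omega h}}\Big)^t\Delta^t0^\alpha.\end{aligned}$$ With this solution, $C\in\mathbb C^{N+1}$ is optimal if and only if $$\begin{aligned}C_0&=h\Big(\frac{e^{2\pi i\omega (a+h)}K_{\omega,m}}{e^{2\pi i\omega h}-1}-\frac{e^{2\pi i\omega a}}{2\pi i\omega h}+\sum_{k=1}^{m-1}\Big(a_k\frac{q_k}{q_k-1}+b_k\frac{q_k^N}{1-q_k}\Big)\Big),\\ C_\beta&=h\Big(e^{2\pi i\omega (h\beta+a)}K_{\omega,m}+\sum_{k=1}^{m-1}\big(a_kq_k^\beta+b_kq_k^{N-\beta}\big)\Big),\quad \beta=1,\dots,N-1,\\ C_N&=h\Big(\frac{e^{2\pi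 i\omega b}K_{\omega,m}}{1-e^{2\pi i\omega h}}+\frac{e^{2\pi i\omega b}}{2\pi i\omega h}+\sum_{k=1}^{m-1}\Big(a_k\frac{q_k^N}{1-q_k}+b_k\frac{q_k}{q_k-1}\Big)\Big).\end{aligned}$$ -/

import Mathlib

open scoped ENNReal Polynomial

namespace SardQuadrature

noncomputable section

/-- The oscillating exponential `e^{2πiωx}`. -/
def expo (ω x : ℝ) : ℂ :=
  Complex.exp (2 * (Real.pi : ℂ) * Complex.I * (ω : ℂ) * (x : ℂ))

/-- Membership in `L₂^{(m)}[a,b]` (for `1 ≤ m`, `a < b`): the complex-valued function `φ` has an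
absolutely continuous derivative of order `m - 1` on `[a,b]`, and its derivative of order `m`
(which then exists almost everywhere) is square integrable on `[a,b]`. At the end points the
derivatives are one-sided. -/
def MemSobolev (m : ℕ) (a b : ℝ) (φ : ℝ → ℂ) : Prop :=
  ContDiffOn ℝ ((m - 1 : ℕ) : WithTop ℕ∞) φ (Set.Icc a b) ∧
  AbsolutelyContinuousOnInterval (iteratedDerivWithin (m - 1) φ (Set.Icc a b)) a b ∧
  MeasureTheory.MemLp (iteratedDerivWithin m φ (Set.Icc a b)) 2
    (MeasureTheory.volume.restrict (Set.Icc a b))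

/-- The (semi)norm `(∫_a^b |φ^{(m)}(x)|² dx)^{1/2}` of `L₂^{(m)}[a,b]`. -/
def sobolevNorm (m : ℕ) (a b : ℝ) (φ : ℝ → ℂ) : ℝ :=
  Real.sqrt (∫ x in a..b, ‖iteratedDerivWithin m φ (Set.Icc a b) x‖ ^ 2)

/-- The error functional
`(ℓ,φ) = ∫_a^b e^{2πiωx} φ(x) dx - ∑_{β=0}^N C_β φ(hβ + a)`, `h = (b - a)/N`,
of the quadrature formula with coefficients `C_0, …, C_N`. -/
def quadError (N : ℕ) (a b ω : ℝ) (C : Fin (N + 1) → ℂ) (φ : ℝ → ℂ) : ℂ :=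
  (∫ x in a..b, expo ω x * φ x) -
    ∑ β : Fin (N + 1), C β * φ ((b - a) / (N : ℝ) * ((β : ℕ) : ℝ) + a)

/-- The norm of the error functional in the dual of `L₂^{(m)}[a,b]`: the supremum of `|(ℓ,φ)|`
over the unit ball, with value `∞` when the functional is unbounded. -/
def errorNorm (m N : ℕ) (a b ω : ℝ) (C : Fin (N + 1) → ℂ) : ℝ≥0∞ :=
  ⨆ φ ∈ {φ : ℝ → ℂ | MemSobolev m a b φ ∧ sobolevNorm m a b φ ≤ 1},
    ENNReal.ofReal ‖quadError N a b ω C φ‖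

/-- `C` are optimal coefficients in the sense of Sard: the error functional is defined on
`L₂^{(m)}[a,b]` (it vanishes on the polynomials of degree less than `m`), and its norm is the
infimum of the norms over all choices of coefficients. -/
def IsSardOptimal (m N : ℕ) (a b ω : ℝ) (C : Fin (N + 1) → ℂ) : Prop :=
  (∀ α : ℕ, α < m → quadError N a b ω C (fun x => (x : ℂ) ^ α) = 0) ∧
  errorNorm m N a b ω C = ⨅ C' : Fin (N + 1) → ℂ, errorNorm m N a b ω C'

/-- The Euler-Frobenius polynomials
`E_k(x) = (1-x)^{k+2}/x · (x d/dx)^k (x/(1-x)^2)`, given by the recursion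
that this formula yields; see `eulerFrobenius_eval` for the formula itself. -/
def eulerFrobenius : ℕ → ℤ[X]
  | 0 => 1
  | k + 1 => (1 + ((k + 1 : ℕ) : ℤ[X]) * Polynomial.X) * eulerFrobenius k +
      Polynomial.X * (1 - Polynomial.X) * Polynomial.derivative (eulerFrobenius k)

theorem iterate_eq_eulerFrobenius (k : ℕ) : ∀ x : ℂ, x ≠ 1 →
    ((fun (f : ℂ → ℂ) (y : ℂ) => y * deriv f y)^[k] (fun y => y / (1 - y) ^ 2)) x =
      x * Polynomial.aeval x (eulerFrobenius k) / (1 - x) ^ (k + 2) := by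
  induction k with
  | zero => intro x _; simp [eulerFrobenius]
  | succ k ih =>
    intro x hx
    rw [Function.iterate_succ_apply']
    have hx' : (1 - x) ≠ 0 := sub_ne_zero.mpr (Ne.symm hx)
    have hev : ((fun (f : ℂ → ℂ) (y : ℂ) => y * deriv f y)^[k] (fun y => y / (1 - y) ^ 2))
        =ᶠ[nhds x] fun x => x * Polynomial.aeval x (eulerFrobenius k) / (1 - x) ^ (k + 2) := by
      filter_upwards [isOpen_ne.mem_nhds hx] with y hy using ih y hy
    have h1 : HasDerivAt (fun x : ℂ => Polynomial.aeval x (eulerFrobenius k))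
        (Polynomial.aeval x (Polynomial.derivative (eulerFrobenius k))) x :=
      Polynomial.hasDerivAt_aeval _ _
    have h2 : HasDerivAt (fun x : ℂ => (1 - x) ^ (k + 2))
        (((k + 2 : ℕ) : ℂ) * (1 - x) ^ (k + 1) * (-1)) x := by
      simpa using ((hasDerivAt_id x).const_sub 1).fun_pow (k + 2)
    have h3 := ((hasDerivAt_id x).mul h1).div h2 (pow_ne_zero _ hx')
    have h4 := hev.deriv_eq.trans h3.deriv
    simp only [h4, eulerFrobenius, map_add, map_mul, map_one, map_sub, Polynomial.aeval_X,
      map_natCast, id]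
    push_cast
    simp only [Pi.mul_apply, id]
    field_simp
    ring

/-- The defining formula of the Euler-Frobenius polynomials. -/
theorem eulerFrobenius_eval (k : ℕ) (x : ℂ) (h0 : x ≠ 0) (h1 : x ≠ 1) :
    Polynomial.aeval x (eulerFrobenius k) = (1 - x) ^ (k + 2) / x *
      ((fun (f : ℂ → ℂ) (y : ℂ) => y * deriv f y)^[k] (fun y => y / (1 - y) ^ 2)) x := by
  have hx' : (1 - x) ≠ 0 := sub_ne_zero.mpr (Ne.symm h1)
  rw [iterate_eq_eulerFrobenius k x h1]
  field_simp

/-- The coefficient `a_α = ∑_{j=0}^α (-1)^j binom(2m,j) (α+1-j)^{2m-1}` of `x^α` in the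
Euler-Frobenius polynomial `E_{2m-2}`. -/
def eulerCoeff (m α : ℕ) : ℤ :=
  ∑ j ∈ Finset.range (α + 1),
    (-1) ^ j * ((2 * m).choose j : ℤ) * ((α : ℤ) + 1 - (j : ℤ)) ^ (2 * m - 1)

/-- `Δ^t 0^j = ∑_{l=1}^t (-1)^{t-l} binom(t,l) l^j`. -/
def diffZero (t j : ℕ) : ℤ :=
  ∑ l ∈ Finset.Icc 1 t, (-1) ^ (t - l) * (t.choose l : ℤ) * (l : ℤ) ^ j

/-- The constant `K_{ω,m}` for the step `h`. -/
def constK (m : ℕ) (ω h : ℝ) : ℝ :=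
  (Real.sin (Real.pi * ω * h) / (Real.pi * ω * h)) ^ (2 * m) *
    (((2 * m - 1).factorial : ℝ) /
      (2 * ∑ α ∈ Finset.range (m - 1),
          (eulerCoeff m α : ℝ) * Real.cos (2 * Real.pi * ω * h * ((m : ℝ) - 1 - (α : ℝ)))
        + (eulerCoeff m (m - 1) : ℝ)))

/-- The complex number `2πiωh`. -/
def phase (ω h : ℝ) : ℂ :=
  2 * (Real.pi : ℂ) * Complex.I * (ω : ℂ) * (h : ℂ)

/-- The `j`-th equation of the first family of the linear system for `a_k = A k`, `b_k = B k`. -/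
def FirstEquation (m N : ℕ) (a ω h : ℝ) (q : Fin (m - 1) → ℝ) (A B : Fin (m - 1) → ℂ)
    (j : ℕ) : Prop :=
  (∑ k, A k * ∑ t ∈ Finset.Icc 1 j,
      (q k : ℂ) * (diffZero t j : ℂ) / ((q k : ℂ) - 1) ^ (t + 1)) +
  (∑ k, B k * ∑ t ∈ Finset.Icc 1 j,
      (q k : ℂ) ^ (N + t) * (diffZero t j : ℂ) / (1 - (q k : ℂ)) ^ (t + 1)) =
  (j.factorial : ℂ) * expo ω a / phase ω h ^ (j + 1) -
    ∑ t ∈ Finset.Icc 1 j,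
      expo ω (a + h) * (constK m ω h : ℂ) * (diffZero t j : ℂ) / (expo ω h - 1) ^ (t + 1)

/-- The `j`-th equation of the second family of the linear system for `a_k = A k`, `b_k = B k`. -/
def SecondEquation (m N : ℕ) (a b ω h : ℝ) (q : Fin (m - 1) → ℝ) (A B : Fin (m - 1) → ℂ)
    (j : ℕ) : Prop :=
  (∑ k, A k *
      ((∑ t ∈ Finset.Icc 1 j,
          (q k : ℂ) ^ t * (diffZero t j : ℂ) / (1 - (q k : ℂ)) ^ (t + 1)) -
        ∑ α ∈ Finset.Icc 1 j, ((h / (b - a) : ℝ) : ℂ) ^ ((α : ℤ) - (j : ℤ)) * (j.choose α : ℂ) *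
          ∑ t ∈ Finset.Icc 1 α,
            (q k : ℂ) ^ (N + t) * (diffZero t α : ℂ) / (1 - (q k : ℂ)) ^ (t + 1))) +
  (∑ k, B k *
      ((∑ t ∈ Finset.Icc 1 j,
          (q k : ℂ) ^ (N + 1) * (diffZero t j : ℂ) / ((q k : ℂ) - 1) ^ (t + 1)) -
        ∑ α ∈ Finset.Icc 1 j, ((h / (b - a) : ℝ) : ℂ) ^ ((α : ℤ) - (j : ℤ)) * (j.choose α : ℂ) *
          ∑ t ∈ Finset.Icc 1 α,
            (q k : ℂ) * (diffZero t α : ℂ) / ((q k : ℂ) - 1) ^ (t + 1))) =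
  (-1) ^ (j + 1) * (j.factorial : ℂ) * expo ω a / phase ω h ^ (j + 1) +
    (∑ α ∈ Finset.Icc 1 j, ((h / (b - a) : ℝ) : ℂ) ^ ((α : ℤ) - (j : ℤ)) *
      ((-1) ^ α * (j.factorial : ℂ) * expo ω b /
        (((j - α).factorial : ℂ) * phase ω h ^ (α + 1)))) -
    (constK m ω h : ℂ) * expo ω a / (1 - expo ω h) *
      (∑ t ∈ Finset.Icc 1 j, (expo ω h / (1 - expo ω h)) ^ t * (diffZero t j : ℂ)) +
    (constK m ω h : ℂ) * expo ω b / (1 - expo ω h) *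
      ∑ α ∈ Finset.Icc 1 j, ((h / (b - a) : ℝ) : ℂ) ^ ((α : ℤ) - (j : ℤ)) * (j.choose α : ℂ) *
        ∑ t ∈ Finset.Icc 1 α, (expo ω h / (1 - expo ω h)) ^ t * (diffZero t α : ℂ)

/-- The system of `2m - 2` linear equations for `a_k = A k`, `b_k = B k`. -/
def SolvesSystem (m N : ℕ) (a b ω h : ℝ) (q : Fin (m - 1) → ℝ) (A B : Fin (m - 1) → ℂ) : Prop :=
  (∀ j ∈ Finset.Icc 1 (m - 1), FirstEquation m N a ω h q A B j) ∧
  (∀ j ∈ Finset.Icc 1 (m - 1), SecondEquation m N a b ω h q A B j)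

end

end SardQuadrature

open SardQuadrature

/-! Optimality is a best-approximation problem in L². Let K_j be `errorKernel` of order j, so that
K_{j+1}' = K_j. If an error functional kills the polynomials of degree < m, m integrations by parts
turn it into (-1)^m ∫ K_{m-1} φ^(m), so its norm is the L² norm of K_{m-1}; if it does not kill
them, its norm is ∞. The conjugate of K_{2m-1} has m-th derivative conj K_{m-1}. Suppose K_{2m-1}
agrees at the nodes with a polynomial of degree < m. A difference of two exact coefficient vectors
is a combination of node values killing such polynomials, so it also kills conj K_{2m-1}; its kernel
is therefore orthogonal to K_{m-1}, and Pythagoras gives minimality and uniqueness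
(`kernelSq_eq_add`, `isSardOptimal_iff_eq`). What remains is to find exact coefficients with this
interpolation property.

In units of the step, K_{2m-1} at node γ is a truncated integral minus a truncated sum of (γ -
s)^(2m-1). The interior coefficients are combinations of geometric progressions with ratios l =
e^{2πiωh}, q_k and 1/q_k. For a progression times a polynomial, the truncated sum is a regularised
sum over β ≥ 0 minus one over β ≥ γ, where the regularised sum of ρ^β β^j is the rational function
R_j(ρ/(1-ρ)), whatever |ρ| is (`sum_pow_mul_eval`); integrals behave alike. The part coming from γ
involves only the moment of order 2m-1. It vanishes because R_{2m-1}(ρ/(1-ρ)) is a multiple of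
E_{2m-2}(ρ), which is zero at q_k and 1/q_k, and because K_{ω,m} makes the ratio l cancel the
integral (`solTail_X_pow_top`). The part coming from 0 is a polynomial in γ, and its degree drops
below m once the moments of orders 1, …, m-1 at the left end vanish: this is the first family of
equations. The end weights C_0 and C_N make the formula exact on constants, and the second family is
exactness in degrees 1, …, m-1.

Unique solvability is the same theory with the weight function multiplied by ε = 0. A homogeneous
solution yields coefficients whose kernel is orthogonal to itself, hence zero. The polynomial in γ
then vanishes at N + 1 ≥ m nodes, so it is zero and all end moments up to order 2m-1 vanish; since
the ratios are distinct, 2m-2 of them already kill the amplitudes (`eq_zero_of_sum_powerSumPoly`).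

The roots of E_{2m-2} come from repeated use of Rolle's theorem on the R_j, which shows that they
are real and simple; the symmetry ρ ↦ 1/ρ puts half of them inside the unit circle. -/

open Polynomial in
/-- The polynomials `R_j` with `R_j(ρ/(1-ρ)) = ∑ ρ^β β^j`, the sum over all `β ≥ 0`. -/
noncomputable def powerSumPoly : ℕ → ℤ[X]
  | 0 => 1 + X
  | j + 1 => X * (1 + X) * derivative (powerSumPoly j)

/-! ### Polynomials of regularised power sums -/

section PowerSumPoly

open Polynomial

theorem powerSumPoly_succ (j : ℕ) :
    powerSumPoly (j + 1) = X * (1 + X) * derivative (powerSumPoly j) := rfl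

theorem sum_choose_powerSumPoly_succ (j : ℕ) :
    ∑ α ∈ Finset.range (j + 2), ((j + 1).choose α : ℤ[X]) * powerSumPoly α =
      (∑ α ∈ Finset.range (j + 1), (j.choose α : ℤ[X]) * powerSumPoly α) +
      ∑ α ∈ Finset.range (j + 1), (j.choose α : ℤ[X]) * powerSumPoly (α + 1) := by
  rw [Finset.sum_range_succ' _ (j + 1)]
  have h1 : ∀ α, (((j + 1).choose (α + 1) : ℕ) : ℤ[X]) * powerSumPoly (α + 1) =
      (j.choose α : ℤ[X]) * powerSumPoly (α + 1) +
      (j.choose (α + 1) : ℤ[X]) * powerSumPoly (α + 1) := by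
    intro α; rw [Nat.choose_succ_succ]; push_cast; ring
  rw [Finset.sum_congr rfl (fun α _ => h1 α), Finset.sum_add_distrib,
    Finset.sum_range_succ (fun α => (j.choose (α + 1) : ℤ[X]) * powerSumPoly (α + 1)) j,
    Finset.sum_range_succ' (fun α => (j.choose α : ℤ[X]) * powerSumPoly α) j]
  simp
  ring

/-- At X = ρ/(1-ρ), after multiplication by 1-ρ, this reads ∑ ρ^β β^j - ρ ∑ ρ^β (β+1)^j = 0^j: the
series minus its shift is its initial term. The induction applies X(1+X) d/dX, which is ρ d/dρ, to
the previous case. -/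
theorem powerSumPoly_rec (j : ℕ) :
    (1 + X) * powerSumPoly j -
      X * ∑ α ∈ Finset.range (j + 1), (j.choose α : ℤ[X]) * powerSumPoly α =
    if j = 0 then 1 + X else 0 := by
  induction j with
  | zero => simp [powerSumPoly]; ring
  | succ j ih =>
    rw [sum_choose_powerSumPoly_succ]
    have hd := congrArg derivative ih
    have hs : ∑ α ∈ Finset.range (j + 1), (j.choose α : ℤ[X]) * powerSumPoly (α + 1) =
        X * (1 + X) * derivative
          (∑ α ∈ Finset.range (j + 1), (j.choose α : ℤ[X]) * powerSumPoly α) := by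
      rw [derivative_sum, Finset.mul_sum]
      refine Finset.sum_congr rfl fun α _ => ?_
      rw [powerSumPoly_succ, derivative_mul, derivative_natCast]
      ring
    rw [hs, powerSumPoly_succ]
    generalize (∑ α ∈ Finset.range (j + 1), (j.choose α : ℤ[X]) * powerSumPoly α) = U at *
    generalize powerSumPoly j = R at *
    rw [if_neg (Nat.succ_ne_zero j)]
    by_cases hj : j = 0
    · simp only [hj, if_true] at ih hd
      simp only [derivative_sub, derivative_mul, derivative_add, derivative_one,
        derivative_X] at hd
      linear_combination X * (1 + X) * hd - X * ih
    · simp only [hj, if_false] at ih hd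
      simp only [derivative_sub, derivative_mul, derivative_add, derivative_one,
        derivative_X, derivative_zero] at hd
      linear_combination X * (1 + X) * hd - X * ih

/-- The recurrence of t! S(j,t) with S the Stirling numbers of the second kind; it holds term by
term from Pascal's rule and absorption. -/
theorem diffZero_succ (t j : ℕ) :
    diffZero (t + 1) (j + 1) = (t + 1) * (diffZero (t + 1) j + diffZero t j) := by
  have h2 : diffZero t j =
      ∑ l ∈ Finset.Icc 1 (t + 1), (-1) ^ (t - l) * (t.choose l : ℤ) * (l : ℤ) ^ j := by
    rw [Finset.sum_Icc_succ_top (by omega)]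
    simp [diffZero]
  rw [h2]
  unfold diffZero
  rw [← Finset.sum_add_distrib, Finset.mul_sum]
  refine Finset.sum_congr rfl fun l hl => ?_
  obtain ⟨h1, h3⟩ := Finset.mem_Icc.mp hl
  obtain ⟨l, rfl⟩ : ∃ k, l = k + 1 := ⟨l - 1, by omega⟩
  have e1 : ((t + 1).choose (l + 1) : ℤ) * (l + 1) = (t + 1) * t.choose l := by
    exact_mod_cast (Nat.add_one_mul_choose_eq t l).symm
  have e2 : ((t + 1).choose (l + 1) : ℤ) = t.choose l + t.choose (l + 1) := by
    exact_mod_cast Nat.choose_succ_succ t l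
  rcases Nat.lt_or_ge l t with hlt | hge
  · obtain ⟨s, hs⟩ : ∃ s, t = l + 1 + s := ⟨t - (l + 1), by omega⟩
    have : t + 1 - (l + 1) = s + 1 := by omega
    have h4 : t - (l + 1) = s := by omega
    rw [this, h4]
    push_cast
    linear_combination (-1 : ℤ) ^ (s + 1) * ((l : ℤ) + 1) ^ j * e1 -
      (-1 : ℤ) ^ (s + 1) * ((l : ℤ) + 1) ^ j * (t + 1) * e2
  · have : t = l := by omega
    subst this
    simp [pow_succ]
    ring

/-- The defining sum starts at l = 1, so the l = 0 term (-1)^t of the alternating binomial sum is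
missing; this matters only for exponent 0. -/
theorem diffZero_zero (t : ℕ) : diffZero t 0 = (if t = 0 then 1 else 0) - (-1) ^ t := by
  have h : (∑ l ∈ Finset.range (t + 1), (-1 : ℤ) ^ l * (t.choose l : ℤ)) =
      if t = 0 then 1 else 0 := Int.alternating_sum_range_choose
  have h2 : (∑ l ∈ Finset.range (t + 1), (-1 : ℤ) ^ (t - l) * (t.choose l : ℤ)) =
      if t = 0 then 1 else 0 := by
    rw [← h, ← Finset.sum_range_reflect]
    refine Finset.sum_congr rfl fun l hl => ?_
    have hl' : l ≤ t := by simpa [Nat.lt_succ_iff] using hl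
    rw [show t + 1 - 1 - l = t - l by omega, Nat.choose_symm hl',
      show t - (t - l) = l by omega]
  rw [Finset.sum_range_succ'] at h2
  unfold diffZero
  rw [show Finset.Icc 1 t = Finset.Ico 1 (t + 1) by ext; simp,
    Finset.sum_Ico_eq_sum_range]
  simp only [Nat.add_sub_cancel, pow_zero, mul_one]
  simp only [Nat.choose_zero_right, Nat.cast_one, mul_one, Nat.sub_zero] at h2
  rw [← h2, add_sub_cancel_right]
  simp only [add_comm 1]

theorem diffZero_of_gt {j : ℕ} : ∀ {t : ℕ}, 1 ≤ j → j < t → diffZero t j = 0 := by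
  induction j with
  | zero => intro t h; omega
  | succ j ih =>
    intro t _ ht
    obtain ⟨t, rfl⟩ : ∃ s, t = s + 1 := ⟨t - 1, by omega⟩
    rw [diffZero_succ]
    rcases Nat.eq_zero_or_pos j with rfl | hj
    · rw [diffZero_zero, diffZero_zero]
      have : t ≠ 0 := by omega
      simp [this, pow_succ]
    · rw [ih hj (by omega), ih hj (by omega)]; simp

theorem powerSumPoly_eq_sum (j : ℕ) :
    powerSumPoly (j + 1) =
      (1 + X) * ∑ t ∈ Finset.Icc 1 (j + 1), (diffZero t (j + 1) : ℤ[X]) * X ^ t := by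
  induction j with
  | zero =>
    simp [powerSumPoly, diffZero]; ring
  | succ j ih =>
    rw [powerSumPoly_succ, ih]
    -- Both boundary terms vanish, so the same sum can be indexed over `range (j + 2)` by t as well
    -- as by t + 1, which the two terms of `diffZero_succ` require.
    have hz : diffZero (j + 2) (j + 1) = 0 := diffZero_of_gt (by omega) (by omega)
    have h0 : diffZero 0 (j + 1) = 0 := by simp [diffZero]
    have e1 : ∑ t ∈ Finset.Icc 1 (j + 1), (diffZero t (j + 1) : ℤ[X]) * X ^ t =
        ∑ t ∈ Finset.range (j + 2), (diffZero (t + 1) (j + 1) : ℤ[X]) * X ^ (t + 1) := by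
      rw [show Finset.Icc 1 (j + 1) = Finset.Ico 1 (j + 2) by ext; simp; omega,
        Finset.sum_Ico_eq_sum_range, Finset.sum_range_succ _ (j + 1), hz]
      simp [add_comm 1]
    have e2 : ∑ t ∈ Finset.Icc 1 (j + 1), (diffZero t (j + 1) : ℤ[X]) * X ^ t =
        ∑ t ∈ Finset.range (j + 2), (diffZero t (j + 1) : ℤ[X]) * X ^ t := by
      rw [show Finset.Icc 1 (j + 1) = Finset.Ico 1 (j + 2) by ext; simp; omega,
        Finset.sum_Ico_eq_sum_range, Finset.sum_range_succ' _ (j + 1), h0]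
      simp [add_comm 1]
    have e3 : ∑ t ∈ Finset.Icc 1 (j + 1 + 1), (diffZero t (j + 1 + 1) : ℤ[X]) * X ^ t =
        ∑ t ∈ Finset.range (j + 2), (diffZero (t + 1) (j + 2) : ℤ[X]) * X ^ (t + 1) := by
      rw [show Finset.Icc 1 (j + 1 + 1) = Finset.Ico 1 (j + 3) by ext; simp; omega,
        Finset.sum_Ico_eq_sum_range]
      simp [add_comm 1]
    have key : ∑ t ∈ Finset.Icc 1 (j + 1 + 1), (diffZero t (j + 1 + 1) : ℤ[X]) * X ^ t =
        X * derivative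
          ((1 + X) * ∑ t ∈ Finset.Icc 1 (j + 1), (diffZero t (j + 1) : ℤ[X]) * X ^ t) := by
      rw [e3, add_mul, one_mul, derivative_add, mul_add]
      nth_rewrite 1 [e1]
      rw [e2, Finset.mul_sum, derivative_sum, derivative_sum, Finset.mul_sum, Finset.mul_sum,
        ← Finset.sum_add_distrib]
      refine Finset.sum_congr rfl fun t _ => ?_
      rw [diffZero_succ]
      have : X * (((diffZero t (j + 1) : ℤ) : ℤ[X]) * X ^ t) =
        ((diffZero t (j + 1) : ℤ) : ℤ[X]) * X ^ (t + 1) := by ring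
      rw [this]
      simp only [derivative_mul, derivative_intCast, derivative_X_pow]
      push_cast
      simp only [map_natCast, map_add, map_one]
      ring
    rw [key]
    ring

/-- Replacing ρ by 1/ρ sends ρ/(1-ρ) to -1 - ρ/(1-ρ). This reflection fixes X(1+X) and changes the
sign of each derivative. -/
theorem powerSumPoly_comp_reflect (k : ℕ) :
    (powerSumPoly (k + 1)).comp (-1 - X) = (-1) ^ k * powerSumPoly (k + 1) := by
  induction k with
  | zero => simp [powerSumPoly]; ring
  | succ k ih =>
    have h := congrArg derivative ih
    rw [derivative_comp] at h
    have hc : derivative ((-1 : ℤ[X]) ^ k * powerSumPoly (k + 1)) =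
        (-1) ^ k * derivative (powerSumPoly (k + 1)) := by
      rw [show ((-1 : ℤ[X]) ^ k) = C ((-1) ^ k) by simp, derivative_C_mul]
    rw [hc] at h
    simp only [derivative_sub, derivative_neg, derivative_one, derivative_X] at h
    rw [powerSumPoly_succ, mul_comp, mul_comp, X_comp, add_comp, one_comp, X_comp, pow_succ]
    linear_combination (-X * (1 + X)) * h

/-- The substitution z = x/(1-x) turns x d/dx into z(1+z) d/dz, so both sides come from iterating
the same operator. -/
theorem aeval_powerSumPoly_succ (k : ℕ) : ∀ x : ℂ, x ≠ 1 →
    aeval (x / (1 - x)) (powerSumPoly (k + 1)) =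
      x * aeval x (eulerFrobenius k) / (1 - x) ^ (k + 2) := by
  intro x hx
  rw [← iterate_eq_eulerFrobenius k x hx]
  induction k generalizing x with
  | zero =>
    have hx' : (1 - x) ≠ 0 := sub_ne_zero.mpr (Ne.symm hx)
    simp [powerSumPoly]
    field_simp
    ring
  | succ k ih =>
    have hx' : (1 - x) ≠ 0 := sub_ne_zero.mpr (Ne.symm hx)
    rw [Function.iterate_succ_apply']
    have hev : ((fun (f : ℂ → ℂ) (y : ℂ) => y * deriv f y)^[k] (fun y => y / (1 - y) ^ 2))
        =ᶠ[nhds x] fun x => aeval (x / (1 - x)) (powerSumPoly (k + 1)) := by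
      filter_upwards [isOpen_ne.mem_nhds hx] with y hy using (ih y hy).symm
    have h1 : HasDerivAt (fun x : ℂ => x / (1 - x)) ((1 * (1 - x) - x * (-1)) / (1 - x) ^ 2) x :=
      (hasDerivAt_id x).div (by simpa using (hasDerivAt_id x).const_sub 1) hx'
    have h2 : HasDerivAt (fun x : ℂ => aeval (x / (1 - x)) (powerSumPoly (k + 1)))
        (aeval (x / (1 - x)) (derivative (powerSumPoly (k + 1))) *
          ((1 * (1 - x) - x * (-1)) / (1 - x) ^ 2)) x :=
      HasDerivAt.comp (h₂ := fun y : ℂ => aeval y (powerSumPoly (k + 1))) x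
        (Polynomial.hasDerivAt_aeval (powerSumPoly (k + 1)) (x / (1 - x))) h1
    simp only [hev.deriv_eq, h2.deriv]
    rw [powerSumPoly_succ]
    simp only [map_mul, map_add, map_one, aeval_X]
    field_simp
    ring

theorem natDegree_powerSumPoly_le (j : ℕ) : (powerSumPoly j).natDegree ≤ j + 1 := by
  induction j with
  | zero => unfold powerSumPoly; compute_degree
  | succ j ih =>
    rw [powerSumPoly_succ]
    refine natDegree_mul_le.trans ?_
    have h1 : (X * (1 + X) : ℤ[X]).natDegree ≤ 2 := by compute_degree
    have h2 := natDegree_derivative_le (powerSumPoly j)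
    omega

theorem coeff_powerSumPoly (j : ℕ) : (powerSumPoly j).coeff (j + 1) = j.factorial := by
  induction j with
  | zero => simp [powerSumPoly, coeff_one]
  | succ j ih =>
    have h : (derivative (powerSumPoly j)).coeff (j + 1) = 0 := by
      refine coeff_eq_zero_of_natDegree_lt ?_
      have h2 := natDegree_derivative_le (powerSumPoly j)
      have := natDegree_powerSumPoly_le j
      omega
    rw [powerSumPoly_succ, show X * (1 + X) * derivative (powerSumPoly j) =
      X * (derivative (powerSumPoly j) + X * derivative (powerSumPoly j)) by ring]
    rw [coeff_X_mul, coeff_add, h, coeff_X_mul, coeff_derivative, ih, Nat.factorial_succ]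
    push_cast; ring

/-- Rolle's theorem: the derivative of a polynomial with k + 2 real roots has at least k + 1 roots
that are not roots of it, and the factor X(1+X) contributes 0 and -1, which are old roots and hence
different from the new ones. -/
theorem le_card_roots_powerSumPoly (k : ℕ) :
    k + 2 ≤ ((powerSumPoly (k + 1)).map (Int.castRingHom ℝ)).roots.toFinset.card := by
  have hne : ∀ j, (powerSumPoly j).map (Int.castRingHom ℝ) ≠ 0 := by
    intro j h
    have := congrArg (fun p => coeff p (j + 1)) h
    simp [coeff_powerSumPoly, Nat.factorial_ne_zero] at this
  have hends : ∀ j, ({0, -1} : Finset ℝ) ⊆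
      ((powerSumPoly (j + 1)).map (Int.castRingHom ℝ)).roots.toFinset := by
    intro j x hx
    rw [Multiset.mem_toFinset, mem_roots (hne _)]
    simp only [Finset.mem_insert, Finset.mem_singleton] at hx
    rcases hx with rfl | rfl <;> simp [powerSumPoly]
  induction k with
  | zero =>
    refine le_trans ?_ (Finset.card_le_card (hends 0))
    rw [Finset.card_pair (by norm_num)]
  | succ k ih =>
    set p := (powerSumPoly (k + 1)).map (Int.castRingHom ℝ) with hp
    have h := p.card_roots_toFinset_le_card_roots_derivative_sdiff_roots_succ
    have hsub : ({0, -1} : Finset ℝ) ∪ (p.derivative.roots.toFinset \ p.roots.toFinset) ⊆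
        ((powerSumPoly (k + 1 + 1)).map (Int.castRingHom ℝ)).roots.toFinset := by
      refine Finset.union_subset (hends _) fun x hx => ?_
      have hx' := (Finset.mem_sdiff.mp hx).1
      rw [Multiset.mem_toFinset] at hx'
      rw [Multiset.mem_toFinset, mem_roots (hne _), powerSumPoly_succ]
      have := isRoot_of_mem_roots hx'
      simp only [IsRoot, Polynomial.map_mul, eval_mul, derivative_map, hp] at this ⊢
      rw [this, mul_zero]
    have hdisj : Disjoint ({0, -1} : Finset ℝ)
        (p.derivative.roots.toFinset \ p.roots.toFinset) :=
      Finset.disjoint_of_subset_left (hends k) Finset.disjoint_sdiff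
    have := Finset.card_le_card hsub
    rw [Finset.card_union_of_disjoint hdisj, Finset.card_pair (by norm_num)] at this
    omega

end PowerSumPoly

/-! ### Euler-Frobenius polynomials: coefficients, roots and the constant K -/

section EulerFrobenius

open Polynomial

theorem natDegree_eulerFrobenius_le (k : ℕ) : (eulerFrobenius k).natDegree ≤ k := by
  induction k with
  | zero => simp [eulerFrobenius]
  | succ k ih =>
    rw [eulerFrobenius]
    refine natDegree_add_le_of_degree_le ?_ ?_
    · have : (1 + ((k + 1 : ℕ) : ℤ[X]) * X).natDegree ≤ 1 := by compute_degree
      exact (natDegree_mul_le.trans (add_le_add this ih)).trans (by omega)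
    · have h1 : (X * (1 - X) : ℤ[X]).natDegree ≤ 2 := by compute_degree
      have h2 := natDegree_derivative_le (eulerFrobenius k)
      rcases Nat.eq_zero_or_pos k with rfl | hk
      · simp [eulerFrobenius]
      · exact natDegree_mul_le.trans (by omega)

theorem coeff_eulerFrobenius_zero (k : ℕ) : (eulerFrobenius k).coeff 0 = 1 := by
  induction k with
  | zero => simp [eulerFrobenius]
  | succ k ih => simp [eulerFrobenius, mul_coeff_zero, ih]

theorem coeff_eulerFrobenius_succ (k j : ℕ) :
    (eulerFrobenius (k + 1)).coeff (j + 1) =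
      (j + 2) * (eulerFrobenius k).coeff (j + 1) +
        ((k : ℤ) + 1 - j) * (eulerFrobenius k).coeff j := by
  have h : eulerFrobenius (k + 1) = eulerFrobenius k +
      X * (C ((k : ℤ) + 1) * eulerFrobenius k + derivative (eulerFrobenius k)
        - X * derivative (eulerFrobenius k)) := by
    rw [eulerFrobenius, C_add, C_1]
    simp only [Nat.cast_add, Nat.cast_one, map_natCast]
    ring
  rw [h, coeff_add, coeff_X_mul, coeff_sub, coeff_add, coeff_C_mul, coeff_derivative]
  cases j with
  | zero => simp; ring
  | succ j => rw [coeff_X_mul, coeff_derivative]; push_cast; ring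

theorem coeff_eulerFrobenius_symm (k : ℕ) : ∀ i j : ℕ, i + j = k →
    (eulerFrobenius k).coeff i = (eulerFrobenius k).coeff j := by
  induction k with
  | zero => intro i j h; rw [show i = 0 by omega, show j = 0 by omega]
  | succ k ih =>
    have h0 : (eulerFrobenius k).coeff (k + 1) = 0 :=
      coeff_eq_zero_of_natDegree_lt (Nat.lt_succ_of_le (natDegree_eulerFrobenius_le k))
    have hk : (eulerFrobenius (k + 1)).coeff (k + 1) = 1 := by
      rw [coeff_eulerFrobenius_succ, h0, ← ih 0 k (by omega), coeff_eulerFrobenius_zero]; ring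
    intro i j h
    rcases i with _ | i
    · rw [show j = k + 1 by omega, hk, coeff_eulerFrobenius_zero]
    rcases j with _ | j
    · rw [show i + 1 = k + 1 by omega, hk, coeff_eulerFrobenius_zero]
    rw [coeff_eulerFrobenius_succ, coeff_eulerFrobenius_succ, ih (i + 1) j (by omega),
      ih i (j + 1) (by omega)]
    have : (k : ℤ) = i + j + 1 := by exact_mod_cast (by omega : k = i + j + 1)
    rw [this]; ring

/-- The alternating sums obey the recurrence `coeff_eulerFrobenius_succ`, by Pascal's rule and the
ratio of neighbouring binomial coefficients. -/
theorem coeff_eulerFrobenius (k j : ℕ) :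
    (eulerFrobenius k).coeff j =
      ∑ i ∈ Finset.range (j + 1),
        (-1) ^ i * ((k + 2).choose i : ℤ) * ((j : ℤ) + 1 - i) ^ (k + 1) := by
  induction k generalizing j with
  | zero =>
    rcases j with _ | _ | j
    · simp [eulerFrobenius]
    · simp [eulerFrobenius, coeff_one, Finset.sum_range_succ]
    · rw [Finset.sum_range_succ', Finset.sum_range_succ', Finset.sum_range_succ',
        Finset.sum_eq_zero]
      · simp [eulerFrobenius, coeff_one]; ring
      · intro i _
        rw [Nat.choose_eq_zero_of_lt (by omega)]; simp
  | succ k ih =>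
    rcases j with _ | j
    · simp [coeff_eulerFrobenius_zero]
    rw [coeff_eulerFrobenius_succ, ih, ih, Finset.sum_range_succ' _ (j + 1),
      Finset.sum_range_succ' _ (j + 1), mul_add, Finset.mul_sum, Finset.mul_sum]
    have key : ∀ i : ℕ, (-1 : ℤ) ^ (i + 1) * ((k + 1 + 2).choose (i + 1) : ℤ) *
          (((j + 1 : ℕ) : ℤ) + 1 - ((i + 1 : ℕ) : ℤ)) ^ (k + 1 + 1) =
        ((j : ℤ) + 2) * ((-1 : ℤ) ^ (i + 1) * ((k + 2).choose (i + 1) : ℤ) *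
          (((j + 1 : ℕ) : ℤ) + 1 - ((i + 1 : ℕ) : ℤ)) ^ (k + 1)) +
        ((k : ℤ) + 1 - j) * ((-1 : ℤ) ^ i * ((k + 2).choose i : ℤ) *
          ((j : ℤ) + 1 - i) ^ (k + 1)) := by
      intro i
      have e1 : (((k + 1 + 2).choose (i + 1) : ℕ) : ℤ) =
          (k + 2).choose i + (k + 2).choose (i + 1) := by
        exact_mod_cast Nat.choose_succ_succ (k + 2) i
      have e2 : ((k + 2).choose (i + 1) : ℤ) * (i + 1) = (k + 2).choose i * (k + 2 - i) := by
        rcases Nat.lt_or_ge (k + 2) i with hlt | hge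
        · rw [Nat.choose_eq_zero_of_lt hlt, Nat.choose_eq_zero_of_lt (by omega)]; simp
        · have := Nat.choose_succ_right_eq (k + 2) i
          zify [hge] at this
          exact this
      rw [e1]
      push_cast
      rw [show (j : ℤ) + 1 + 1 - (i + 1) = j + 1 - i by ring]
      linear_combination (-1 : ℤ) ^ i * ((j : ℤ) + 1 - i) ^ (k + 1) * e2
    rw [Finset.sum_congr rfl (fun i _ => key i), Finset.sum_add_distrib]
    simp
    ring

theorem eulerCoeff_eq_coeff (m α : ℕ) (hm : 1 ≤ m) :
    eulerCoeff m α = (eulerFrobenius (2 * m - 2)).coeff α := by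
  rw [coeff_eulerFrobenius, eulerCoeff, show 2 * m - 2 + 2 = 2 * m by omega,
    show 2 * m - 2 + 1 = 2 * m - 1 by omega]

theorem eulerFrobenius_ne_zero (k : ℕ) : eulerFrobenius k ≠ 0 := fun h => by
  simpa [h] using coeff_eulerFrobenius_zero k

theorem aeval_eulerFrobenius_zero (k : ℕ) : aeval (0 : ℂ) (eulerFrobenius k) = 1 := by
  induction k with
  | zero => simp [eulerFrobenius]
  | succ k ih => simp [eulerFrobenius, ih]

theorem aeval_eulerFrobenius_one (k : ℕ) :
    aeval (1 : ℂ) (eulerFrobenius k) = ((k + 1).factorial : ℂ) := by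
  induction k with
  | zero => simp [eulerFrobenius]
  | succ k ih =>
    rw [eulerFrobenius, Nat.factorial_succ]
    simp only [map_add, map_mul, map_one, aeval_X, map_natCast, map_sub, ih]
    push_cast
    ring

/-- A zero x of E_k is a zero x/(1-x) of R_{k+1}, and inversion of x is the reflection under which
R_{k+1} is even or odd. -/
theorem aeval_eulerFrobenius_inv_eq_zero {k : ℕ} {x : ℂ}
    (h : aeval x (eulerFrobenius k) = 0) : aeval x⁻¹ (eulerFrobenius k) = 0 := by
  have h0 : x ≠ 0 := by rintro rfl; simp [aeval_eulerFrobenius_zero] at h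
  have h1 : x ≠ 1 := by
    rintro rfl; simp [aeval_eulerFrobenius_one, Nat.factorial_ne_zero] at h
  have h1' : (1 - x) ≠ 0 := sub_ne_zero.mpr (Ne.symm h1)
  have hi : x⁻¹ ≠ 1 := by simpa using h1
  have hi' : (1 - x⁻¹) ≠ 0 := sub_ne_zero.mpr (Ne.symm hi)
  have e1 := aeval_powerSumPoly_succ k x h1
  have e2 := aeval_powerSumPoly_succ k x⁻¹ hi
  have e3 := congrArg (aeval (x / (1 - x))) (powerSumPoly_comp_reflect k)
  rw [h, mul_zero, zero_div] at e1
  rw [map_mul, e1, mul_zero, aeval_comp] at e3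
  have hz : x⁻¹ / (1 - x⁻¹) = aeval (x / (1 - x)) (-1 - X : ℤ[X]) := by
    simp only [map_sub, map_neg, map_one, aeval_X]
    have hx1 : x - 1 ≠ 0 := sub_ne_zero.mpr h1
    have e : 1 - x⁻¹ = (x - 1) / x := by field_simp
    rw [e]
    field_simp
    ring
  rw [hz, e3] at e2
  have := (div_eq_zero_iff.mp e2.symm).resolve_right (pow_ne_zero _ hi')
  exact (mul_eq_zero.mp this).resolve_left (inv_ne_zero h0)

/-- The real roots of `E_k`. -/
noncomputable def realRoots (k : ℕ) : Finset ℝ :=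
  ((eulerFrobenius k).map (Int.castRingHom ℝ)).roots.toFinset

theorem mem_realRoots {k : ℕ} {x : ℝ} :
    x ∈ realRoots k ↔ aeval (x : ℂ) (eulerFrobenius k) = 0 := by
  have hne : (eulerFrobenius k).map (Int.castRingHom ℝ) ≠ 0 :=
    (Polynomial.map_ne_zero_iff Int.cast_injective).mpr (eulerFrobenius_ne_zero k)
  rw [realRoots, Multiset.mem_toFinset, mem_roots hne, IsRoot.def, eval_map]
  have : aeval (x : ℂ) (eulerFrobenius k) = ((aeval x (eulerFrobenius k) : ℝ) : ℂ) := by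
    have := aeval_algebraMap_apply ℂ x (eulerFrobenius k)
    simpa using this
  rw [this, Complex.ofReal_eq_zero]
  rfl

/-- The inverse substitution z ↦ z/(1+z) carries the real roots of R_{k+1} other than 0 and -1
injectively to roots of E_k. -/
theorem le_card_realRoots (k : ℕ) : k ≤ (realRoots k).card := by
  have hne : (powerSumPoly (k + 1)).map (Int.castRingHom ℝ) ≠ 0 := by
    intro h
    have := congrArg (fun p => coeff p (k + 2)) h
    simp [coeff_powerSumPoly, Nat.factorial_ne_zero] at this
  set S := ((powerSumPoly (k + 1)).map (Int.castRingHom ℝ)).roots.toFinset with hS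
  have h1 : k ≤ (S \ {0, -1}).card := by
    have := le_card_roots_powerSumPoly k
    rw [← hS] at this
    have h2 := Finset.le_card_sdiff ({0, -1} : Finset ℝ) S
    rw [Finset.card_pair (by norm_num)] at h2
    omega
  refine h1.trans (Finset.card_le_card_of_injOn (fun z => z / (1 + z)) ?_ ?_)
  · intro z hz
    simp only [Finset.coe_sdiff, Set.mem_sdiff, Finset.mem_coe, Finset.mem_insert,
      Finset.mem_singleton, not_or] at hz
    obtain ⟨hz, h0, h1⟩ := hz
    rw [hS, Multiset.mem_toFinset, mem_roots hne, IsRoot.def, eval_map] at hz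
    have hz' : aeval (z : ℂ) (powerSumPoly (k + 1)) = 0 := by
      have h3 := aeval_algebraMap_apply ℂ z (powerSumPoly (k + 1))
      have h4 : aeval z (powerSumPoly (k + 1)) = 0 := hz
      rw [h4] at h3
      simpa using h3
    have hn : (1 + z) ≠ 0 := fun h => h1 (by linarith)
    have hn' : (1 + (z : ℂ)) ≠ 0 := by exact_mod_cast hn
    have h0' : (z : ℂ) ≠ 0 := by exact_mod_cast h0
    have hx : (z : ℂ) / (1 + z) ≠ 1 := by
      rw [Ne, div_eq_one_iff_eq hn']
      intro h
      have : (0 : ℂ) = 1 := by linear_combination h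
      exact zero_ne_one this
    have hx' : (1 - (z : ℂ) / (1 + z)) ≠ 0 := sub_ne_zero.mpr (Ne.symm hx)
    have e := aeval_powerSumPoly_succ k _ hx
    have hzz : (z : ℂ) / (1 + z) / (1 - z / (1 + z)) = z := by
      field_simp
      ring
    rw [hzz, hz'] at e
    show z / (1 + z) ∈ realRoots k
    rw [mem_realRoots]
    push_cast
    have := (div_eq_zero_iff.mp e.symm).resolve_right (pow_ne_zero _ hx')
    exact (mul_eq_zero.mp this).resolve_left (div_ne_zero h0' hn')
  · intro z hz w hw h
    simp only [Finset.coe_sdiff, Set.mem_sdiff, Finset.mem_coe, Finset.mem_insert,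
      Finset.mem_singleton, not_or] at hz hw
    have hn : (1 + z) ≠ 0 := fun h => hz.2.2 (by linarith)
    have hn' : (1 + w) ≠ 0 := fun h => hw.2.2 (by linarith)
    simp only at h
    rw [div_eq_div_iff hn hn'] at h
    linarith

/-- E_k has degree at most k, so the k real roots leave no room for others. -/
theorem exists_mem_realRoots {k : ℕ} {z : ℂ} (h : aeval z (eulerFrobenius k) = 0) :
    ∃ x ∈ realRoots k, (x : ℂ) = z := by
  have hne : (eulerFrobenius k).map (Int.castRingHom ℂ) ≠ 0 :=
    (Polynomial.map_ne_zero_iff Int.cast_injective).mpr (eulerFrobenius_ne_zero k)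
  have hmem : ∀ w : ℂ, w ∈ ((eulerFrobenius k).map (Int.castRingHom ℂ)).roots.toFinset ↔
      aeval w (eulerFrobenius k) = 0 := by
    intro w
    rw [Multiset.mem_toFinset, mem_roots hne, IsRoot.def, eval_map]; rfl
  have hsub : (realRoots k).image (fun x : ℝ => (x : ℂ)) ⊆
      ((eulerFrobenius k).map (Int.castRingHom ℂ)).roots.toFinset := by
    intro w hw
    obtain ⟨x, hx, rfl⟩ := Finset.mem_image.mp hw
    exact (hmem _).mpr (mem_realRoots.mp hx)
  have hcard : ((eulerFrobenius k).map (Int.castRingHom ℂ)).roots.toFinset.card ≤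
      ((realRoots k).image (fun x : ℝ => (x : ℂ))).card := by
    rw [Finset.card_image_of_injective _ Complex.ofReal_injective]
    refine le_trans ?_ (le_card_realRoots k)
    refine (Multiset.toFinset_card_le _).trans ((card_roots' _).trans ?_)
    exact natDegree_map_le.trans (natDegree_eulerFrobenius_le k)
  have := Finset.eq_of_subset_of_card_le hsub hcard
  have hz := (hmem z).mpr h
  rw [← this] at hz
  simpa using Finset.mem_image.mp hz

theorem card_realRoots (k : ℕ) : (realRoots k).card = k := by
  refine le_antisymm ?_ (le_card_realRoots k)
  refine (Multiset.toFinset_card_le _).trans ((card_roots' _).trans ?_)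
  exact natDegree_map_le.trans (natDegree_eulerFrobenius_le k)

/-- Inversion matches the roots inside the unit circle with those outside. On the circle a real root
could only be -1, since 1 is not a root, and a single leftover root contradicts the even total 2n.
-/
theorem card_filter_realRoots (n : ℕ) :
    ((realRoots (2 * n)).filter (fun x => |x| < 1)).card = n ∧
      ∀ x ∈ realRoots (2 * n), |x| ≠ 1 := by
  set S := realRoots (2 * n) with hS
  have hinv : ∀ x ∈ S, x⁻¹ ∈ S := by
    intro x hx
    rw [hS, mem_realRoots] at hx ⊢
    push_cast
    exact aeval_eulerFrobenius_inv_eq_zero hx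
  have h0 : ∀ x ∈ S, x ≠ 0 := by
    rintro x hx rfl
    rw [hS, mem_realRoots] at hx
    simp [aeval_eulerFrobenius_zero] at hx
  have h1 : ∀ x ∈ S, x ≠ 1 := by
    rintro x hx rfl
    rw [hS, mem_realRoots, Complex.ofReal_one, aeval_eulerFrobenius_one] at hx
    exact Nat.factorial_ne_zero _ (by exact_mod_cast hx)
  have hgt : (S.filter (fun x => |x| < 1)).card = (S.filter (fun x => 1 < |x|)).card := by
    refine Finset.card_bij (fun x _ => x⁻¹) ?_ ?_ ?_
    · intro x hx
      obtain ⟨hx, hl⟩ := Finset.mem_filter.mp hx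
      refine Finset.mem_filter.mpr ⟨hinv x hx, ?_⟩
      rw [abs_inv]
      exact (one_lt_inv₀ (abs_pos.mpr (h0 x hx))).mpr hl
    · intro x _ y _ h; exact inv_injective h
    · intro x hx
      obtain ⟨hx, hl⟩ := Finset.mem_filter.mp hx
      refine ⟨x⁻¹, Finset.mem_filter.mpr ⟨hinv x hx, ?_⟩, inv_inv x⟩
      rw [abs_inv]
      exact inv_lt_one_of_one_lt₀ hl
  have heq : (S.filter (fun x => |x| = 1)).card ≤ 1 := by
    refine (Finset.card_le_card (t := {-1}) ?_).trans (by simp)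
    intro x hx
    obtain ⟨hx, hl⟩ := Finset.mem_filter.mp hx
    rcases eq_or_eq_neg_of_abs_eq hl with h | h
    · exact absurd h (h1 x hx)
    · simp [h]
  have hsum := Finset.card_filter_add_card_filter_not (s := S) (fun x => |x| < 1)
  have hsum2 := Finset.card_filter_add_card_filter_not
    (s := S.filter (fun x => ¬ |x| < 1)) (fun x => |x| = 1)
  rw [Finset.filter_filter, Finset.filter_filter] at hsum2
  have e1 : S.filter (fun x => ¬ |x| < 1 ∧ |x| = 1) = S.filter (fun x => |x| = 1) :=
    Finset.filter_congr fun x _ => ⟨fun h => h.2, fun h => ⟨by rw [h]; simp, h⟩⟩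
  have e2 : S.filter (fun x => ¬ |x| < 1 ∧ ¬ |x| = 1) = S.filter (fun x => 1 < |x|) :=
    Finset.filter_congr fun x _ => ⟨fun h => lt_of_le_of_ne (not_lt.mp h.1) (Ne.symm h.2),
      fun h => ⟨not_lt.mpr h.le, h.ne'⟩⟩
  rw [e1, e2] at hsum2
  have hc : S.card = 2 * n := card_realRoots _
  refine ⟨by omega, fun x hx hx1 => ?_⟩
  have : 0 < (S.filter (fun x => |x| = 1)).card :=
    Finset.card_pos.mpr ⟨x, Finset.mem_filter.mpr ⟨hx, hx1⟩⟩
  omega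

theorem exists_strictMono_roots (n : ℕ) :
    ∃ q : Fin n → ℝ, StrictMono q ∧
      (∀ z : ℂ, (∃ k, (q k : ℂ) = z) ↔
        aeval z (eulerFrobenius (2 * n)) = 0 ∧ ‖z‖ < 1) := by
  set F := (realRoots (2 * n)).filter (fun x => |x| < 1)
  have hF : F.card = n := (card_filter_realRoots n).1
  refine ⟨F.orderEmbOfFin hF, (F.orderEmbOfFin hF).strictMono, fun z => ?_⟩
  have hr : ∀ x, (∃ k, F.orderEmbOfFin hF k = x) ↔ x ∈ F := by
    intro x
    have := Finset.range_orderEmbOfFin F hF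
    rw [← Finset.mem_coe, ← this]; rfl
  constructor
  · rintro ⟨k, rfl⟩
    obtain ⟨h1, h2⟩ := Finset.mem_filter.mp ((hr _).mp ⟨k, rfl⟩)
    exact ⟨mem_realRoots.mp h1, by simpa using h2⟩
  · rintro ⟨h1, h2⟩
    obtain ⟨x, hx, rfl⟩ := exists_mem_realRoots h1
    obtain ⟨k, hk⟩ := (hr x).mpr (Finset.mem_filter.mpr ⟨hx, by simpa using h2⟩)
    exact ⟨k, by rw [hk]⟩

theorem aeval_eulerFrobenius_ne_zero_of_norm_eq_one (n : ℕ) {z : ℂ} (hz : ‖z‖ = 1) :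
    aeval z (eulerFrobenius (2 * n)) ≠ 0 := by
  intro h
  obtain ⟨x, hx, rfl⟩ := exists_mem_realRoots h
  exact (card_filter_realRoots n).2 x hx (by simpa using hz)

/-- E_{2n} is palindromic, so the terms of degrees α and 2n - α combine into a cosine once l^n is
factored out. -/
theorem aeval_eulerFrobenius_expo (n : ℕ) (ω h : ℝ) :
    aeval (expo ω h) (eulerFrobenius (2 * n)) = expo ω h ^ n *
      ((2 * ∑ α ∈ Finset.range n, (eulerCoeff (n + 1) α : ℝ) *
          Real.cos (2 * Real.pi * ω * h * (((n + 1 : ℕ) : ℝ) - 1 - (α : ℝ)))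
        + (eulerCoeff (n + 1) n : ℝ) : ℝ) : ℂ) := by
  have hc : ∀ α, (eulerFrobenius (2 * n)).coeff α = eulerCoeff (n + 1) α := fun α =>
    (eulerCoeff_eq_coeff (n + 1) α (by omega)).symm
  rw [aeval_eq_sum_range' (n := n + (n + 1))
    (by have := natDegree_eulerFrobenius_le (2 * n); omega), Finset.sum_range_add,
    Finset.sum_range_succ', ← add_assoc]
  rw [← Finset.sum_range_reflect (fun i => (eulerFrobenius (2 * n)).coeff (n + (i + 1)) •
    expo ω h ^ (n + (i + 1))), ← Finset.sum_add_distrib]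
  push_cast
  rw [mul_add, Finset.mul_sum, Finset.mul_sum]
  congr 1
  · refine Finset.sum_congr rfl fun α hα => ?_
    have hα := Finset.mem_range.mp hα
    obtain ⟨s, hs⟩ : ∃ s, n = α + s := ⟨n - α, by omega⟩
    rw [show n - 1 - α + 1 = s by omega,
      coeff_eulerFrobenius_symm (2 * n) (n + s) α (by omega), hc]
    have hn : (n : ℂ) + 1 - 1 - α = s := by rw [hs]; push_cast; ring
    rw [hn]
    have hcos : 2 * Complex.cos (2 * Real.pi * ω * h * s) * expo ω h ^ s =
        expo ω h ^ (2 * s) + 1 := by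
      rw [Complex.cos]
      have e1 : expo ω h ^ s = Complex.exp (2 * Real.pi * ω * h * s * Complex.I) := by
        rw [expo, ← Complex.exp_nat_mul]; congr 1; ring
      rw [pow_mul', e1]
      have e2 : Complex.exp (-(2 * Real.pi * ω * h * s) * Complex.I) *
          Complex.exp (2 * Real.pi * ω * h * s * Complex.I) = 1 := by
        rw [← Complex.exp_add]; simp
      linear_combination e2
    simp only [zsmul_eq_mul]
    rw [hs]
    rw [show α + s + s = α + 2 * s by ring, pow_add, pow_add]
    linear_combination (-(eulerCoeff (α + s + 1) α : ℂ) * expo ω h ^ α) * hcos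
  · rw [add_zero, hc, zsmul_eq_mul, mul_comm]

theorem expo_sub_one_ne_zero {ω h : ℝ} (hω : ∀ n : ℤ, ω * h ≠ (n : ℝ)) : expo ω h ≠ 1 := by
  rw [expo, Ne, Complex.exp_eq_one_iff]
  rintro ⟨n, hn⟩
  apply hω n
  have hpi : (2 * Real.pi * Complex.I : ℂ) ≠ 0 := by
    simp [Real.pi_ne_zero]
  have : ((ω * h : ℝ) : ℂ) = ((n : ℝ) : ℂ) := by
    push_cast
    apply mul_left_cancel₀ hpi
    linear_combination hn
  exact_mod_cast this

theorem norm_expo (ω x : ℝ) : ‖expo ω x‖ = 1 := by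
  rw [expo, show (2 * (Real.pi : ℂ) * Complex.I * (ω : ℂ) * (x : ℂ)) =
    ((2 * Real.pi * ω * x : ℝ) : ℂ) * Complex.I by push_cast; ring, Complex.norm_exp_ofReal_mul_I]

theorem expo_add (ω x y : ℝ) : expo ω (x + y) = expo ω x * expo ω y := by
  rw [expo, expo, expo, ← Complex.exp_add]; push_cast; ring_nf

theorem one_sub_expo_sq (ω h : ℝ) :
    (1 - expo ω h) ^ 2 = -4 * ((Real.sin (Real.pi * ω * h) : ℝ) : ℂ) ^ 2 * expo ω h := by
  push_cast
  rw [Complex.sin]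
  have e1 : expo ω h = Complex.exp (Real.pi * ω * h * Complex.I) ^ 2 := by
    rw [expo, ← Complex.exp_nat_mul]; congr 1; push_cast; ring
  have e2 : Complex.exp (-(Real.pi * ω * h) * Complex.I) *
      Complex.exp (Real.pi * ω * h * Complex.I) = 1 := by
    rw [← Complex.exp_add]; simp
  rw [e1]
  generalize Complex.exp (Real.pi * ω * h * Complex.I) = u at *
  generalize Complex.exp (-(Real.pi * ω * h) * Complex.I) = v at *
  linear_combination (-(u * v) - 1 + 2 * u ^ 2) * e2 + (v - u) ^ 2 * u ^ 2 * Complex.I_sq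

/-- The reason for the value of K: the regularised sum of l^β β^(2m-1), times K, equals the
regularised integral of e^{2πiωhs} s^(2m-1). The powers of the sine come from (1-l)² = -4 l
sin²(πωh), and the denominator of K is l^(1-m) E_{2m-2}(l), nonzero because no root lies on the unit
circle. -/
theorem constK_mul_powerSum (m : ℕ) (hm : 1 ≤ m) {ω h : ℝ} (hω : ∀ n : ℤ, ω * h ≠ (n : ℝ)) :
    (constK m ω h : ℂ) * aeval (expo ω h / (1 - expo ω h)) (powerSumPoly (2 * m - 1)) =
      ((2 * m - 1).factorial : ℂ) / phase ω h ^ (2 * m) := by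
  obtain ⟨n, rfl⟩ : ∃ n, m = n + 1 := ⟨m - 1, by omega⟩
  have hl := expo_sub_one_ne_zero hω
  have hl' : 1 - expo ω h ≠ 0 := sub_ne_zero.mpr (Ne.symm hl)
  have hE := aeval_eulerFrobenius_ne_zero_of_norm_eq_one n (norm_expo ω h)
  have hexp : expo ω h ≠ 0 := by rw [expo]; exact Complex.exp_ne_zero _
  have hsq := one_sub_expo_sq ω h
  have hs : ((Real.sin (Real.pi * ω * h) : ℝ) : ℂ) ≠ 0 := by
    intro h0
    rw [h0] at hsq
    exact pow_ne_zero 2 hl' (by rw [hsq]; ring)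
  have hωh : ω * h ≠ 0 := by simpa using hω 0
  have hph : ((Real.pi * ω * h : ℝ) : ℂ) ≠ 0 := by
    rw [mul_assoc]; exact_mod_cast mul_ne_zero Real.pi_ne_zero hωh
  have hphase : phase ω h ^ 2 = -4 * ((Real.pi * ω * h : ℝ) : ℂ) ^ 2 := by
    rw [phase]; push_cast
    linear_combination (4 * (Real.pi : ℂ) ^ 2 * ω ^ 2 * h ^ 2) * Complex.I_sq
  rw [show 2 * (n + 1) - 1 = 2 * n + 1 by omega, aeval_powerSumPoly_succ _ _ hl, constK,
    show 2 * (n + 1) - 1 = 2 * n + 1 by omega, show n + 1 - 1 = n by omega]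
  have hD := aeval_eulerFrobenius_expo n ω h
  rw [hD] at hE ⊢
  generalize (2 * ∑ α ∈ Finset.range n, (eulerCoeff (n + 1) α : ℝ) *
          Real.cos (2 * Real.pi * ω * h * (((n + 1 : ℕ) : ℝ) - 1 - (α : ℝ)))
        + (eulerCoeff (n + 1) n : ℝ) : ℝ) = D at *
  have hD0 : (D : ℂ) ≠ 0 := right_ne_zero_of_mul hE
  rw [show 2 * n + 2 = 2 * (n + 1) by ring, pow_mul (1 - expo ω h), hsq, pow_mul (phase ω h),
    hphase]
  push_cast at hs hph ⊢
  generalize Complex.sin (Real.pi * ω * h) = s at *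
  generalize (Real.pi * ω * h : ℂ) = p at *
  rw [div_pow, mul_pow, mul_pow, mul_pow]
  field_simp
  ring

end EulerFrobenius

/-! ### Regularised sums and integrals, and the two end contributions of the error -/

section Functionals

open Polynomial

/-- The linear functional on polynomials with prescribed moments. -/
noncomputable def momentFunctional (μ : ℕ → ℂ) : ℂ[X] →ₗ[ℂ] ℂ :=
  Polynomial.lsum fun j => μ j • LinearMap.id

theorem momentFunctional_X_pow (μ : ℕ → ℂ) (j : ℕ) : momentFunctional μ (X ^ j) = μ j := by
  rw [momentFunctional, lsum_apply, ← monomial_one_right_eq_X_pow, sum_monomial_index] <;> simp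

/-- The regularised sum `∑ ρ^β f(β)` over all `β ≥ 0`. -/
noncomputable def regSum (ρ : ℂ) : ℂ[X] →ₗ[ℂ] ℂ :=
  momentFunctional fun j => aeval (ρ / (1 - ρ)) (powerSumPoly j)

/-- The regularised integral of `e^{θs} f(s)` over `s ≥ 0`. -/
noncomputable def regInt (θ : ℂ) : ℂ[X] →ₗ[ℂ] ℂ :=
  momentFunctional fun j => (-1) ^ (j + 1) * (j.factorial : ℂ) / θ ^ (j + 1)

theorem regSum_X_pow (ρ : ℂ) (j : ℕ) :
    regSum ρ (X ^ j) = aeval (ρ / (1 - ρ)) (powerSumPoly j) := momentFunctional_X_pow _ j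

theorem regInt_X_pow (θ : ℂ) (j : ℕ) :
    regInt θ (X ^ j) = (-1) ^ (j + 1) * (j.factorial : ℂ) / θ ^ (j + 1) :=
  momentFunctional_X_pow _ j

theorem regSum_one {ρ : ℂ} (hρ : ρ ≠ 1) : regSum ρ 1 = 1 / (1 - ρ) := by
  have h := regSum_X_pow ρ 0
  have h' : (1 - ρ) ≠ 0 := sub_ne_zero.mpr (Ne.symm hρ)
  rw [pow_zero] at h
  rw [h, powerSumPoly]
  simp only [map_add, map_one, aeval_X]
  field_simp
  ring

theorem regInt_one (θ : ℂ) : regInt θ 1 = -1 / θ := by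
  have h := regInt_X_pow θ 0
  rw [pow_zero] at h
  rw [h]; simp

theorem X_add_C_pow (y : ℂ) (j : ℕ) : (X + C y) ^ j =
    ∑ α ∈ Finset.range (j + 1), ((j.choose α : ℂ) * y ^ (j - α)) • (X : ℂ[X]) ^ α := by
  rw [add_pow]
  refine Finset.sum_congr rfl fun α _ => ?_
  rw [smul_eq_C_mul, C_mul, C_pow]
  simp only [map_natCast]
  ring

/-- Splitting off the term β = 0. This is `powerSumPoly_rec` extended linearly, so it needs no
convergence and holds for |ρ| ≥ 1 as well. -/
theorem regSum_sub_shift {ρ : ℂ} (hρ : ρ ≠ 1) (f : ℂ[X]) :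
    regSum ρ f - ρ * regSum ρ (taylor 1 f) = f.eval 0 := by
  have h' : (1 - ρ) ≠ 0 := sub_ne_zero.mpr (Ne.symm hρ)
  have hX : ∀ j, regSum ρ (X ^ j) - ρ * regSum ρ (taylor 1 (X ^ j)) =
      (X ^ j : ℂ[X]).eval 0 := by
    intro j
    have hrec := congrArg (aeval (ρ / (1 - ρ))) (powerSumPoly_rec j)
    simp only [map_sub, map_mul, map_sum, map_natCast, map_add, map_one, aeval_X] at hrec
    rw [taylor_X_pow, X_add_C_pow]
    simp only [map_sum, map_smul, regSum_X_pow, one_pow, mul_one, smul_eq_mul]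
    generalize (∑ α ∈ Finset.range (j + 1),
      (j.choose α : ℂ) * aeval (ρ / (1 - ρ)) (powerSumPoly α)) = U at *
    generalize aeval (ρ / (1 - ρ)) (powerSumPoly j) = R at *
    have e : 1 + ρ / (1 - ρ) = 1 / (1 - ρ) := by field_simp; ring
    rw [e] at hrec
    have h2 : R - ρ * U = (1 - ρ) * (1 / (1 - ρ) * R - ρ / (1 - ρ) * U) := by field_simp
    rw [h2, hrec]
    by_cases hj : j = 0
    · simp [hj, e, h']
    · simp [hj]
  induction f using Polynomial.induction_on' with
  | add p q hp hq =>
    simp only [map_add, eval_add]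
    linear_combination hp + hq
  | monomial n c =>
    rw [← C_mul_X_pow_eq_monomial, ← smul_eq_C_mul]
    simp only [map_smul, smul_eq_mul, eval_smul]
    linear_combination c * hX n

theorem sum_pow_mul_eval {ρ : ℂ} (hρ : ρ ≠ 1) (f : ℂ[X]) (γ : ℕ) :
    ∑ β ∈ Finset.range γ, ρ ^ β * f.eval (β : ℂ) =
      regSum ρ f - ρ ^ γ * regSum ρ (taylor (γ : ℂ) f) := by
  induction γ with
  | zero => simp
  | succ γ ih =>
    rw [Finset.sum_range_succ, ih]
    have h := regSum_sub_shift hρ (taylor (γ : ℂ) f)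
    rw [taylor_taylor, taylor_eval, zero_add] at h
    rw [show ((γ + 1 : ℕ) : ℂ) = γ + 1 by push_cast; ring, ← h, pow_succ, add_comm (γ : ℂ) 1]
    ring

variable {ι : Type*} [Fintype ι]

/-- Regularised sum of `(∑ i, d_i ρ_i^(β+γ)) f(β)` over all `β ≥ 0`. -/
noncomputable def twistedSum (ρ d : ι → ℂ) (γ : ℕ) : ℂ[X] →ₗ[ℂ] ℂ :=
  ∑ i, (d i * ρ i ^ γ) • regSum (ρ i)

/-- Difference of the regularised sum and the regularised integral, both shifted by `γ`. -/
noncomputable def tailError (ρ d : ι → ℂ) (e l θ : ℂ) (γ : ℕ) : ℂ[X] →ₗ[ℂ] ℂ :=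
  twistedSum ρ d γ - (e * l ^ γ) • regInt θ

theorem twistedSum_apply (ρ d : ι → ℂ) (γ : ℕ) (f : ℂ[X]) :
    twistedSum ρ d γ f = ∑ i, d i * ρ i ^ γ * regSum (ρ i) f := by
  simp [twistedSum, LinearMap.sum_apply]

theorem tailError_apply (ρ d : ι → ℂ) (e l θ : ℂ) (γ : ℕ) (f : ℂ[X]) :
    tailError ρ d e l θ γ f =
      (∑ i, d i * ρ i ^ γ * regSum (ρ i) f) - e * l ^ γ * regInt θ f := by
  simp [tailError, twistedSum_apply]

/-- The coefficients of the quadrature formula in units of the step. -/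
noncomputable def quadCoeff (ρ d : ι → ℂ) (e l θ : ℂ) (N β : ℕ) : ℂ :=
  if β = 0 then ∑ i, d i - tailError ρ d e l θ 0 1
  else if β < N then ∑ i, d i * ρ i ^ β
  else tailError ρ d e l θ N 1

/-- The error of the one-sided formula at an end point, with the end weight that makes
it exact for constants. -/
noncomputable def endError (ρ d : ι → ℂ) (e l θ : ℂ) (γ : ℕ) : ℂ[X] →ₗ[ℂ] ℂ :=
  tailError ρ d e l θ γ - (tailError ρ d e l θ γ 1) • Polynomial.leval 0

theorem endError_apply (ρ d : ι → ℂ) (e l θ : ℂ) (γ : ℕ) (f : ℂ[X]) :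
    endError ρ d e l θ γ f = tailError ρ d e l θ γ f - tailError ρ d e l θ γ 1 * f.eval 0 := by
  simp [endError]

theorem endError_one (ρ d : ι → ℂ) (e l θ : ℂ) (γ : ℕ) : endError ρ d e l θ γ 1 = 0 := by
  simp [endError_apply]

theorem endError_X_pow (ρ d : ι → ℂ) (e l θ : ℂ) (γ : ℕ) {j : ℕ} (hj : 1 ≤ j) :
    endError ρ d e l θ γ (X ^ j) = tailError ρ d e l θ γ (X ^ j) := by
  rw [endError_apply]
  simp [show j ≠ 0 by omega]

/-- The truncated error functional, in units of the step. -/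
noncomputable def truncError (ρ d : ι → ℂ) (e l θ : ℂ) (N γ : ℕ) (f : ℂ[X]) : ℂ :=
  e * (regInt θ f - l ^ γ * regInt θ (taylor (γ : ℂ) f)) -
    ∑ β ∈ Finset.range γ, quadCoeff ρ d e l θ N β * f.eval (β : ℂ)

/-- Truncated sum and truncated integral are both the tail from 0 minus the tail from γ. The bound 1
≤ γ puts the modified weight at β = 0 inside the sum, where it turns the tail error at 0 into the
end error. -/
theorem truncError_eq {ρ : ι → ℂ} (hρ : ∀ i, ρ i ≠ 1) (d : ι → ℂ) (e l θ : ℂ) {N γ : ℕ}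
    (h1 : 1 ≤ γ) (hγ : γ ≤ N) (f : ℂ[X]) :
    truncError ρ d e l θ N γ f =
      -endError ρ d e l θ 0 f + tailError ρ d e l θ γ (taylor (γ : ℂ) f) := by
  have hsum : ∑ β ∈ Finset.range γ, quadCoeff ρ d e l θ N β * f.eval (β : ℂ) =
      (∑ β ∈ Finset.range γ, (∑ i, d i * ρ i ^ β) * f.eval (β : ℂ)) -
        tailError ρ d e l θ 0 1 * f.eval 0 := by
    obtain ⟨γ, rfl⟩ : ∃ g, γ = g + 1 := ⟨γ - 1, by omega⟩
    rw [Finset.sum_range_succ', Finset.sum_range_succ']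
    have : ∀ β ∈ Finset.range γ, quadCoeff ρ d e l θ N (β + 1) * f.eval ((β + 1 : ℕ) : ℂ) =
        (∑ i, d i * ρ i ^ (β + 1)) * f.eval ((β + 1 : ℕ) : ℂ) := by
      intro β hβ
      have := Finset.mem_range.mp hβ
      rw [quadCoeff, if_neg (by omega), if_pos (by omega)]
    rw [Finset.sum_congr rfl this]
    simp [quadCoeff]
    ring
  have hs2 : ∑ β ∈ Finset.range γ, (∑ i, d i * ρ i ^ β) * f.eval (β : ℂ) =
      ∑ i, d i * (regSum (ρ i) f - ρ i ^ γ * regSum (ρ i) (taylor (γ : ℂ) f)) := by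
    simp_rw [← sum_pow_mul_eval (hρ _), Finset.sum_mul, Finset.mul_sum]
    rw [Finset.sum_comm]
    simp_rw [mul_assoc]
  rw [truncError, hsum, hs2, endError_apply, tailError_apply _ _ _ _ _ 0 f,
    tailError_apply _ _ _ _ _ γ]
  simp only [mul_sub, Finset.sum_sub_distrib, pow_zero, mul_one, mul_assoc]
  ring

/-- The weight at N is the zeroth moment of the tail there, exactly what makes the right-hand
contribution an end error too. The whole error is thus a difference of two one-sided ones. -/
theorem truncError_sub_last {ρ : ι → ℂ} (hρ : ∀ i, ρ i ≠ 1) (d : ι → ℂ) (e l θ : ℂ) {N : ℕ}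
    (hN : 1 ≤ N) (f : ℂ[X]) :
    truncError ρ d e l θ N N f - quadCoeff ρ d e l θ N N * f.eval (N : ℂ) =
      -endError ρ d e l θ 0 f + endError ρ d e l θ N (taylor (N : ℂ) f) := by
  rw [truncError_eq hρ d e l θ hN le_rfl, endError_apply _ _ _ _ _ N, taylor_eval, quadCoeff,
    if_neg (by omega), if_neg (by omega), zero_add]
  ring

theorem endError_taylor_X_pow (ρ d : ι → ℂ) (e l θ : ℂ) (N j : ℕ) :
    endError ρ d e l θ N (taylor (N : ℂ) (X ^ j)) =
      ∑ α ∈ Finset.Icc 1 j, ((j.choose α : ℂ) * (N : ℂ) ^ (j - α)) *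
        tailError ρ d e l θ N (X ^ α) := by
  rw [taylor_X_pow, X_add_C_pow, Finset.sum_range_succ', map_add, map_smul, pow_zero,
    endError_one, smul_zero, add_zero, map_sum,
    show Finset.Icc 1 j = Finset.Ico 1 (j + 1) by ext; simp, Finset.sum_Ico_eq_sum_range]
  simp only [Nat.add_sub_cancel]
  refine Finset.sum_congr rfl fun α _ => ?_
  rw [map_smul, endError_X_pow _ _ _ _ _ _ (by omega), smul_eq_mul, add_comm 1 α]

/-- The polynomial which interpolates the truncated error functional of `(γ - X)^n`. -/
noncomputable def nodePoly (ρ d : ι → ℂ) (e l θ : ℂ) (n : ℕ) : ℂ[X] :=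
  ∑ k ∈ Finset.range (n + 1),
    C (-((n.choose k : ℂ) * (-1) ^ k * endError ρ d e l θ 0 (X ^ k))) * X ^ (n - k)

/-- Shifted to γ, the function (γ - X)^n becomes (-X)^n, so the tail from γ sees a single moment,
assumed zero. The contribution of 0 is polynomial in γ by the binomial theorem. -/
theorem truncError_eq_nodePoly {ρ : ι → ℂ} (hρ : ∀ i, ρ i ≠ 1) (d : ι → ℂ) (e l θ : ℂ)
    {N γ n : ℕ} (hn : 1 ≤ n) (hγ : γ ≤ N)
    (h0 : tailError ρ d e l θ γ (X ^ n) = 0) :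
    truncError ρ d e l θ N γ ((C (γ : ℂ) - X) ^ n) = (nodePoly ρ d e l θ n).eval (γ : ℂ) := by
  have hp : (nodePoly ρ d e l θ n).eval (γ : ℂ) =
      -endError ρ d e l θ 0 ((C (γ : ℂ) - X) ^ n) := by
    have hb : (C (γ : ℂ) - X) ^ n = ∑ k ∈ Finset.range (n + 1),
        ((n.choose k : ℂ) * (-1) ^ k * (γ : ℂ) ^ (n - k)) • (X : ℂ[X]) ^ k := by
      rw [sub_eq_neg_add, add_pow]
      refine Finset.sum_congr rfl fun k _ => ?_
      rw [smul_eq_C_mul, neg_pow, C_mul, C_mul, C_pow, C_pow]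
      simp only [map_natCast, map_neg, map_one]
      ring
    rw [hb, map_sum, nodePoly, eval_finsetSum, ← Finset.sum_neg_distrib]
    refine Finset.sum_congr rfl fun k _ => ?_
    simp only [eval_mul, eval_C, eval_pow, eval_X, map_smul, smul_eq_mul]
    ring
  rw [hp]
  have ht : taylor (γ : ℂ) ((C (γ : ℂ) - X) ^ n) = ((-1) ^ n : ℂ) • X ^ n := by
    rw [taylor_apply, pow_comp, sub_comp, C_comp, X_comp, smul_eq_C_mul, C_pow,
      show C (γ : ℂ) - (X + C (γ : ℂ)) = -X by ring, neg_pow]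
    simp
  rcases Nat.eq_zero_or_pos γ with rfl | h1
  -- For γ = 0 the truncated error is zero, and the end error at 0 vanishes as well, because its
  -- only moment is the one in `h0`.
  · rw [truncError]
    rw [endError_apply]
    have he : ((C ((0 : ℕ) : ℂ) - X) ^ n : ℂ[X]).eval 0 = 0 := by
      simp [show n ≠ 0 by omega]
    have h2 : ((C ((0 : ℕ) : ℂ) - X) ^ n : ℂ[X]) = ((-1) ^ n : ℂ) • X ^ n := by
      rw [← ht]; simp
    rw [he, h2]
    simp only [map_smul, h0]
    simp
  · rw [truncError_eq hρ d e l θ h1 hγ, ht, map_smul, h0]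
    simp

/-- The power γ^(2m-1-k) carries the end moment of order k, and powers ≥ m belong to k < m. For k =
0 the moment vanishes by the end weight, for the others by hypothesis. -/
theorem degree_nodePoly_lt {ρ d : ι → ℂ} {e l θ : ℂ} {m : ℕ} (hm : 1 ≤ m)
    (h : ∀ j ∈ Finset.Icc 1 (m - 1), tailError ρ d e l θ 0 (X ^ j) = 0) :
    (nodePoly ρ d e l θ (2 * m - 1)).degree < m := by
  rw [← mem_degreeLT]
  refine Submodule.sum_mem _ fun k hk => ?_
  rw [mem_degreeLT]
  have hk := Finset.mem_range.mp hk
  rcases Nat.lt_or_ge k m with hlt | hge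
  · have : endError ρ d e l θ 0 (X ^ k) = 0 := by
      rcases Nat.eq_zero_or_pos k with rfl | hpos
      · rw [pow_zero, endError_one]
      · rw [endError_X_pow _ _ _ _ _ _ hpos, h k (Finset.mem_Icc.mpr ⟨hpos, by omega⟩)]
    rw [this]
    simp
  · refine (degree_C_mul_X_pow_le _ _).trans_lt ?_
    exact_mod_cast (by omega : 2 * m - 1 - k < m)

theorem endError_eq_zero_of_nodePoly {ρ d : ι → ℂ} {e l θ : ℂ} {n k : ℕ} (hk : k ≤ n)
    (h : nodePoly ρ d e l θ n = 0) : endError ρ d e l θ 0 (X ^ k) = 0 := by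
  have hc := congrArg (fun p => coeff p (n - k)) h
  simp only [nodePoly, finsetSum_coeff, coeff_C_mul, coeff_X_pow, coeff_zero] at hc
  rw [Finset.sum_eq_single k] at hc
  · have : (n.choose k : ℂ) ≠ 0 := by exact_mod_cast (Nat.choose_pos hk).ne'
    simpa [this] using hc
  · intro b hb hbk
    have := Finset.mem_range.mp hb
    rw [if_neg (by omega), mul_zero]
  · intro hk'
    exact absurd (Finset.mem_range.mpr (by omega)) hk'

/-- The hypothesis `h2` makes the two end errors cancel on X^j for 1 ≤ j < m; on constants each of
them is zero by itself. -/
theorem truncError_sub_last_eq_zero {ρ : ι → ℂ} (hρ : ∀ i, ρ i ≠ 1) {d : ι → ℂ} {e l θ : ℂ}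
    {m N : ℕ} (hN : 1 ≤ N)
    (h2 : ∀ j ∈ Finset.Icc 1 (m - 1), tailError ρ d e l θ 0 (X ^ j) =
      ∑ α ∈ Finset.Icc 1 j, ((j.choose α : ℂ) * (N : ℂ) ^ (j - α)) *
        tailError ρ d e l θ N (X ^ α)) {f : ℂ[X]} (hf : f.natDegree < m) :
    truncError ρ d e l θ N N f - quadCoeff ρ d e l θ N N * f.eval (N : ℂ) = 0 := by
  rw [truncError_sub_last hρ d e l θ hN]
  have key : ∀ j < m, -endError ρ d e l θ 0 (X ^ j) +
      endError ρ d e l θ N (taylor (N : ℂ) (X ^ j)) = 0 := by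
    intro j hj
    rw [endError_taylor_X_pow]
    rcases Nat.eq_zero_or_pos j with rfl | hpos
    · simp [endError_one]
    · have hj' : j ∈ Finset.Icc 1 (m - 1) := Finset.mem_Icc.mpr ⟨hpos, by omega⟩
      rw [← h2 j hj', endError_X_pow _ _ _ _ _ _ hpos]
      ring
  rw [f.as_sum_range_C_mul_X_pow' hf]
  simp only [← smul_eq_C_mul, map_sum, map_smul]
  rw [← Finset.sum_neg_distrib, ← Finset.sum_add_distrib]
  refine Finset.sum_eq_zero fun j hj => ?_
  simp only [smul_eq_mul]
  linear_combination f.coeff j * key j (Finset.mem_range.mp hj)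

end Functionals

/-! ### Independence of the moment conditions -/

section Independence

open Polynomial

/-- Since R_{k+1} = X(1+X) R_k' and R_k' has degree exactly k, the conditions say that the weights
d_i z_i (1 + z_i) annihilate all polynomials of degree below the number of points. A Lagrange basis
polynomial isolates each weight. -/
theorem eq_zero_of_sum_powerSumPoly {ι : Type*} [Fintype ι] {z d : ι → ℂ}
    (hz : Function.Injective z) (h0 : ∀ i, z i * (1 + z i) ≠ 0)
    (h : ∀ k < Fintype.card ι, ∑ i, d i * aeval (z i) (powerSumPoly (k + 1)) = 0) (i : ι) :
    d i = 0 := by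
  classical
  have main : ∀ k ≤ Fintype.card ι, ∀ f : ℂ[X], f.degree < k →
      ∑ i, d i * (z i * (1 + z i)) * f.eval (z i) = 0 := by
    intro k
    induction k with
    | zero => intro _ f hf; simp [degree_eq_bot.mp (Nat.WithBot.lt_zero_iff.mp hf)]
    | succ k ih =>
      intro hk f hf
      set p : ℂ[X] := (derivative (powerSumPoly k)).map (Int.castRingHom ℂ) with hp
      have hpd : p.natDegree ≤ k := by
        refine natDegree_map_le.trans ((natDegree_derivative_le _).trans ?_)
        have := natDegree_powerSumPoly_le k
        omega
      have hpc : p.coeff k ≠ 0 := by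
        rw [hp, coeff_map, coeff_derivative, coeff_powerSumPoly]
        simp only [map_mul, map_natCast, map_add, map_one]
        exact_mod_cast mul_ne_zero (Nat.factorial_ne_zero k) (Nat.succ_ne_zero k)
      have hpe : ∑ i, d i * (z i * (1 + z i)) * p.eval (z i) = 0 := by
        rw [← h k hk]
        refine Finset.sum_congr rfl fun i _ => ?_
        rw [powerSumPoly_succ, hp, eval_map]
        simp only [map_mul, map_add, map_one, aeval_X]
        rw [aeval_def, algebraMap_int_eq]
        ring
      have hlow : (f - C (f.coeff k / p.coeff k) * p).degree < k := by
        rw [degree_lt_iff_coeff_zero]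
        intro j hj
        rcases Nat.eq_or_lt_of_le hj with rfl | hlt
        · simp [hpc]
        · rw [coeff_sub, coeff_C_mul, coeff_eq_zero_of_natDegree_lt (hpd.trans_lt hlt),
            coeff_eq_zero_of_degree_lt (hf.trans_le (by exact_mod_cast hlt))]
          simp
      have e := ih (by omega) _ hlow
      simp only [eval_sub, eval_mul, eval_C, mul_sub, Finset.sum_sub_distrib] at e
      have e2 : ∑ i, d i * (z i * (1 + z i)) * (f.coeff k / p.coeff k * p.eval (z i)) =
          f.coeff k / p.coeff k * ∑ i, d i * (z i * (1 + z i)) * p.eval (z i) := by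
        rw [Finset.mul_sum]
        exact Finset.sum_congr rfl fun i _ => by ring
      rw [e2, hpe, mul_zero, sub_zero] at e
      exact e
  have hb := main _ le_rfl (Lagrange.basis Finset.univ z i) (by
    rw [Lagrange.degree_basis hz.injOn (Finset.mem_univ i), Finset.card_univ]
    have := Fintype.card_pos_iff.mpr ⟨i⟩
    exact_mod_cast (by omega : Fintype.card ι - 1 < Fintype.card ι))
  rw [Finset.sum_eq_single i] at hb
  · rw [Lagrange.eval_basis_self hz.injOn (Finset.mem_univ i), mul_one] at hb
    exact (mul_eq_zero.mp hb).resolve_right (h0 i)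
  · intro j _ hji
    rw [Lagrange.eval_basis_of_ne hji.symm (Finset.mem_univ j), mul_zero]
  · intro hi
    exact absurd (Finset.mem_univ i) hi

end Independence

/-! ### Absolutely continuous complex functions and integration by parts -/

section AbsolutelyContinuous

open MeasureTheory Filter Topology

theorem AbsolutelyContinuousOnInterval.comp_of_dist_le {X Y : Type*} [PseudoMetricSpace X]
    [PseudoMetricSpace Y] {f : ℝ → X} {a b : ℝ} (hf : AbsolutelyContinuousOnInterval f a b)
    {g : X → Y} (hg : ∀ x y, dist (g x) (g y) ≤ dist x y) :
    AbsolutelyContinuousOnInterval (fun t => g (f t)) a b :=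
  squeeze_zero (fun _ => Finset.sum_nonneg fun _ _ => dist_nonneg)
    (fun _ => Finset.sum_le_sum fun _ _ => hg _ _) hf

theorem AbsolutelyContinuousOnInterval.congr {X : Type*} [PseudoMetricSpace X]
    {f g : ℝ → X} {a b : ℝ} (hf : AbsolutelyContinuousOnInterval f a b)
    (h : Set.EqOn f g (Set.uIcc a b)) : AbsolutelyContinuousOnInterval g a b := by
  rw [absolutelyContinuousOnInterval_iff] at hf ⊢
  intro ε hε
  obtain ⟨δ, hδ, H⟩ := hf ε hε
  refine ⟨δ, hδ, fun E hE hlt => ?_⟩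
  have := H E hE hlt
  rwa [Finset.sum_congr rfl fun i hi => ?_]
  rw [h (hE.1 i hi).1, h (hE.1 i hi).2]

/-- `f` is absolutely continuous with derivative `f'` almost everywhere. -/
structure IsAntiderivOn (f f' : ℝ → ℂ) (a b : ℝ) : Prop where
  ac : AbsolutelyContinuousOnInterval f a b
  hasDeriv : ∀ᵐ x, x ∈ Set.uIcc a b → HasDerivAt f (f' x) x

theorem AbsolutelyContinuousOnInterval.ae_differentiableAt_complex {f : ℝ → ℂ} {a b : ℝ}
    (hf : AbsolutelyContinuousOnInterval f a b) :
    ∀ᵐ x, x ∈ Set.uIcc a b → DifferentiableAt ℝ f x := by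
  have hre : AbsolutelyContinuousOnInterval (fun t => (f t).re) a b :=
    hf.comp_of_dist_le fun x y => by
      rw [Real.dist_eq, ← Complex.sub_re, Complex.dist_eq]; exact Complex.abs_re_le_norm _
  have him : AbsolutelyContinuousOnInterval (fun t => (f t).im) a b :=
    hf.comp_of_dist_le fun x y => by
      rw [Real.dist_eq, ← Complex.sub_im, Complex.dist_eq]; exact Complex.abs_im_le_norm _
  filter_upwards [hre.ae_differentiableAt, him.ae_differentiableAt] with x h1 h2 hx
  have h1 := (h1 hx).hasDerivAt.ofReal_comp
  have h2 := ((h2 hx).hasDerivAt.ofReal_comp).mul_const Complex.I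
  refine ((h1.add h2).congr_of_eventuallyEq ?_).differentiableAt
  filter_upwards with t using (Complex.re_add_im (f t)).symm

/-- The fundamental theorem of calculus is applied to the real and imaginary parts, which inherit
absolute continuity as 1-Lipschitz images. -/
theorem IsAntiderivOn.intervalIntegrable_and_integral {f f' : ℝ → ℂ} {a b : ℝ}
    (hf : IsAntiderivOn f f' a b) :
    IntervalIntegrable f' volume a b ∧ ∫ x in a..b, f' x = f b - f a := by
  have hre : AbsolutelyContinuousOnInterval (fun t => (f t).re) a b :=
    hf.ac.comp_of_dist_le fun x y => by
      rw [Real.dist_eq, ← Complex.sub_re, Complex.dist_eq]; exact Complex.abs_re_le_norm _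
  have him : AbsolutelyContinuousOnInterval (fun t => (f t).im) a b :=
    hf.ac.comp_of_dist_le fun x y => by
      rw [Real.dist_eq, ← Complex.sub_im, Complex.dist_eq]; exact Complex.abs_im_le_norm _
  have hae : ∀ᵐ x, x ∈ Set.uIoc a b →
      ((deriv (fun t => (f t).re) x : ℝ) : ℂ) +
        ((deriv (fun t => (f t).im) x : ℝ) : ℂ) * Complex.I = f' x := by
    filter_upwards [hf.hasDeriv] with x hx hxm
    have hd := hx (Set.uIoc_subset_uIcc hxm)
    have h1 : HasDerivAt (fun t => (f t).re) (f' x).re x :=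
      (Complex.reCLM.hasFDerivAt.comp_hasDerivAt x hd)
    have h2 : HasDerivAt (fun t => (f t).im) (f' x).im x :=
      (Complex.imCLM.hasFDerivAt.comp_hasDerivAt x hd)
    rw [h1.deriv, h2.deriv, Complex.re_add_im]
  have hcast : ∀ g : ℝ → ℝ, IntervalIntegrable g volume a b →
      IntervalIntegrable (fun x => (g x : ℂ)) volume a b := fun g hg => ⟨hg.1.ofReal, hg.2.ofReal⟩
  have i1 := hcast _ hre.intervalIntegrable_deriv
  have i2 := (hcast _ him.intervalIntegrable_deriv).mul_const Complex.I
  constructor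
  · refine (i1.add i2).congr_ae ?_
    exact (ae_restrict_iff' measurableSet_uIoc).mpr hae
  · rw [← intervalIntegral.integral_congr_ae hae, intervalIntegral.integral_add i1 i2,
      intervalIntegral.integral_mul_const]
    rw [intervalIntegral.integral_ofReal, intervalIntegral.integral_ofReal,
      hre.integral_deriv_eq_sub, him.integral_deriv_eq_sub]
    apply Complex.ext <;> simp

theorem IsAntiderivOn.intervalIntegrable {f f' : ℝ → ℂ} {a b : ℝ}
    (hf : IsAntiderivOn f f' a b) : IntervalIntegrable f' volume a b :=
  hf.intervalIntegrable_and_integral.1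

theorem IsAntiderivOn.integral_eq {f f' : ℝ → ℂ} {a b : ℝ}
    (hf : IsAntiderivOn f f' a b) : ∫ x in a..b, f' x = f b - f a :=
  hf.intervalIntegrable_and_integral.2

theorem IsAntiderivOn.mono {f f' : ℝ → ℂ} {a b c d : ℝ}
    (hf : IsAntiderivOn f f' a b) (h : Set.uIcc c d ⊆ Set.uIcc a b) :
    IsAntiderivOn f f' c d :=
  ⟨hf.ac.mono h, hf.hasDeriv.mono fun _ hx hxm => hx (h hxm)⟩

theorem IsAntiderivOn.integral_mul {f f' g g' : ℝ → ℂ} {a b : ℝ}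
    (hf : IsAntiderivOn f f' a b) (hg : IsAntiderivOn g g' a b) :
    ∫ x in a..b, f x * g' x = f b * g b - f a * g a - ∫ x in a..b, f' x * g x := by
  have hp : IsAntiderivOn (f * g) (fun x => f' x * g x + f x * g' x) a b := by
    refine ⟨hf.ac.smul hg.ac, ?_⟩
    filter_upwards [hf.hasDeriv, hg.hasDeriv] with x h1 h2 hx
    exact (h1 hx).mul (h2 hx)
  have i1 : IntervalIntegrable (fun x => f' x * g x) volume a b :=
    hf.intervalIntegrable.mul_continuousOn hg.ac.continuousOn
  have i2 : IntervalIntegrable (fun x => f x * g' x) volume a b :=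
    hg.intervalIntegrable.continuousOn_mul hf.ac.continuousOn
  have := hp.integral_eq
  rw [intervalIntegral.integral_add i1 i2] at this
  simp only [Pi.mul_apply] at this
  linear_combination this

theorem IsAntiderivOn.conj {f f' : ℝ → ℂ} {a b : ℝ} (hf : IsAntiderivOn f f' a b) :
    IsAntiderivOn (fun x => star (f x)) (fun x => star (f' x)) a b := by
  refine ⟨hf.ac.comp_of_dist_le (g := star) fun x y => ?_, ?_⟩
  · exact (dist_star_star x y).le
  · filter_upwards [hf.hasDeriv] with x hx hxm
    exact (hx hxm).star

theorem isAntiderivOn_of_hasDerivAt {f f' : ℝ → ℂ} (a b : ℝ)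
    (hf : ∀ x, HasDerivAt f (f' x) x) (hc : Continuous f') : IsAntiderivOn f f' a b := by
  have hC : ContDiff ℝ 1 f := by
    rw [contDiff_one_iff_deriv]
    exact ⟨fun x => (hf x).differentiableAt, by rwa [funext fun x => (hf x).deriv]⟩
  exact ⟨hC.contDiffOn.absolutelyContinuousOnInterval, Eventually.of_forall fun x _ => hf x⟩

theorem IsAntiderivOn.sub {f f' g g' : ℝ → ℂ} {a b : ℝ}
    (hf : IsAntiderivOn f f' a b) (hg : IsAntiderivOn g g' a b) :
    IsAntiderivOn (fun x => f x - g x) (fun x => f' x - g' x) a b := by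
  refine ⟨hf.ac.sub hg.ac, ?_⟩
  filter_upwards [hf.hasDeriv, hg.hasDeriv] with x h1 h2 hx
  exact (h1 hx).sub (h2 hx)

theorem IsAntiderivOn.const_mul {f f' : ℝ → ℂ} {a b : ℝ} (c : ℂ)
    (hf : IsAntiderivOn f f' a b) :
    IsAntiderivOn (fun x => c * f x) (fun x => c * f' x) a b := by
  refine ⟨hf.ac.const_smul c, ?_⟩
  filter_upwards [hf.hasDeriv] with x h1 hx
  exact (h1 hx).const_mul c

theorem IsAntiderivOn.add {f f' g g' : ℝ → ℂ} {a b : ℝ}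
    (hf : IsAntiderivOn f f' a b) (hg : IsAntiderivOn g g' a b) :
    IsAntiderivOn (fun x => f x + g x) (fun x => f' x + g' x) a b := by
  refine ⟨hf.ac.add hg.ac, ?_⟩
  filter_upwards [hf.hasDeriv, hg.hasDeriv] with x h1 h2 hx
  exact (h1 hx).add (h2 hx)

theorem IsAntiderivOn.sum {κ : Type*} (s : Finset κ) {f f' : κ → ℝ → ℂ} {a b : ℝ}
    (hf : ∀ i ∈ s, IsAntiderivOn (f i) (f' i) a b) :
    IsAntiderivOn (fun x => ∑ i ∈ s, f i x) (fun x => ∑ i ∈ s, f' i x) a b := by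
  classical
  induction s using Finset.induction_on with
  | empty =>
    simpa using isAntiderivOn_of_hasDerivAt (f := fun _ => 0) (f' := fun _ => 0) a b
      (fun x => hasDerivAt_const x (0 : ℂ)) continuous_const
  | insert i s hi ih =>
    simp only [Finset.sum_insert hi]
    exact (hf i (Finset.mem_insert_self i s)).add
      (ih fun j hj => hf j (Finset.mem_insert_of_mem hj))

end AbsolutelyContinuous

/-! ### Truncated powers -/

section TruncatedPowers

open MeasureTheory Filter Topology

/-- The truncated power `s_+^j / j!`. -/
noncomputable def truncPow (j : ℕ) (s : ℝ) : ℝ :=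
  if 0 ≤ s then s ^ j / (j.factorial : ℝ) else 0

theorem truncPow_succ_eq (j : ℕ) (s : ℝ) :
    truncPow (j + 1) s = (max s 0) ^ (j + 1) / ((j + 1).factorial : ℝ) := by
  unfold truncPow
  split_ifs with h
  · rw [max_eq_left h]
  · rw [max_eq_right (by linarith)]; simp

theorem truncPow_succ_of_nonpos (j : ℕ) {s : ℝ} (h : s ≤ 0) : truncPow (j + 1) s = 0 := by
  rw [truncPow_succ_eq, max_eq_right h]; simp

theorem continuous_truncPow_succ (j : ℕ) : Continuous (truncPow (j + 1)) := by
  rw [funext (truncPow_succ_eq j)]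
  fun_prop

theorem hasDerivAt_truncPow_of_ne (j : ℕ) {s : ℝ} (h : s ≠ 0) :
    HasDerivAt (truncPow (j + 1)) (truncPow j s) s := by
  rcases lt_or_gt_of_ne h with h | h
  · rw [truncPow, if_neg (not_le.mpr h)]
    refine (hasDerivAt_const s (0 : ℝ)).congr_of_eventuallyEq ?_
    filter_upwards [gt_mem_nhds h] with t ht
    exact truncPow_succ_of_nonpos j (le_of_lt ht)
  · rw [truncPow, if_pos h.le]
    have h1 : HasDerivAt (fun t : ℝ => t ^ (j + 1) / ((j + 1).factorial : ℝ))
        (s ^ j / (j.factorial : ℝ)) s := by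
      have := (hasDerivAt_pow (j + 1) s).div_const ((j + 1).factorial : ℝ)
      have e : s ^ j / (j.factorial : ℝ) =
          ((j + 1 : ℕ) : ℝ) * s ^ (j + 1 - 1) / ((j + 1).factorial : ℝ) := by
        have : (j.factorial : ℝ) ≠ 0 := by exact_mod_cast Nat.factorial_ne_zero j
        rw [Nat.factorial_succ, Nat.add_sub_cancel]
        push_cast
        field_simp
      rwa [e]
    refine h1.congr_of_eventuallyEq ?_
    filter_upwards [lt_mem_nhds h] with t ht
    rw [truncPow, if_pos ht.le]

/-- At the corner s = 0 the derivative exists because the derivative on both sides extends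
continuously across it. -/
theorem hasDerivAt_truncPow_succ (j : ℕ) (s : ℝ) :
    HasDerivAt (truncPow (j + 2)) (truncPow (j + 1) s) s :=
  hasDerivAt_of_hasDerivAt_of_ne' (x := 0) (fun _ hy => hasDerivAt_truncPow_of_ne (j + 1) hy)
    (continuous_truncPow_succ (j + 1)).continuousAt (continuous_truncPow_succ j).continuousAt s

theorem isAntiderivOn_truncPow (j : ℕ) (x a b : ℝ) :
    IsAntiderivOn (fun t => ((truncPow (j + 1) (t - x) : ℝ) : ℂ))
      (fun t => ((truncPow j (t - x) : ℝ) : ℂ)) a b := by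
  have hder : ∀ t, t ≠ x → HasDerivAt (fun t => ((truncPow (j + 1) (t - x) : ℝ) : ℂ))
      ((truncPow j (t - x) : ℝ) : ℂ) t := by
    intro t ht
    have := (hasDerivAt_truncPow_of_ne j (sub_ne_zero.mpr ht)).comp_sub_const t x
    exact this.ofReal_comp
  refine ⟨?_, ?_⟩
  · have h1 : AbsolutelyContinuousOnInterval (fun t : ℝ => max (t - x) 0) a b := by
      have hl : LipschitzWith 1 (fun t : ℝ => max (t - x) 0) :=
        LipschitzWith.of_dist_le_mul fun s t => by
          rw [Real.dist_eq, Real.dist_eq, NNReal.coe_one, one_mul]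
          refine (abs_max_sub_max_le_abs _ _ _).trans (le_of_eq ?_)
          congr 1; ring
      exact (hl.lipschitzOnWith (s := Set.uIcc a b)).absolutelyContinuousOnInterval
    have h2 : ∀ k : ℕ,
        AbsolutelyContinuousOnInterval (fun t : ℝ => (max (t - x) 0) ^ (k + 1)) a b := by
      intro k
      induction k with
      | zero => simpa using h1
      | succ k ih =>
        refine (ih.fun_mul h1).congr fun t _ => ?_
        exact (pow_succ _ _).symm
    have h3 := (h2 j).const_mul (((j + 1).factorial : ℝ)⁻¹)
    have h4 := h3.comp_of_dist_le (g := fun r : ℝ => (r : ℂ))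
      fun x y => (Complex.isometry_ofReal.dist_eq x y).le
    refine h4.congr fun t _ => ?_
    simp only [truncPow_succ_eq]
    push_cast
    ring
  · have : ∀ᵐ t : ℝ, t ≠ x := by simp [ae_iff, measure_singleton]
    filter_upwards [this] with t ht _ using hder t ht

theorem measurable_truncPow (j : ℕ) : Measurable (truncPow j) :=
  Measurable.ite measurableSet_Ici (by fun_prop) measurable_const

theorem abs_truncPow_le (j : ℕ) {s c : ℝ} (hs : s ≤ c) (hc : 0 ≤ c) :
    |truncPow j s| ≤ c ^ j / (j.factorial : ℝ) := by
  unfold truncPow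
  split_ifs with h
  · rw [abs_of_nonneg (by positivity)]
    gcongr
  · rw [abs_zero]; positivity

end TruncatedPowers

/-! ### Iterated kernels and Peano's formula -/

section PeanoKernel

open MeasureTheory Filter Topology

/-- The frequency `2πiω`. -/
noncomputable def freq (ω : ℝ) : ℂ := 2 * (Real.pi : ℂ) * Complex.I * (ω : ℂ)

theorem freq_ne_zero {ω : ℝ} (hω : ω ≠ 0) : freq ω ≠ 0 := by
  simp [freq, Real.pi_ne_zero, hω]

theorem hasDerivAt_expo (ω x : ℝ) : HasDerivAt (expo ω) (freq ω * expo ω x) x := by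
  have h : HasDerivAt (fun y : ℝ => freq ω * (y : ℂ)) (freq ω * 1) x :=
    (Complex.ofRealCLM.hasDerivAt (x := x)).const_mul (freq ω)
  have := h.cexp
  rw [mul_one, mul_comm] at this
  exact this

theorem continuous_expo (ω : ℝ) : Continuous (expo ω) :=
  continuous_iff_continuousAt.mpr fun x => (hasDerivAt_expo ω x).continuousAt

/-- The `j`-fold iterated integral from `a` of `e^{2πiωx}`. -/
noncomputable def expoPrim (ω a : ℝ) : ℕ → ℝ → ℂ
  | 0 => expo ω
  | j + 1 => fun t =>
      (expoPrim ω a j t - expo ω a * ((t : ℂ) - a) ^ j / (j.factorial : ℂ)) / freq ω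

theorem hasDerivAt_expoPrim {ω : ℝ} (hω : ω ≠ 0) (a : ℝ) (j : ℕ) (t : ℝ) :
    HasDerivAt (expoPrim ω a (j + 1)) (expoPrim ω a j t) t := by
  have hw := freq_ne_zero hω
  induction j with
  | zero =>
    have h := ((hasDerivAt_expo ω t).sub_const (expo ω a)).div_const (freq ω)
    rw [mul_div_cancel_left₀ _ hw] at h
    refine h.congr_of_eventuallyEq (Eventually.of_forall fun s => ?_)
    simp [expoPrim]
  | succ j ih =>
    have h1 : HasDerivAt (fun s : ℝ => expo ω a * ((s : ℂ) - a) ^ (j + 1) /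
        ((j + 1).factorial : ℂ)) (expo ω a * ((t : ℂ) - a) ^ j / (j.factorial : ℂ)) t := by
      have h2 := (((Complex.ofRealCLM.hasDerivAt (x := t)).sub_const (a : ℂ)).fun_pow
        (j + 1)).const_mul (expo ω a)
      have h3 := h2.div_const ((j + 1).factorial : ℂ)
      have hj : (j.factorial : ℂ) ≠ 0 := by exact_mod_cast Nat.factorial_ne_zero j
      have hj' : (j : ℂ) + 1 ≠ 0 := by exact_mod_cast Nat.succ_ne_zero j
      have e : expo ω a * (((j + 1 : ℕ) : ℂ) * (Complex.ofRealCLM t - (a : ℂ)) ^ (j + 1 - 1) *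
          Complex.ofRealCLM 1) / ((j + 1).factorial : ℂ) =
          expo ω a * ((t : ℂ) - a) ^ j / (j.factorial : ℂ) := by
        rw [Nat.factorial_succ, Nat.add_sub_cancel]
        simp only [Complex.ofRealCLM_apply, Complex.ofReal_one, mul_one]
        push_cast
        field_simp
      rwa [e] at h3
    exact (ih.sub h1).div_const (freq ω)

theorem expoPrim_self (ω a : ℝ) (j : ℕ) : expoPrim ω a (j + 1) a = 0 := by
  induction j with
  | zero => simp [expoPrim]
  | succ j ih =>
    rw [expoPrim]
    simp only [ih]
    simp

theorem continuous_expoPrim {ω : ℝ} (hω : ω ≠ 0) (a : ℝ) (j : ℕ) :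
    Continuous (expoPrim ω a j) := by
  cases j with
  | zero => exact continuous_expo ω
  | succ j => exact continuous_iff_continuousAt.mpr fun x =>
      (hasDerivAt_expoPrim hω a j x).continuousAt

variable {κ : Type*} [Fintype κ]

/-- The functional `φ ↦ ε ∫ e^{2πiωx} φ(x) dx - ∑ C_β φ(x_β)`. -/
noncomputable def errorFunctional (ω a b : ℝ) (x : κ → ℝ) (ε : ℂ) (C : κ → ℂ) (φ : ℝ → ℂ) : ℂ :=
  ε * (∫ t in a..b, expo ω t * φ t) - ∑ β, C β * φ (x β)

/-- The `j`-th iterated kernel of the error functional. -/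
noncomputable def errorKernel (ω a : ℝ) (x : κ → ℝ) (ε : ℂ) (C : κ → ℂ) (j : ℕ) (t : ℝ) : ℂ :=
  ε * expoPrim ω a (j + 1) t - ∑ β, C β * ((truncPow j (t - x β) : ℝ) : ℂ)

theorem isAntiderivOn_errorKernel {ω : ℝ} (hω : ω ≠ 0) (a b : ℝ) (x : κ → ℝ) (ε : ℂ)
    (C : κ → ℂ) (j : ℕ) :
    IsAntiderivOn (errorKernel ω a x ε C (j + 1)) (errorKernel ω a x ε C j) a b :=
  ((isAntiderivOn_of_hasDerivAt a b (hasDerivAt_expoPrim hω a (j + 1))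
    (continuous_expoPrim hω a (j + 1))).const_mul ε).sub
    (IsAntiderivOn.sum Finset.univ fun β _ =>
      (isAntiderivOn_truncPow j (x β) a b).const_mul (C β))

theorem hasDerivAt_errorKernel {ω : ℝ} (hω : ω ≠ 0) (a : ℝ) (x : κ → ℝ) (ε : ℂ)
    (C : κ → ℂ) (j : ℕ) (t : ℝ) :
    HasDerivAt (errorKernel ω a x ε C (j + 2)) (errorKernel ω a x ε C (j + 1) t) t := by
  refine ((hasDerivAt_expoPrim hω a (j + 2) t).const_mul ε).sub
    (HasDerivAt.fun_sum fun β _ => HasDerivAt.const_mul _ ?_)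
  exact ((hasDerivAt_truncPow_succ j (t - x β)).comp_sub_const t (x β)).ofReal_comp

theorem errorKernel_left {ω a : ℝ} {x : κ → ℝ} (hx : ∀ β, a ≤ x β) (ε : ℂ) (C : κ → ℂ)
    (j : ℕ) : errorKernel ω a x ε C (j + 1) a = 0 := by
  rw [errorKernel, expoPrim_self, Finset.sum_eq_zero]
  · simp
  · intro β _
    rw [truncPow_succ_of_nonpos j (by linarith [hx β])]; simp

theorem measurable_errorKernel {ω : ℝ} (hω : ω ≠ 0) (a : ℝ) (x : κ → ℝ) (ε : ℂ) (C : κ → ℂ)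
    (j : ℕ) : Measurable (errorKernel ω a x ε C j) := by
  refine ((continuous_expoPrim hω a (j + 1)).measurable.const_mul ε).sub
    (Finset.measurable_fun_sum _ fun β _ => Measurable.const_mul ?_ _)
  exact Complex.measurable_ofReal.comp ((measurable_truncPow j).comp (measurable_id.sub_const _))

theorem exists_bound_errorKernel {ω : ℝ} (hω : ω ≠ 0) {a b : ℝ} {x : κ → ℝ}
    (hx : ∀ β, x β ∈ Set.Icc a b) (ε : ℂ) (C : κ → ℂ) (j : ℕ) :
    ∃ M : ℝ, ∀ t ∈ Set.Icc a b, ‖errorKernel ω a x ε C j t‖ ≤ M := by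
  obtain ⟨M, hM⟩ := isCompact_Icc.exists_bound_of_continuousOn
    ((continuous_expoPrim hω a (j + 1)).continuousOn (s := Set.Icc a b))
  refine ⟨‖ε‖ * M + ∑ β, ‖C β‖ * ((b - a) ^ j / (j.factorial : ℝ)), fun t ht => ?_⟩
  refine (norm_sub_le _ _).trans (add_le_add ?_ ?_)
  · rw [norm_mul]; gcongr; exact hM t ht
  · refine (norm_sum_le _ _).trans (Finset.sum_le_sum fun β _ => ?_)
    rw [norm_mul, Complex.norm_real, Real.norm_eq_abs]
    gcongr
    exact abs_truncPow_le j (by linarith [ht.2, (hx β).1]) (by linarith [ht.1, ht.2])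

theorem memLp_errorKernel {ω : ℝ} (hω : ω ≠ 0) {a b : ℝ} {x : κ → ℝ}
    (hx : ∀ β, x β ∈ Set.Icc a b) (ε : ℂ) (C : κ → ℂ) (j : ℕ) (p : ℝ≥0∞) :
    MemLp (errorKernel ω a x ε C j) p (volume.restrict (Set.Icc a b)) := by
  obtain ⟨M, hM⟩ := exists_bound_errorKernel hω hx ε C j
  exact MemLp.of_bound (measurable_errorKernel hω a x ε C j).aestronglyMeasurable M
    ((ae_restrict_iff' measurableSet_Icc).mpr (Eventually.of_forall hM))

theorem intervalIntegrable_truncPow_mul {a b x : ℝ} (hab : a ≤ b) (hx : x ∈ Set.Icc a b)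
    (j : ℕ) {g : ℝ → ℂ} (hg : IntervalIntegrable g volume a b) :
    IntervalIntegrable (fun t => ((truncPow j (t - x) : ℝ) : ℂ) * g t) volume a b := by
  rw [intervalIntegrable_iff_integrableOn_Ioc_of_le hab] at hg ⊢
  refine Integrable.bdd_mul (c := (b - a) ^ j / (j.factorial : ℝ)) hg ?_ ?_
  · exact (Complex.measurable_ofReal.comp
      ((measurable_truncPow j).comp (measurable_id.sub_const _))).aestronglyMeasurable
  · refine (ae_restrict_iff' measurableSet_Ioc).mpr (Eventually.of_forall fun t ht => ?_)
    rw [Complex.norm_real, Real.norm_eq_abs]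
    exact abs_truncPow_le j (by linarith [ht.2, hx.1]) (by linarith)

theorem integral_truncPow_zero_mul {a b x : ℝ} (hab : a ≤ b) (hx : x ∈ Set.Icc a b)
    {f f' : ℝ → ℂ} (hf : IsAntiderivOn f f' a b) :
    ∫ t in a..b, ((truncPow 0 (t - x) : ℝ) : ℂ) * f' t = f b - f x := by
  have hI := intervalIntegrable_truncPow_mul hab hx 0 hf.intervalIntegrable
  have s1 : Set.uIcc a x ⊆ Set.uIcc a b := by
    rw [Set.uIcc_of_le hx.1, Set.uIcc_of_le hab]; exact Set.Icc_subset_Icc_right hx.2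
  have s2 : Set.uIcc x b ⊆ Set.uIcc a b := by
    rw [Set.uIcc_of_le hx.2, Set.uIcc_of_le hab]; exact Set.Icc_subset_Icc_left hx.1
  rw [← intervalIntegral.integral_add_adjacent_intervals (hI.mono_set s1) (hI.mono_set s2)]
  have h1 : ∫ t in a..x, ((truncPow 0 (t - x) : ℝ) : ℂ) * f' t = 0 := by
    refine intervalIntegral.integral_zero_ae ?_
    have : ∀ᵐ t : ℝ, t ≠ x := by simp [ae_iff, measure_singleton]
    filter_upwards [this] with t ht hm
    rw [Set.uIoc_of_le hx.1] at hm
    have : t < x := lt_of_le_of_ne hm.2 ht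
    rw [truncPow, if_neg (by linarith)]; simp
  have h2 : ∫ t in x..b, ((truncPow 0 (t - x) : ℝ) : ℂ) * f' t = ∫ t in x..b, f' t := by
    refine intervalIntegral.integral_congr_ae (Eventually.of_forall fun t hm => ?_)
    rw [Set.uIoc_of_le hx.2] at hm
    rw [truncPow, if_pos (by linarith [hm.1])]; simp
  rw [h1, h2, (hf.mono s2).integral_eq, zero_add]

/-- The kernel of order 0 jumps at the nodes and cannot be integrated by parts as a whole: its
smooth part is, and each jump just cuts an integral of f' at a node. -/
theorem errorFunctional_eq_integral_kernel_zero {ω : ℝ} (hω : ω ≠ 0) {a b : ℝ} (hab : a ≤ b)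
    {x : κ → ℝ} (hx : ∀ β, x β ∈ Set.Icc a b) (ε : ℂ) (C : κ → ℂ) {f f' : ℝ → ℂ}
    (hf : IsAntiderivOn f f' a b) :
    errorFunctional ω a b x ε C f =
      errorKernel ω a x ε C 0 b * f b - ∫ t in a..b, errorKernel ω a x ε C 0 t * f' t := by
  have hE : IsAntiderivOn (expoPrim ω a 1) (expo ω) a b :=
    isAntiderivOn_of_hasDerivAt a b (hasDerivAt_expoPrim hω a 0) (continuous_expo ω)
  have i1 : IntervalIntegrable (fun t => ε * (expoPrim ω a 1 t * f' t)) volume a b :=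
    (hf.intervalIntegrable.continuousOn_mul
      (continuous_expoPrim hω a 1).continuousOn).const_mul ε
  have i2 : ∀ β, IntervalIntegrable
      (fun t => C β * (((truncPow 0 (t - x β) : ℝ) : ℂ) * f' t)) volume a b := fun β =>
    (intervalIntegrable_truncPow_mul hab (hx β) 0 hf.intervalIntegrable).const_mul _
  have e : ∀ t, errorKernel ω a x ε C 0 t * f' t = ε * (expoPrim ω a 1 t * f' t) -
      ∑ β, C β * (((truncPow 0 (t - x β) : ℝ) : ℂ) * f' t) := by
    intro t
    rw [errorKernel, sub_mul, Finset.sum_mul]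
    simp only [mul_assoc, zero_add]
  have i3 : IntervalIntegrable
      (fun t => ∑ β, C β * (((truncPow 0 (t - x β) : ℝ) : ℂ) * f' t)) volume a b := by
    have := IntervalIntegrable.sum Finset.univ (fun β _ => i2 β)
    refine this.congr fun t _ => ?_
    simp
  rw [intervalIntegral.integral_congr fun t _ => e t, intervalIntegral.integral_sub i1 i3,
    intervalIntegral.integral_const_mul, hE.integral_mul hf, expoPrim_self,
    intervalIntegral.integral_finsetSum fun β _ => i2 β]
  simp only [intervalIntegral.integral_const_mul, integral_truncPow_zero_mul hab (hx _) hf]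
  rw [errorFunctional, errorKernel]
  -- The convention that the truncated power of order 0 equals 1 at 0 counts a node at b.
  have hb : ∀ β, truncPow 0 (b - x β) = 1 := fun β => by
    rw [truncPow, if_pos (by linarith [(hx β).2])]; simp
  simp only [hb, mul_sub, Finset.sum_sub_distrib, zero_add, Complex.ofReal_one, mul_one, sub_mul,
    Finset.sum_mul]
  ring

/-- Peano's formula with boundary terms. -/
theorem errorFunctional_eq_sum_add_integral {ω : ℝ} (hω : ω ≠ 0) {a b : ℝ} (hab : a ≤ b)
    {x : κ → ℝ} (hx : ∀ β, x β ∈ Set.Icc a b) (ε : ℂ) (C : κ → ℂ) {φ : ℕ → ℝ → ℂ} (k : ℕ)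
    (hφ : ∀ i < k + 1, IsAntiderivOn (φ i) (φ (i + 1)) a b) :
    errorFunctional ω a b x ε C (φ 0) =
      (∑ i ∈ Finset.range (k + 1), (-1) ^ i * (errorKernel ω a x ε C i b * φ i b)) +
        (-1) ^ (k + 1) * ∫ t in a..b, errorKernel ω a x ε C k t * φ (k + 1) t := by
  induction k with
  | zero =>
    rw [errorFunctional_eq_integral_kernel_zero hω hab hx ε C (hφ 0 (by omega))]
    simp
    ring
  | succ k ih =>
    rw [ih fun i hi => hφ i (by omega), Finset.sum_range_succ _ (k + 1)]
    have h := (isAntiderivOn_errorKernel hω a b x ε C k).integral_mul (hφ (k + 1) (by omega))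
    -- Kernels of order at least 1 vanish at a, so only boundary terms at b survive.
    rw [errorKernel_left fun β => (hx β).1] at h
    rw [pow_succ _ (k + 1)]
    linear_combination (-1) ^ (k + 1) * h

theorem errorFunctional_eq_integral {ω : ℝ} (hω : ω ≠ 0) {a b : ℝ} (hab : a ≤ b)
    {x : κ → ℝ} (hx : ∀ β, x β ∈ Set.Icc a b) {ε : ℂ} {C : κ → ℂ} {φ : ℕ → ℝ → ℂ} {m : ℕ}
    (hm : 1 ≤ m) (hφ : ∀ i < m, IsAntiderivOn (φ i) (φ (i + 1)) a b)
    (h0 : ∀ j < m, errorKernel ω a x ε C j b = 0) :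
    errorFunctional ω a b x ε C (φ 0) =
      (-1) ^ m * ∫ t in a..b, errorKernel ω a x ε C (m - 1) t * φ m t := by
  obtain ⟨k, rfl⟩ : ∃ k, m = k + 1 := ⟨m - 1, by omega⟩
  rw [errorFunctional_eq_sum_add_integral hω hab hx ε C k hφ, Finset.sum_eq_zero, zero_add,
    Nat.add_sub_cancel]
  intro i hi
  rw [h0 i (Finset.mem_range.mp hi)]; ring

open Polynomial in
theorem hasDerivAt_eval_ofReal (p : ℂ[X]) (t : ℝ) :
    HasDerivAt (fun s : ℝ => p.eval (s : ℂ)) ((derivative p).eval (t : ℂ)) t :=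
  (p.hasDerivAt (t : ℂ)).comp_ofReal

open Polynomial in
theorem isAntiderivOn_iterate_derivative (p : ℂ[X]) (a b : ℝ) (i : ℕ) :
    IsAntiderivOn (fun s : ℝ => (derivative^[i] p).eval (s : ℂ))
      (fun s : ℝ => (derivative^[i + 1] p).eval (s : ℂ)) a b := by
  refine isAntiderivOn_of_hasDerivAt a b (fun t => ?_) (by fun_prop)
  rw [Function.iterate_succ_apply']
  exact hasDerivAt_eval_ofReal _ t

theorem errorFunctional_poly_eq_zero {ω : ℝ} (hω : ω ≠ 0) {a b : ℝ} (hab : a ≤ b)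
    {x : κ → ℝ} (hx : ∀ β, x β ∈ Set.Icc a b) {ε : ℂ} {C : κ → ℂ} {m : ℕ}
    (hm : 1 ≤ m) (h0 : ∀ j < m, errorKernel ω a x ε C j b = 0) {p : ℂ[X]} (hp : p.degree < m) :
    errorFunctional ω a b x ε C (fun t => p.eval (t : ℂ)) = 0 := by
  have hz : Polynomial.derivative^[m] p = 0 := by
    by_cases h : p = 0
    · rw [h, Polynomial.iterate_derivative_zero]
    · exact Polynomial.iterate_derivative_eq_zero ((Polynomial.natDegree_lt_iff_degree_lt h).mpr hp)
  have := errorFunctional_eq_integral (φ := fun i s => (Polynomial.derivative^[i] p).eval (s : ℂ))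
    hω hab hx hm (fun i _ => isAntiderivOn_iterate_derivative p a b i) h0
  simp only [hz, Polynomial.eval_zero, mul_zero, intervalIntegral.integral_zero] at this
  exact this

open Polynomial in
/-- An error functional which vanishes on polynomials has kernels vanishing at `b`. -/
theorem errorKernel_right_eq_zero {ω : ℝ} (hω : ω ≠ 0) {a b : ℝ} (hab : a ≤ b)
    {x : κ → ℝ} (hx : ∀ β, x β ∈ Set.Icc a b) {ε : ℂ} {C : κ → ℂ} {m : ℕ}
    (h : ∀ p : ℂ[X], p.degree < m → errorFunctional ω a b x ε C (fun t => p.eval (t : ℂ)) = 0)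
    {j : ℕ} (hj : j < m) : errorKernel ω a x ε C j b = 0 := by
  -- Of the derivatives of (X - b)^j only the j-th is nonzero at b, so Peano's formula singles out
  -- the kernel of order j.
  set p : ℂ[X] := (X - Polynomial.C (b : ℂ)) ^ j with hp
  have hpd : p.natDegree = j := by rw [hp, natDegree_pow, natDegree_X_sub_C, mul_one]
  have hdeg : p.degree < m := by
    refine degree_le_natDegree.trans_lt ?_
    rw [hpd]; exact_mod_cast hj
  have hz : derivative^[j + 1] p = 0 := iterate_derivative_eq_zero (by omega)
  have hev : ∀ i ≤ j, (derivative^[i] p).eval (b : ℂ) = if i = j then (j.factorial : ℂ) else 0 := by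
    intro i hi
    rw [hp, iterate_derivative_X_sub_pow]
    simp only [nsmul_eq_mul, eval_mul, eval_natCast, eval_pow, eval_sub, eval_X, eval_C, sub_self]
    split_ifs with hij
    · rw [hij, Nat.descFactorial_self]; simp
    · rw [zero_pow (by omega), mul_zero]
  have := errorFunctional_eq_sum_add_integral hω hab hx ε C
    (φ := fun i s => (derivative^[i] p).eval (s : ℂ)) j
    (fun i _ => isAntiderivOn_iterate_derivative p a b i)
  simp only [hz, eval_zero, mul_zero, intervalIntegral.integral_zero, add_zero] at this
  rw [show (fun s : ℝ => (derivative^[0] p).eval (s : ℂ)) = fun s : ℝ => p.eval (s : ℂ) from rfl,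
    h p hdeg, Finset.sum_eq_single j] at this
  · rw [hev j le_rfl, if_pos rfl] at this
    have hf : (j.factorial : ℂ) ≠ 0 := by exact_mod_cast Nat.factorial_ne_zero j
    simpa [hf] using this.symm
  · intro i hi hij
    rw [hev i (by have := Finset.mem_range.mp hi; omega), if_neg hij]; ring
  · intro hj'
    exact absurd (Finset.mem_range.mpr (by omega)) hj'

end PeanoKernel

/-! ### The dual norm, orthogonality and uniqueness in the Sobolev space -/

section Sobolev

open MeasureTheory Filter Topology

/-- A chain of explicit derivatives identifies the one-sided iterated derivatives. The last link
holds only almost everywhere, which accommodates kernels that jump at the nodes. -/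
theorem memSobolev_of_tower {m : ℕ} (hm : 1 ≤ m) {a b : ℝ} (hab : a < b) {f : ℕ → ℝ → ℂ}
    (hd : ∀ i < m - 1, ∀ t, HasDerivAt (f i) (f (i + 1) t) t)
    (hl : IsAntiderivOn (f (m - 1)) (f m) a b)
    (hL : MemLp (f m) 2 (volume.restrict (Set.Icc a b))) :
    MemSobolev m a b (f 0) ∧
      ∀ᵐ t ∂(volume.restrict (Set.Icc a b)), iteratedDerivWithin m (f 0) (Set.Icc a b) t = f m t := by
  have hu := uniqueDiffOn_Icc hab
  have heq : ∀ i ≤ m - 1, Set.EqOn (iteratedDerivWithin i (f 0) (Set.Icc a b)) (f i)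
      (Set.Icc a b) := by
    intro i
    induction i with
    | zero => intro _ t _; rw [iteratedDerivWithin_zero]
    | succ i ih =>
      intro hi t ht
      rw [iteratedDerivWithin_succ, derivWithin_congr (ih (by omega)) (ih (by omega) ht)]
      exact (hd i (by omega) t).hasDerivWithinAt.derivWithin (hu t ht)
  have hae : ∀ᵐ t ∂(volume.restrict (Set.Icc a b)),
      iteratedDerivWithin m (f 0) (Set.Icc a b) t = f m t := by
    refine (ae_restrict_iff' measurableSet_Icc).mpr ?_
    filter_upwards [hl.hasDeriv] with t h ht
    rw [Set.uIcc_of_le hab.le] at h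
    obtain ⟨k, hk⟩ : ∃ k, m = k + 1 := ⟨m - 1, by omega⟩
    have hk' : m - 1 = k := by omega
    rw [hk'] at heq h
    have := (h ht).hasDerivWithinAt.derivWithin (hu t ht)
    rw [← this, hk, iteratedDerivWithin_succ,
      derivWithin_congr (heq k le_rfl) (heq k le_rfl ht)]
  refine ⟨⟨?_, ?_, ?_⟩, hae⟩
  · have hc : ∀ i < m - 1, ContinuousOn (f i) (Set.Icc a b) := fun i hi t _ =>
      (hd i hi t).continuousAt.continuousWithinAt
    refine contDiffOn_of_continuousOn_differentiableOn_deriv (n := ((m - 1 : ℕ) : ℕ∞)) ?_ ?_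
    · intro i hi
      have hi : i ≤ m - 1 := by exact_mod_cast hi
      refine ContinuousOn.congr ?_ (heq i hi)
      rcases Nat.eq_or_lt_of_le hi with h | h
      · have := hl.ac.continuousOn
        rwa [Set.uIcc_of_le hab.le, ← h] at this
      · exact hc i h
    · intro i hi
      have hi : i < m - 1 := by exact_mod_cast hi
      exact DifferentiableOn.congr
        (fun t _ => (hd i hi t).differentiableAt.differentiableWithinAt) (heq i hi.le)
  · refine hl.ac.congr ?_
    rw [Set.uIcc_of_le hab.le]
    exact (heq (m - 1) le_rfl).symm
  · exact (memLp_congr_ae hae).mpr hL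

theorem isAntiderivOn_of_memSobolev {m : ℕ} {a b : ℝ} (hab : a < b) {φ : ℝ → ℂ}
    (h : MemSobolev m a b φ) {i : ℕ} (hi : i < m) :
    IsAntiderivOn (iteratedDerivWithin i φ (Set.Icc a b))
      (iteratedDerivWithin (i + 1) φ (Set.Icc a b)) a b := by
  have hu := uniqueDiffOn_Icc hab
  have hac : AbsolutelyContinuousOnInterval (iteratedDerivWithin i φ (Set.Icc a b)) a b := by
    rcases Nat.eq_or_lt_of_le (Nat.le_sub_one_of_lt hi) with h1 | h1
    · rw [h1]; exact h.2.1
    · have hC : ContDiffOn ℝ 1 (iteratedDerivWithin i φ (Set.Icc a b)) (Set.Icc a b) := by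
        have h2 : ContDiffOn ℝ ((i + 1 : ℕ) : WithTop ℕ∞) φ (Set.Icc a b) :=
          h.1.of_le (by exact_mod_cast h1)
        exact ((contDiffOn_nat_succ_iff_contDiffOn_one_iteratedDerivWithin hu).mp
          (by exact_mod_cast h2)).2
      rw [← Set.uIcc_of_le hab.le] at hC ⊢
      exact hC.absolutelyContinuousOnInterval
  refine ⟨hac, ?_⟩
  have ha : ∀ᵐ t : ℝ, t ≠ a := by simp [ae_iff, measure_singleton]
  have hb : ∀ᵐ t : ℝ, t ≠ b := by simp [ae_iff, measure_singleton]
  filter_upwards [hac.ae_differentiableAt_complex, ha, hb] with t h1 h2 h3 ht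
  have h4 := (h1 ht).hasDerivAt
  rw [Set.uIcc_of_le hab.le] at ht
  have hn : Set.Icc a b ∈ 𝓝 t :=
    Icc_mem_nhds (lt_of_le_of_ne ht.1 h2.symm) (lt_of_le_of_ne ht.2 h3)
  rwa [iteratedDerivWithin_succ, derivWithin_of_mem_nhds hn]

theorem memSobolev_poly {m : ℕ} (hm : 1 ≤ m) {a b : ℝ} (hab : a < b) (p : ℂ[X]) :
    MemSobolev m a b (fun t => p.eval (t : ℂ)) ∧
      ∀ᵐ t ∂(volume.restrict (Set.Icc a b)),
        iteratedDerivWithin m (fun t : ℝ => p.eval (t : ℂ)) (Set.Icc a b) t =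
          (Polynomial.derivative^[m] p).eval (t : ℂ) := by
  refine memSobolev_of_tower (f := fun i (s : ℝ) => (Polynomial.derivative^[i] p).eval (s : ℂ))
    hm hab (fun i _ t => ?_) ?_ ?_
  · rw [Function.iterate_succ_apply']
    exact hasDerivAt_eval_ofReal _ t
  · have := isAntiderivOn_iterate_derivative p a b (m - 1)
    rwa [Nat.sub_add_cancel hm] at this
  · have hc : Continuous fun s : ℝ => (Polynomial.derivative^[m] p).eval (s : ℂ) := by fun_prop
    obtain ⟨M, hM⟩ :=
      isCompact_Icc.exists_bound_of_continuousOn (hc.continuousOn (s := Set.Icc a b))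
    exact MemLp.of_bound hc.aestronglyMeasurable M
      ((ae_restrict_iff' measurableSet_Icc).mpr (Eventually.of_forall hM))

variable {κ : Type*} [Fintype κ]

theorem memSobolev_star_errorKernel {ω : ℝ} (hω : ω ≠ 0) {a b : ℝ} (hab : a < b) {x : κ → ℝ}
    (hx : ∀ β, x β ∈ Set.Icc a b) (ε : ℂ) (C : κ → ℂ) (c : ℂ) {m : ℕ} (hm : 1 ≤ m) :
    MemSobolev m a b (fun t => c * star (errorKernel ω a x ε C (2 * m - 1) t)) ∧
      ∀ᵐ t ∂(volume.restrict (Set.Icc a b)),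
        iteratedDerivWithin m (fun t => c * star (errorKernel ω a x ε C (2 * m - 1) t))
          (Set.Icc a b) t = c * star (errorKernel ω a x ε C (m - 1) t) := by
  have := memSobolev_of_tower (f := fun i t => c * star (errorKernel ω a x ε C (2 * m - 1 - i) t))
    hm hab (fun i hi t => ?_) ?_ ?_
  · simpa only [Nat.sub_zero, show 2 * m - 1 - m = m - 1 by omega] using this
  · obtain ⟨j, hj⟩ : ∃ j, 2 * m - 1 - (i + 1) = j + 1 := ⟨2 * m - 1 - (i + 1) - 1, by omega⟩
    rw [hj, show 2 * m - 1 - i = j + 2 by omega]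
    exact (hasDerivAt_errorKernel hω a x ε C j t).star.const_mul c
  · rw [show 2 * m - 1 - (m - 1) = (m - 1) + 1 by omega, show 2 * m - 1 - m = m - 1 by omega]
    exact (isAntiderivOn_errorKernel hω a b x ε C (m - 1)).conj.const_mul c
  · rw [show 2 * m - 1 - m = m - 1 by omega]
    exact ((memLp_errorKernel hω hx ε C (m - 1) 2).star).const_mul c

theorem errorFunctional_eq_of_memSobolev {ω : ℝ} (hω : ω ≠ 0) {a b : ℝ} (hab : a < b)
    {x : κ → ℝ} (hx : ∀ β, x β ∈ Set.Icc a b) {ε : ℂ} {C : κ → ℂ} {m : ℕ} (hm : 1 ≤ m)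
    (h0 : ∀ j < m, errorKernel ω a x ε C j b = 0) {φ : ℝ → ℂ} (hφ : MemSobolev m a b φ) :
    errorFunctional ω a b x ε C φ = (-1) ^ m * ∫ t in Set.Icc a b,
      errorKernel ω a x ε C (m - 1) t * iteratedDerivWithin m φ (Set.Icc a b) t := by
  have := errorFunctional_eq_integral (φ := fun i => iteratedDerivWithin i φ (Set.Icc a b))
    hω hab.le hx hm (fun i hi => isAntiderivOn_of_memSobolev hab hφ hi) h0
  rw [iteratedDerivWithin_zero, intervalIntegral.integral_of_le hab.le,
    ← integral_Icc_eq_integral_Ioc] at this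
  exact this

/-- The squared norm of the Peano kernel of order `m`. -/
noncomputable def kernelSq (ω a b : ℝ) (x : κ → ℝ) (ε : ℂ) (C : κ → ℂ) (m : ℕ) : ℝ :=
  ∫ t in Set.Icc a b, ‖errorKernel ω a x ε C (m - 1) t‖ ^ 2

theorem kernelSq_nonneg (ω a b : ℝ) (x : κ → ℝ) (ε : ℂ) (C : κ → ℂ) (m : ℕ) :
    0 ≤ kernelSq ω a b x ε C m := integral_nonneg fun _ => by positivity

theorem sobolevNorm_eq {m : ℕ} {a b : ℝ} (hab : a ≤ b) (φ : ℝ → ℂ) :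
    sobolevNorm m a b φ =
      Real.sqrt (∫ t in Set.Icc a b, ‖iteratedDerivWithin m φ (Set.Icc a b) t‖ ^ 2) := by
  rw [sobolevNorm, intervalIntegral.integral_of_le hab, integral_Icc_eq_integral_Ioc]

theorem norm_errorFunctional_le {ω : ℝ} (hω : ω ≠ 0) {a b : ℝ} (hab : a < b)
    {x : κ → ℝ} (hx : ∀ β, x β ∈ Set.Icc a b) {ε : ℂ} {C : κ → ℂ} {m : ℕ} (hm : 1 ≤ m)
    (h0 : ∀ j < m, errorKernel ω a x ε C j b = 0) {φ : ℝ → ℂ} (hφ : MemSobolev m a b φ) :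
    ‖errorFunctional ω a b x ε C φ‖ ≤
      Real.sqrt (kernelSq ω a b x ε C m) * sobolevNorm m a b φ := by
  rw [errorFunctional_eq_of_memSobolev hω hab hx hm h0 hφ, norm_mul, norm_pow, norm_neg, norm_one,
    one_pow, one_mul]
  refine (norm_integral_le_integral_norm _).trans ?_
  simp only [norm_mul]
  have h2 : (2 : ℝ).HolderConjugate 2 := Real.HolderConjugate.two_two
  have hk := memLp_errorKernel hω hx ε C (m - 1) 2
  have := integral_mul_norm_le_Lp_mul_Lq h2 (by simpa using hk) (by simpa using hφ.2.2)
  refine this.trans (le_of_eq ?_)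
  rw [sobolevNorm_eq hab.le, kernelSq, Real.sqrt_eq_rpow, Real.sqrt_eq_rpow]
  simp only [Real.rpow_ofNat]

/-- Equality in Cauchy-Schwarz: the extremal function is conj K_{2m-1} divided by the L² norm of
K_{m-1}, since its m-th derivative is the normalised conj K_{m-1}. -/
theorem exists_sobolev_extremal {ω : ℝ} (hω : ω ≠ 0) {a b : ℝ} (hab : a < b)
    {x : κ → ℝ} (hx : ∀ β, x β ∈ Set.Icc a b) {ε : ℂ} {C : κ → ℂ} {m : ℕ} (hm : 1 ≤ m)
    (h0 : ∀ j < m, errorKernel ω a x ε C j b = 0) (hpos : 0 < kernelSq ω a b x ε C m) :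
    ∃ φ, MemSobolev m a b φ ∧ sobolevNorm m a b φ ≤ 1 ∧
      ‖errorFunctional ω a b x ε C φ‖ = Real.sqrt (kernelSq ω a b x ε C m) := by
  set s := Real.sqrt (kernelSq ω a b x ε C m) with hs
  have hs0 : 0 < s := Real.sqrt_pos.mpr hpos
  have hss : s ^ 2 = kernelSq ω a b x ε C m := Real.sq_sqrt hpos.le
  obtain ⟨h1, h2⟩ := memSobolev_star_errorKernel hω hab hx ε C ((s⁻¹ : ℝ) : ℂ) hm
  refine ⟨_, h1, ?_, ?_⟩
  · rw [sobolevNorm_eq hab.le]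
    refine Real.sqrt_le_iff.mpr ⟨zero_le_one, ?_⟩
    have : ∫ t in Set.Icc a b, ‖iteratedDerivWithin m (fun t => ((s⁻¹ : ℝ) : ℂ) *
        star (errorKernel ω a x ε C (2 * m - 1) t)) (Set.Icc a b) t‖ ^ 2 =
        ∫ t in Set.Icc a b, (s⁻¹) ^ 2 * ‖errorKernel ω a x ε C (m - 1) t‖ ^ 2 := by
      refine integral_congr_ae ?_
      filter_upwards [h2] with t ht
      rw [ht, norm_mul, Complex.norm_real, norm_star, mul_pow, Real.norm_eq_abs, sq_abs]
    rw [this, integral_const_mul, ← kernelSq, ← hss]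
    field_simp
    exact le_rfl
  · rw [errorFunctional_eq_of_memSobolev hω hab hx hm h0 h1, norm_mul, norm_pow, norm_neg,
      norm_one, one_pow, one_mul]
    have : ∫ t in Set.Icc a b, errorKernel ω a x ε C (m - 1) t *
        iteratedDerivWithin m (fun t => ((s⁻¹ : ℝ) : ℂ) *
        star (errorKernel ω a x ε C (2 * m - 1) t)) (Set.Icc a b) t =
        ∫ t in Set.Icc a b, ((s⁻¹ * ‖errorKernel ω a x ε C (m - 1) t‖ ^ 2 : ℝ) : ℂ) := by
      refine integral_congr_ae ?_
      filter_upwards [h2] with t ht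
      rw [ht]
      have := Complex.mul_conj' (errorKernel ω a x ε C (m - 1) t)
      push_cast
      rw [← this]
      simp only [Complex.star_def]
      ring
    rw [this, integral_complex_ofReal, integral_const_mul, ← kernelSq, ← hss, Complex.norm_real,
      Real.norm_eq_abs, abs_of_pos (by positivity)]
    field_simp

/-- Up to sign the integral is the functional of D at conj K_{2m-1}. With ε = 0 that functional sees
only node values, where conj K_{2m-1} agrees with a polynomial of degree < m, and such polynomials
are annihilated. -/
theorem integral_kernel_mul_star_eq_zero {ω : ℝ} (hω : ω ≠ 0) {a b : ℝ} (hab : a < b)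
    {x : κ → ℝ} (hx : ∀ β, x β ∈ Set.Icc a b) {D : κ → ℂ} {m : ℕ} (hm : 1 ≤ m)
    (h0 : ∀ j < m, errorKernel ω a x 0 D j b = 0) {ε : ℂ} {C : κ → ℂ} {p : ℂ[X]}
    (hp : p.degree < m) (hC : ∀ β, errorKernel ω a x ε C (2 * m - 1) (x β) = p.eval (x β : ℂ)) :
    ∫ t in Set.Icc a b, errorKernel ω a x 0 D (m - 1) t *
      star (errorKernel ω a x ε C (m - 1) t) = 0 := by
  obtain ⟨h1, h2⟩ := memSobolev_star_errorKernel hω hab hx ε C 1 hm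
  have e1 := errorFunctional_eq_of_memSobolev hω hab hx hm h0 h1
  have hpd : (p.map (starRingEnd ℂ)).degree < m := (Polynomial.degree_map_le).trans_lt hp
  have e2 := errorFunctional_poly_eq_zero hω hab.le hx hm h0 hpd
  have e3 : errorFunctional ω a b x 0 D
      (fun t => 1 * star (errorKernel ω a x ε C (2 * m - 1) t)) =
      errorFunctional ω a b x 0 D (fun t => (p.map (starRingEnd ℂ)).eval (t : ℂ)) := by
    unfold errorFunctional
    rw [zero_mul, zero_mul]
    congr 1
    refine Finset.sum_congr rfl fun β _ => ?_
    dsimp only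
    rw [hC β, one_mul]
    congr 1
    have : ((x β : ℝ) : ℂ) = starRingEnd ℂ (x β : ℂ) := (Complex.conj_ofReal _).symm
    conv_rhs => rw [this]
    rw [Polynomial.eval_map_apply, Complex.star_def]
  rw [e3, e2] at e1
  have e4 := (mul_eq_zero.mp e1.symm).resolve_left (pow_ne_zero _ (by norm_num))
  refine Eq.trans (integral_congr_ae ?_) e4
  filter_upwards [h2] with t ht
  rw [ht, one_mul]

/-- A kernel that is zero almost everywhere makes the functional vanish on every polynomial, of any
degree, in particular on the Lagrange basis of the nodes. -/
theorem eq_zero_of_kernelSq_eq_zero {ω : ℝ} (hω : ω ≠ 0) {a b : ℝ} (hab : a < b)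
    {x : κ → ℝ} (hx : ∀ β, x β ∈ Set.Icc a b) (hinj : Function.Injective x) {D : κ → ℂ} {m : ℕ}
    (hm : 1 ≤ m) (h0 : ∀ j < m, errorKernel ω a x 0 D j b = 0)
    (hsq : kernelSq ω a b x 0 D m = 0) : D = 0 := by
  classical
  have hk := memLp_errorKernel hω hx 0 D (m - 1) 2
  have hae : ∀ᵐ t ∂(volume.restrict (Set.Icc a b)), errorKernel ω a x 0 D (m - 1) t = 0 := by
    rw [kernelSq, integral_eq_zero_iff_of_nonneg (fun t => by positivity)
      (MemLp.integrable_norm_pow (p := 2) (by exact_mod_cast hk) two_ne_zero)] at hsq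
    filter_upwards [hsq] with t ht
    simpa using ht
  have hfun : ∀ p : ℂ[X], ∑ β, D β * p.eval (x β : ℂ) = 0 := by
    intro p
    have e := errorFunctional_eq_of_memSobolev hω hab hx hm h0 (memSobolev_poly hm hab p).1
    rw [integral_eq_zero_of_ae, mul_zero] at e
    · simpa [errorFunctional] using e
    · filter_upwards [hae] with t ht
      rw [ht]; simp
  have hinj' : Function.Injective fun β => (x β : ℂ) := Complex.ofReal_injective.comp hinj
  funext β
  have := hfun (Lagrange.basis Finset.univ (fun β => (x β : ℂ)) β)
  rw [Finset.sum_eq_single β] at this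
  · rwa [Lagrange.eval_basis_self hinj'.injOn (Finset.mem_univ β), mul_one] at this
  · intro γ _ hne
    have e := Lagrange.eval_basis_of_ne (s := Finset.univ) (v := fun β => (x β : ℂ)) hne.symm
      (Finset.mem_univ γ)
    rw [e, mul_zero]
  · intro h; exact absurd (Finset.mem_univ β) h

/-- Coefficients of a homogeneous functional whose kernel interpolates a polynomial vanish. -/
theorem eq_zero_of_homogeneous {ω : ℝ} (hω : ω ≠ 0) {a b : ℝ} (hab : a < b)
    {x : κ → ℝ} (hx : ∀ β, x β ∈ Set.Icc a b) (hinj : Function.Injective x) {D : κ → ℂ} {m : ℕ}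
    (hm : 1 ≤ m) (h0 : ∀ j < m, errorKernel ω a x 0 D j b = 0) {p : ℂ[X]} (hp : p.degree < m)
    (hD : ∀ β, errorKernel ω a x 0 D (2 * m - 1) (x β) = p.eval (x β : ℂ)) : D = 0 := by
  refine eq_zero_of_kernelSq_eq_zero hω hab hx hinj hm h0 ?_
  -- Taking D for both functionals makes the kernel orthogonal to itself.
  have := integral_kernel_mul_star_eq_zero hω hab hx hm h0 hp hD
  have e : ∀ t, errorKernel ω a x 0 D (m - 1) t * star (errorKernel ω a x 0 D (m - 1) t) =
      ((‖errorKernel ω a x 0 D (m - 1) t‖ ^ 2 : ℝ) : ℂ) := by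
    intro t
    rw [Complex.star_def, Complex.mul_conj']; push_cast; rfl
  simp only [e] at this
  rw [integral_complex_ofReal] at this
  exact_mod_cast this

theorem errorKernel_sub (ω a : ℝ) (x : κ → ℝ) (ε : ℂ) (C C' : κ → ℂ) (j : ℕ) (t : ℝ) :
    errorKernel ω a x 0 (C - C') j t =
      errorKernel ω a x ε C j t - errorKernel ω a x ε C' j t := by
  simp only [errorKernel, Pi.sub_apply, sub_mul, Finset.sum_sub_distrib]
  ring

/-- Pythagoras: the kernel of C' is that of C plus that of C' - C, and these two are orthogonal. -/
theorem kernelSq_eq_add {ω : ℝ} (hω : ω ≠ 0) {a b : ℝ} (hab : a < b)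
    {x : κ → ℝ} (hx : ∀ β, x β ∈ Set.Icc a b) {ε : ℂ} {C C' : κ → ℂ} {m : ℕ} (hm : 1 ≤ m)
    (h0 : ∀ j < m, errorKernel ω a x ε C j b = 0) (h0' : ∀ j < m, errorKernel ω a x ε C' j b = 0)
    {p : ℂ[X]} (hp : p.degree < m)
    (hC : ∀ β, errorKernel ω a x ε C (2 * m - 1) (x β) = p.eval (x β : ℂ)) :
    kernelSq ω a b x ε C' m = kernelSq ω a b x ε C m + kernelSq ω a b x 0 (C' - C) m := by
  have hD : ∀ j < m, errorKernel ω a x 0 (C' - C) j b = 0 := fun j hj => by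
    rw [errorKernel_sub ω a x ε, h0 j hj, h0' j hj, sub_zero]
  have horth := integral_kernel_mul_star_eq_zero hω hab hx hm hD hp hC
  have k1 := memLp_errorKernel hω hx ε C (m - 1) 2
  have k2 := memLp_errorKernel hω hx 0 (C' - C) (m - 1) 2
  have i1 : Integrable (fun t => ‖errorKernel ω a x ε C (m - 1) t‖ ^ 2)
      (volume.restrict (Set.Icc a b)) :=
    MemLp.integrable_norm_pow (p := 2) (by exact_mod_cast k1) two_ne_zero
  have i2 : Integrable (fun t => ‖errorKernel ω a x 0 (C' - C) (m - 1) t‖ ^ 2)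
      (volume.restrict (Set.Icc a b)) :=
    MemLp.integrable_norm_pow (p := 2) (by exact_mod_cast k2) two_ne_zero
  have i3 : Integrable (fun t => errorKernel ω a x 0 (C' - C) (m - 1) t *
      star (errorKernel ω a x ε C (m - 1) t)) (volume.restrict (Set.Icc a b)) :=
    k2.integrable_mul (p := 2) (q := 2) k1.star
  have hre : ∫ t in Set.Icc a b, (errorKernel ω a x 0 (C' - C) (m - 1) t *
      star (errorKernel ω a x ε C (m - 1) t)).re = 0 := by
    have h := integral_re (𝕜 := ℂ) i3
    rw [horth] at h
    simpa using h
  have i3' : Integrable (fun t => 2 * (errorKernel ω a x 0 (C' - C) (m - 1) t *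
      star (errorKernel ω a x ε C (m - 1) t)).re) (volume.restrict (Set.Icc a b)) :=
    (i3.re (𝕜 := ℂ)).const_mul 2
  have key : ∀ t, ‖errorKernel ω a x ε C' (m - 1) t‖ ^ 2 =
      ‖errorKernel ω a x ε C (m - 1) t‖ ^ 2 + ‖errorKernel ω a x 0 (C' - C) (m - 1) t‖ ^ 2 +
      2 * (errorKernel ω a x 0 (C' - C) (m - 1) t * star (errorKernel ω a x ε C (m - 1) t)).re := by
    intro t
    have e := errorKernel_sub ω a x ε C' C (m - 1) t
    generalize errorKernel ω a x 0 (C' - C) (m - 1) t = d at *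
    generalize errorKernel ω a x ε C (m - 1) t = u at *
    have : errorKernel ω a x ε C' (m - 1) t = u + d := by rw [e]; ring
    rw [this, ← Complex.normSq_eq_norm_sq, ← Complex.normSq_eq_norm_sq,
      ← Complex.normSq_eq_norm_sq, add_comm u d, Complex.normSq_add, Complex.star_def]
    ring
  have i12 : Integrable (fun t => ‖errorKernel ω a x ε C (m - 1) t‖ ^ 2 +
      ‖errorKernel ω a x 0 (C' - C) (m - 1) t‖ ^ 2) (volume.restrict (Set.Icc a b)) := i1.add i2
  unfold kernelSq
  rw [integral_congr_ae (Eventually.of_forall key), integral_add i12 i3',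
    integral_add i1 i2, integral_const_mul, hre]
  ring

end Sobolev

/-! ### Characterisation of the optimal coefficients -/

section SardOptimality

open MeasureTheory

/-- The nodes `hβ + a`. -/
noncomputable def node (N : ℕ) (a b : ℝ) (β : Fin (N + 1)) : ℝ :=
  (b - a) / (N : ℝ) * ((β : ℕ) : ℝ) + a

theorem node_mem_Icc {N : ℕ} (hN : 1 ≤ N) {a b : ℝ} (hab : a < b) (β : Fin (N + 1)) :
    node N a b β ∈ Set.Icc a b := by
  have hN' : (0 : ℝ) < N := by exact_mod_cast hN
  have hβ : ((β : ℕ) : ℝ) ≤ N := by exact_mod_cast Nat.lt_succ_iff.mp β.2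
  have h0 : 0 < b - a := sub_pos.mpr hab
  constructor
  · have : 0 ≤ (b - a) / (N : ℝ) * ((β : ℕ) : ℝ) := by positivity
    unfold node; linarith
  · have : (b - a) / (N : ℝ) * ((β : ℕ) : ℝ) ≤ (b - a) / (N : ℝ) * N := by gcongr
    rw [div_mul_cancel₀ _ hN'.ne'] at this
    unfold node; linarith

theorem node_injective {N : ℕ} (hN : 1 ≤ N) {a b : ℝ} (hab : a < b) :
    Function.Injective (node N a b) := by
  intro β γ h
  have hN' : (0 : ℝ) < N := by exact_mod_cast hN
  have h0 : (b - a) / (N : ℝ) ≠ 0 := (div_pos (sub_pos.mpr hab) hN').ne'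
  unfold node at h
  have := mul_left_cancel₀ h0 (add_right_cancel h)
  exact Fin.ext (by exact_mod_cast this)

theorem quadError_eq (N : ℕ) (a b ω : ℝ) (C : Fin (N + 1) → ℂ) (φ : ℝ → ℂ) :
    quadError N a b ω C φ = errorFunctional ω a b (node N a b) 1 C φ := by
  simp [quadError, errorFunctional, node]

theorem natDegree_lt_of_degree_lt {p : ℂ[X]} {m : ℕ} (hm : 1 ≤ m) (hp : p.degree < m) :
    p.natDegree < m := by
  by_cases h : p = 0
  · rw [h, Polynomial.natDegree_zero]; omega
  · exact (Polynomial.natDegree_lt_iff_degree_lt h).mpr hp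

theorem errorFunctional_poly_of_monomials {κ : Type*} [Fintype κ] {ω a b : ℝ} {x : κ → ℝ}
    {ε : ℂ} {C : κ → ℂ} {m : ℕ} (hm : 1 ≤ m)
    (h : ∀ α < m, errorFunctional ω a b x ε C (fun t => (t : ℂ) ^ α) = 0) {p : ℂ[X]}
    (hp : p.degree < m) : errorFunctional ω a b x ε C (fun t => p.eval (t : ℂ)) = 0 := by
  have hev : ∀ z : ℂ, p.eval z = ∑ α ∈ Finset.range m, p.coeff α * z ^ α := fun z =>
    Polynomial.eval_eq_sum_range' (natDegree_lt_of_degree_lt hm hp) z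
  have : errorFunctional ω a b x ε C (fun t => p.eval (t : ℂ)) =
      ∑ α ∈ Finset.range m, p.coeff α *
        errorFunctional ω a b x ε C (fun t => (t : ℂ) ^ α) := by
    unfold errorFunctional
    simp only [hev, Finset.mul_sum, mul_sub, Finset.sum_sub_distrib]
    congr 1
    · rw [intervalIntegral.integral_finsetSum, Finset.mul_sum]
      · refine Finset.sum_congr rfl fun α _ => ?_
        have e : ∀ t : ℝ, expo ω t * (p.coeff α * (t : ℂ) ^ α) =
          p.coeff α * (expo ω t * (t : ℂ) ^ α) := fun t => by ring
        simp only [e]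
        rw [intervalIntegral.integral_const_mul]
        ring
      · intro α _
        have := continuous_expo ω
        exact Continuous.intervalIntegrable (by fun_prop) _ _
    · rw [Finset.sum_comm]
      exact Finset.sum_congr rfl fun α _ => Finset.sum_congr rfl fun β _ => by ring
  rw [this]
  exact Finset.sum_eq_zero fun α hα => by rw [h α (Finset.mem_range.mp hα), mul_zero]

theorem errorNorm_eq_of_exact {m N : ℕ} (hm : 1 ≤ m) (hN : 1 ≤ N) {a b : ℝ} (hab : a < b)
    {ω : ℝ} (hω : ω ≠ 0) {C : Fin (N + 1) → ℂ}
    (h0 : ∀ j < m, errorKernel ω a (node N a b) 1 C j b = 0) :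
    errorNorm m N a b ω C =
      ENNReal.ofReal (Real.sqrt (kernelSq ω a b (node N a b) 1 C m)) := by
  have hx := node_mem_Icc hN hab
  refine le_antisymm (iSup₂_le fun φ hφ => ENNReal.ofReal_le_ofReal ?_) ?_
  · rw [quadError_eq]
    refine (norm_errorFunctional_le hω hab hx hm h0 hφ.1).trans ?_
    exact mul_le_of_le_one_right (Real.sqrt_nonneg _) hφ.2
  · rcases (kernelSq_nonneg ω a b (node N a b) 1 C m).eq_or_lt with h | h
    · rw [← h]; simp
    · obtain ⟨φ, h1, h2, h3⟩ := exists_sobolev_extremal hω hab hx hm h0 h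
      rw [← h3, ← quadError_eq]
      exact le_iSup₂ (f := fun φ _ => ENNReal.ofReal ‖quadError N a b ω C φ‖) φ ⟨h1, h2⟩

/-- Multiples of a polynomial of degree < m all have seminorm 0 and lie in the unit ball, while the
functional is unbounded on them. -/
theorem errorNorm_eq_top {m N : ℕ} (hm : 1 ≤ m) {a b : ℝ} (hab : a < b)
    {ω : ℝ} {C : Fin (N + 1) → ℂ} {p : ℂ[X]} (hp : p.degree < m)
    (h : errorFunctional ω a b (node N a b) 1 C (fun t => p.eval (t : ℂ)) ≠ 0) :
    errorNorm m N a b ω C = ⊤ := by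
  set v := errorFunctional ω a b (node N a b) 1 C (fun t => p.eval (t : ℂ)) with hv
  have hv0 : 0 < ‖v‖ := norm_pos_iff.mpr h
  refine ENNReal.eq_top_of_forall_nnreal_le fun r => ?_
  set c : ℂ := ((r / ‖v‖ : ℝ) : ℂ) with hc
  have hpc : (Polynomial.C c * p).degree < m := by
    rw [← Polynomial.smul_eq_C_mul]
    exact (Polynomial.degree_smul_le _ _).trans_lt hp
  obtain ⟨h1, h2⟩ := memSobolev_poly hm hab (Polynomial.C c * p)
  have hz : Polynomial.derivative^[m] (Polynomial.C c * p) = 0 :=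
    Polynomial.iterate_derivative_eq_zero (natDegree_lt_of_degree_lt hm hpc)
  have hs : sobolevNorm m a b (fun t => (Polynomial.C c * p).eval (t : ℂ)) = 0 := by
    rw [sobolevNorm_eq hab.le, integral_eq_zero_of_ae, Real.sqrt_zero]
    filter_upwards [h2] with t ht
    rw [ht, hz]; simp
  have hq : quadError N a b ω C (fun t => (Polynomial.C c * p).eval (t : ℂ)) = c * v := by
    rw [quadError_eq, hv]
    unfold errorFunctional
    simp only [Polynomial.eval_mul, Polynomial.eval_C]
    have e : ∀ t : ℝ, expo ω t * (c * p.eval (t : ℂ)) = c * (expo ω t * p.eval (t : ℂ)) :=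
      fun t => by ring
    simp only [e]
    rw [intervalIntegral.integral_const_mul, mul_sub, Finset.mul_sum]
    congr 1
    · ring
    · exact Finset.sum_congr rfl fun β _ => by ring
  have hle := le_iSup₂ (f := fun φ (_ : φ ∈ {φ : ℝ → ℂ | MemSobolev m a b φ ∧
    sobolevNorm m a b φ ≤ 1}) => ENNReal.ofReal ‖quadError N a b ω C φ‖) _
    ⟨h1, by rw [hs]; exact zero_le_one⟩
  refine le_trans (le_of_eq ?_) hle
  rw [hq, norm_mul, hc, Complex.norm_real, Real.norm_eq_abs,
    abs_of_nonneg (div_nonneg (NNReal.coe_nonneg r) hv0.le), div_mul_cancel₀ _ hv0.ne',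
    ENNReal.ofReal_coe_nnreal]

/-- Coefficients which are exact on polynomials of degree less than `m` and whose kernel of order
`2m` interpolates such a polynomial at the nodes are the unique optimal ones. -/
theorem isSardOptimal_iff_eq {m N : ℕ} (hm : 1 ≤ m) (hN : 1 ≤ N) {a b : ℝ} (hab : a < b)
    {ω : ℝ} (hω : ω ≠ 0) {Cs : Fin (N + 1) → ℂ}
    (h0 : ∀ j < m, errorKernel ω a (node N a b) 1 Cs j b = 0) {p : ℂ[X]} (hp : p.degree < m)
    (hC : ∀ β, errorKernel ω a (node N a b) 1 Cs (2 * m - 1) (node N a b β) =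
      p.eval (node N a b β : ℂ)) (C : Fin (N + 1) → ℂ) :
    IsSardOptimal m N a b ω C ↔ C = Cs := by
  have hx := node_mem_Icc hN hab
  have hinj := node_injective hN hab
  have hle : ∀ C', errorNorm m N a b ω Cs ≤ errorNorm m N a b ω C' := by
    intro C'
    by_cases h : ∀ p : ℂ[X], p.degree < m →
        errorFunctional ω a b (node N a b) 1 C' (fun t => p.eval (t : ℂ)) = 0
    · have h0' : ∀ j < m, errorKernel ω a (node N a b) 1 C' j b = 0 := fun j hj =>
        errorKernel_right_eq_zero hω hab.le hx h hj
      rw [errorNorm_eq_of_exact hm hN hab hω h0, errorNorm_eq_of_exact hm hN hab hω h0',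
        kernelSq_eq_add hω hab hx hm h0 h0' hp hC]
      refine ENNReal.ofReal_le_ofReal (Real.sqrt_le_sqrt ?_)
      linarith [kernelSq_nonneg ω a b (node N a b) 0 (C' - Cs) m]
    · push Not at h
      obtain ⟨p, hp, hne⟩ := h
      rw [errorNorm_eq_top hm hab hp hne]
      exact le_top
  have hinf : errorNorm m N a b ω Cs = ⨅ C' : Fin (N + 1) → ℂ, errorNorm m N a b ω C' :=
    le_antisymm (le_iInf hle) (iInf_le _ _)
  constructor
  · rintro ⟨hex, hopt⟩
    have hmon : ∀ α < m, errorFunctional ω a b (node N a b) 1 C (fun t => (t : ℂ) ^ α) = 0 :=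
      fun α hα => by rw [← quadError_eq]; exact hex α hα
    have h0' : ∀ j < m, errorKernel ω a (node N a b) 1 C j b = 0 := fun j hj =>
      errorKernel_right_eq_zero hω hab.le hx
        (fun p hp => errorFunctional_poly_of_monomials hm hmon hp) hj
    rw [← hinf, errorNorm_eq_of_exact hm hN hab hω h0, errorNorm_eq_of_exact hm hN hab hω h0',
      ENNReal.ofReal_eq_ofReal_iff (Real.sqrt_nonneg _) (Real.sqrt_nonneg _),
      Real.sqrt_inj (kernelSq_nonneg _ _ _ _ _ _ _) (kernelSq_nonneg _ _ _ _ _ _ _),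
      kernelSq_eq_add hω hab hx hm h0 h0' hp hC] at hopt
    have hD : ∀ j < m, errorKernel ω a (node N a b) 0 (C - Cs) j b = 0 := fun j hj => by
      rw [errorKernel_sub ω a (node N a b) 1, h0 j hj, h0' j hj, sub_zero]
    exact sub_eq_zero.mp
      (eq_zero_of_kernelSq_eq_zero hω hab hx hinj hm hD (by linarith))
  · rintro rfl
    refine ⟨fun α hα => ?_, hinf⟩
    rw [quadError_eq]
    have := errorFunctional_poly_eq_zero hω hab.le hx hm h0 (p := Polynomial.X ^ α)
      (by rw [Polynomial.degree_X_pow]; exact_mod_cast hα)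
    simpa using this

end SardOptimality

/-! ### Kernel values at the nodes as truncated errors -/

section Bridge

open Polynomial

/-- Integration by parts on the half line, with the value at infinity regularised to 0. -/
theorem regInt_derivative {θ : ℂ} (hθ : θ ≠ 0) (f : ℂ[X]) :
    θ * regInt θ f = -f.eval 0 - regInt θ (derivative f) := by
  induction f using Polynomial.induction_on' with
  | add p q hp hq =>
    simp only [map_add, eval_add]
    linear_combination hp + hq
  | monomial n c =>
    rw [← C_mul_X_pow_eq_monomial, derivative_C_mul_X_pow, ← smul_eq_C_mul, ← smul_eq_C_mul]
    simp only [map_smul, smul_eq_mul, eval_smul, regInt_X_pow]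
    cases n with
    | zero => simp; field_simp
    | succ n =>
      rw [Nat.add_sub_cancel, Nat.factorial_succ]
      simp
      field_simp
      ring

theorem expo_nat_mul (ω h : ℝ) (γ : ℕ) : expo ω (h * γ) = expo ω h ^ γ := by
  rw [expo, expo, ← Complex.exp_nat_mul]; push_cast; congr 1; ring

theorem taylor_sub_X_pow (y : ℂ) (n : ℕ) :
    taylor y ((C y - X) ^ n) = ((-1) ^ n : ℂ) • X ^ n := by
  rw [taylor_apply, pow_comp, sub_comp, C_comp, X_comp, smul_eq_C_mul, C_pow,
    show C y - (X + C y) = -X by ring, neg_pow]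
  simp

/-- Cauchy's formula for the repeated integral, (1/n!) ∫ e^{2πiωs} (x-s)^n ds from a to x, rescaled
to the step and written as a difference of two regularised integrals. -/
theorem expoPrim_node {ω h : ℝ} (hω : ω ≠ 0) (hh : h ≠ 0) (a : ℝ) (n γ : ℕ) :
    expoPrim ω a (n + 1) (h * γ + a) = (h : ℂ) ^ (n + 1) / (n.factorial : ℂ) * (expo ω a *
      (regInt (phase ω h) ((C (γ : ℂ) - X) ^ n) - expo ω h ^ γ *
        regInt (phase ω h) (taylor (γ : ℂ) ((C (γ : ℂ) - X) ^ n)))) := by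
  have hw := freq_ne_zero hω
  have hh' : (h : ℂ) ≠ 0 := by exact_mod_cast hh
  have hph : phase ω h = freq ω * h := by rw [phase, freq]
  have hθ : phase ω h ≠ 0 := by rw [hph]; exact mul_ne_zero hw hh'
  have hex : expo ω (h * γ + a) = expo ω h ^ γ * expo ω a := by rw [expo_add, expo_nat_mul]
  induction n with
  | zero =>
    have ht : taylor (γ : ℂ) (1 : ℂ[X]) = 1 := by simp
    simp only [expoPrim, hex, pow_zero, ht, regInt_one, hph]
    simp
    field_simp
    ring
  | succ n ih =>
    rw [taylor_sub_X_pow, map_smul, regInt_X_pow] at ih ⊢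
    rw [expoPrim]
    dsimp only
    rw [ih]
    have hd := regInt_derivative hθ ((C (γ : ℂ) - X) ^ (n + 1))
    have hder : derivative ((C (γ : ℂ) - X) ^ (n + 1) : ℂ[X]) =
        (-((n : ℂ) + 1)) • (C (γ : ℂ) - X) ^ n := by
      rw [derivative_pow, derivative_sub, derivative_C, derivative_X, smul_eq_C_mul]
      simp
      ring
    rw [hder, map_smul] at hd
    simp only [eval_pow, eval_sub, eval_C, eval_X, sub_zero, smul_eq_mul] at hd ⊢
    generalize regInt (phase ω h) ((C (γ : ℂ) - X) ^ n) = I0 at *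
    have hI : regInt (phase ω h) ((C (γ : ℂ) - X) ^ (n + 1)) =
        (-(γ : ℂ) ^ (n + 1) - -((n : ℂ) + 1) * I0) / phase ω h := by
      rw [← hd]; field_simp
    rw [hI, hph]
    have hf : (n.factorial : ℂ) ≠ 0 := by exact_mod_cast Nat.factorial_ne_zero n
    have hn : (n : ℂ) + 1 ≠ 0 := by exact_mod_cast Nat.succ_ne_zero n
    have hsq : ((-1 : ℂ) ^ n) ^ 2 = 1 := by rw [← pow_mul, mul_comm, pow_mul]; simp
    rw [Nat.factorial_succ]
    push_cast
    rw [show (h : ℂ) * γ + a - a = h * γ by ring, mul_pow]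
    field_simp
    ring

variable {ι : Type*} [Fintype ι]

/-- For n ≥ 1 the truncated power kills every node from γ on, including γ itself, so the sum stops
before γ. -/
theorem errorKernel_node {ω h : ℝ} (hω : ω ≠ 0) {N : ℕ} {a b : ℝ}
    (hh : h = (b - a) / (N : ℝ)) (hpos : 0 < h) (ρ d : ι → ℂ) (ε : ℂ) {n γ : ℕ} (hn : 1 ≤ n)
    (hγ : γ ≤ N) :
    errorKernel ω a (node N a b) ε
      (fun β => h * quadCoeff ρ d (ε * expo ω a) (expo ω h) (phase ω h) N β) n (h * γ + a) =
      (h : ℂ) ^ (n + 1) / (n.factorial : ℂ) *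
        truncError ρ d (ε * expo ω a) (expo ω h) (phase ω h) N γ ((C (γ : ℂ) - X) ^ n) := by
  have hs : ∑ β : Fin (N + 1), (h * quadCoeff ρ d (ε * expo ω a) (expo ω h) (phase ω h) N β) *
      ((truncPow n (h * γ + a - node N a b β) : ℝ) : ℂ) =
      (h : ℂ) ^ (n + 1) / (n.factorial : ℂ) * ∑ β ∈ Finset.range γ,
        quadCoeff ρ d (ε * expo ω a) (expo ω h) (phase ω h) N β *
          ((C (γ : ℂ) - X) ^ n).eval (β : ℂ) := by
    simp only [node]
    rw [Fin.sum_univ_eq_sum_range (fun β => (h * quadCoeff ρ d (ε * expo ω a) (expo ω h)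
      (phase ω h) N β) * ((truncPow n (h * γ + a - ((b - a) / (N : ℝ) * (β : ℝ) + a)) : ℝ) : ℂ))
      (N + 1), ← Finset.sum_subset (s₁ := Finset.range γ)
      (Finset.range_subset_range.mpr (by omega)), Finset.mul_sum]
    · refine Finset.sum_congr rfl fun β hβ => ?_
      have hβ : (β : ℝ) ≤ γ := by exact_mod_cast (Finset.mem_range.mp hβ).le
      rw [← hh, show h * γ + a - (h * β + a) = h * (γ - β) by ring, truncPow,
        if_pos (mul_nonneg hpos.le (by linarith))]
      simp only [eval_pow, eval_sub, eval_C, eval_X]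
      push_cast
      rw [mul_pow]
      ring
    · intro β _ hβ
      have hβ : (γ : ℝ) ≤ β := by
        exact_mod_cast not_lt.mp fun hlt => hβ (Finset.mem_range.mpr hlt)
      obtain ⟨n, rfl⟩ : ∃ k, n = k + 1 := ⟨n - 1, by omega⟩
      rw [← hh, show h * γ + a - (h * β + a) = -(h * (β - γ)) by ring,
        truncPow_succ_of_nonpos _ (neg_nonpos.mpr (mul_nonneg hpos.le (by linarith)))]
      simp
  rw [errorKernel, expoPrim_node hω hpos.ne', hs, truncError]
  ring

/-- The order n = 0 is included here: the node N then contributes, which accounts for the separate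
last term. -/
theorem errorKernel_right {ω h : ℝ} (hω : ω ≠ 0) {N : ℕ} (hN : 1 ≤ N) {a b : ℝ}
    (hh : h = (b - a) / (N : ℝ)) (hpos : 0 < h) (ρ d : ι → ℂ) (ε : ℂ) (n : ℕ) :
    errorKernel ω a (node N a b) ε
      (fun β => h * quadCoeff ρ d (ε * expo ω a) (expo ω h) (phase ω h) N β) n b =
      (h : ℂ) ^ (n + 1) / (n.factorial : ℂ) *
        (truncError ρ d (ε * expo ω a) (expo ω h) (phase ω h) N N ((C (N : ℂ) - X) ^ n) -
          quadCoeff ρ d (ε * expo ω a) (expo ω h) (phase ω h) N N *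
            ((C (N : ℂ) - X) ^ n).eval (N : ℂ)) := by
  have hN' : (N : ℝ) ≠ 0 := by exact_mod_cast (by omega : N ≠ 0)
  have hb : b = h * N + a := by rw [hh]; field_simp; ring
  have hs : ∑ β : Fin (N + 1), (h * quadCoeff ρ d (ε * expo ω a) (expo ω h) (phase ω h) N β) *
      ((truncPow n (b - node N a b β) : ℝ) : ℂ) =
      (h : ℂ) ^ (n + 1) / (n.factorial : ℂ) * ∑ β ∈ Finset.range (N + 1),
        quadCoeff ρ d (ε * expo ω a) (expo ω h) (phase ω h) N β *
          ((C (N : ℂ) - X) ^ n).eval (β : ℂ) := by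
    simp only [node]
    rw [Fin.sum_univ_eq_sum_range (fun β => (h * quadCoeff ρ d (ε * expo ω a) (expo ω h)
      (phase ω h) N β) * ((truncPow n (b - ((b - a) / (N : ℝ) * (β : ℝ) + a)) : ℝ) : ℂ))
      (N + 1), Finset.mul_sum]
    refine Finset.sum_congr rfl fun β hβ => ?_
    have hβ : (β : ℝ) ≤ N := by exact_mod_cast Nat.lt_succ_iff.mp (Finset.mem_range.mp hβ)
    have e : b - ((b - a) / (N : ℝ) * (β : ℝ) + a) = h * (N - β) := by
      rw [← hh]; linear_combination hb
    rw [e, truncPow, if_pos (mul_nonneg hpos.le (by linarith))]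
    simp only [eval_pow, eval_sub, eval_C, eval_X]
    push_cast
    rw [mul_pow]
    ring
  have hE := expoPrim_node hω hpos.ne' a n N
  rw [← hb] at hE
  rw [errorKernel, hE, hs, truncError, Finset.sum_range_succ]
  ring

end Bridge

/-! ### The linear system as conditions on end moments -/

section SystemForm

open Polynomial

theorem aeval_powerSumPoly_eq_sum {ρ : ℂ} (hρ : ρ ≠ 1) {j : ℕ} (hj : 1 ≤ j) :
    aeval (ρ / (1 - ρ)) (powerSumPoly j) =
      ∑ t ∈ Finset.Icc 1 j, ρ ^ t * (diffZero t j : ℂ) / (1 - ρ) ^ (t + 1) := by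
  obtain ⟨j, rfl⟩ : ∃ k, j = k + 1 := ⟨j - 1, by omega⟩
  have h' : (1 - ρ) ≠ 0 := sub_ne_zero.mpr (Ne.symm hρ)
  rw [powerSumPoly_eq_sum]
  simp only [map_mul, map_add, map_one, aeval_X, map_sum, map_pow, map_intCast]
  rw [show 1 + ρ / (1 - ρ) = 1 / (1 - ρ) by field_simp; ring, Finset.mul_sum]
  refine Finset.sum_congr rfl fun t _ => ?_
  rw [div_pow, pow_succ]
  field_simp

theorem aeval_powerSumPoly_inv {ρ : ℂ} (h0 : ρ ≠ 0) (hρ : ρ ≠ 1) {j : ℕ} (hj : 1 ≤ j) :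
    aeval (ρ⁻¹ / (1 - ρ⁻¹)) (powerSumPoly j) =
      (-1) ^ (j + 1) * aeval (ρ / (1 - ρ)) (powerSumPoly j) := by
  obtain ⟨j, rfl⟩ : ∃ k, j = k + 1 := ⟨j - 1, by omega⟩
  have h' : (1 - ρ) ≠ 0 := sub_ne_zero.mpr (Ne.symm hρ)
  have h'' : (1 - ρ⁻¹) ≠ 0 := sub_ne_zero.mpr fun h => hρ (inv_eq_one.mp h.symm)
  have h3 : ρ - 1 ≠ 0 := sub_ne_zero.mpr hρ
  have h := congrArg (aeval (ρ / (1 - ρ))) (powerSumPoly_comp_reflect j)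
  rw [aeval_comp] at h
  simp only [map_sub, map_neg, map_one, aeval_X, map_mul, map_pow] at h
  rw [show ρ⁻¹ / (1 - ρ⁻¹) = -1 - ρ / (1 - ρ) by field_simp; ring, h]
  ring

/-- Inner sums of the system come in two shapes: powers of 1 - ρ below belong to the ratio ρ, powers
of ρ - 1 to the ratio 1/ρ. -/
theorem aeval_powerSumPoly_inv_eq_sum {ρ : ℂ} (h0 : ρ ≠ 0) (hρ : ρ ≠ 1) {j : ℕ} (hj : 1 ≤ j) :
    aeval (ρ⁻¹ / (1 - ρ⁻¹)) (powerSumPoly j) =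
      ∑ t ∈ Finset.Icc 1 j, ρ * (diffZero t j : ℂ) / (ρ - 1) ^ (t + 1) := by
  have h' : (1 - ρ⁻¹) ≠ 0 := sub_ne_zero.mpr fun h => hρ (inv_eq_one.mp h.symm)
  have h3 : ρ - 1 ≠ 0 := sub_ne_zero.mpr hρ
  rw [aeval_powerSumPoly_eq_sum (fun h => hρ (inv_eq_one.mp h)) hj]
  refine Finset.sum_congr rfl fun t _ => ?_
  rw [show 1 - ρ⁻¹ = (ρ - 1) / ρ by field_simp, div_pow, inv_pow, pow_succ ρ t]
  field_simp

/-- The ratios `l`, `q_k` and `q_k⁻¹` of the geometric progressions in the coefficients. -/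
noncomputable def rates {κ : Type*} (l : ℂ) (q : κ → ℂ) : Option (κ ⊕ κ) → ℂ
  | none => l
  | some (Sum.inl k) => q k
  | some (Sum.inr k) => (q k)⁻¹

/-- The amplitudes of the geometric progressions in the coefficients. -/
noncomputable def weights {κ : Type*} (c : ℂ) (A B : κ → ℂ) : Option (κ ⊕ κ) → ℂ
  | none => c
  | some (Sum.inl k) => A k
  | some (Sum.inr k) => B k

theorem weights_add {κ : Type*} (c c' : ℂ) (A A' B B' : κ → ℂ) :
    weights (c + c') (A + A') (B + B') = weights c A B + weights c' A' B' := by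
  ext (_ | _ | _) <;> rfl

theorem weights_smul {κ : Type*} (r c : ℂ) (A B : κ → ℂ) :
    weights (r * c) (r • A) (r • B) = r • weights c A B := by
  ext (_ | _ | _) <;> rfl

theorem tailError_add {ι : Type*} [Fintype ι] (ρ d d' : ι → ℂ) (e e' l θ : ℂ) (γ : ℕ)
    (f : ℂ[X]) : tailError ρ (d + d') (e + e') l θ γ f =
      tailError ρ d e l θ γ f + tailError ρ d' e' l θ γ f := by
  simp only [tailError_apply, Pi.add_apply, add_mul, Finset.sum_add_distrib]
  ring

theorem tailError_smul {ι : Type*} [Fintype ι] (ρ d : ι → ℂ) (r e l θ : ℂ) (γ : ℕ)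
    (f : ℂ[X]) : tailError ρ (r • d) (r * e) l θ γ f = r * tailError ρ d e l θ γ f := by
  simp only [tailError_apply, Pi.smul_apply, smul_eq_mul, mul_assoc, ← Finset.mul_sum, mul_sub]

theorem tailError_rates {κ : Type*} [Fintype κ] (l : ℂ) (q : κ → ℂ) (c : ℂ) (A B : κ → ℂ)
    (e θ : ℂ) (γ : ℕ) (f : ℂ[X]) :
    tailError (rates l q) (weights c A B) e l θ γ f =
      c * l ^ γ * regSum l f + (∑ k, A k * q k ^ γ * regSum (q k) f +
        ∑ k, B k * ((q k)⁻¹) ^ γ * regSum (q k)⁻¹ f) - e * l ^ γ * regInt θ f := by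
  rw [tailError_apply, Fintype.sum_option, Fintype.sum_sum_type]
  rfl

/-- The amplitudes of the progressions determined by a solution `A`, `B` of the system, for the
weight function `ε e^{2πiωx}`. -/
noncomputable def solWeights (m N : ℕ) (a ω h : ℝ) (q : Fin (m - 1) → ℝ) (ε : ℂ)
    (A B : Fin (m - 1) → ℂ) : Option (Fin (m - 1) ⊕ Fin (m - 1)) → ℂ :=
  weights (ε * expo ω a * constK m ω h) A fun k => B k * (q k : ℂ) ^ N

/-- Every sum in the equation is written for the inverse of the ratio to which it belongs, which
costs the common sign (-1)^(j+1) of the reflection. -/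
theorem firstEquation_iff {m N : ℕ} {a ω h : ℝ} (hω : expo ω h ≠ 1) {q : Fin (m - 1) → ℝ}
    (hq0 : ∀ k, (q k : ℂ) ≠ 0) (hq1 : ∀ k, (q k : ℂ) ≠ 1) (A B : Fin (m - 1) → ℂ) {j : ℕ}
    (hj : 1 ≤ j) :
    FirstEquation m N a ω h q A B j ↔
      tailError (rates (expo ω h) fun k => (q k : ℂ)) (solWeights m N a ω h q 1 A B)
        (1 * expo ω a) (expo ω h) (phase ω h) 0 (X ^ j) = 0 := by
  have hs : ((-1 : ℂ) ^ (j + 1)) * (-1) ^ (j + 1) = 1 := by rw [← mul_pow]; simp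
  have hl0 : expo ω h ≠ 0 := Complex.exp_ne_zero _
  have hA : ∀ k, ∑ t ∈ Finset.Icc 1 j, (q k : ℂ) * (diffZero t j : ℂ) / ((q k : ℂ) - 1) ^ (t + 1) =
      (-1) ^ (j + 1) * regSum (q k : ℂ) (X ^ j) := fun k => by
    rw [← aeval_powerSumPoly_inv_eq_sum (hq0 k) (hq1 k) hj,
      aeval_powerSumPoly_inv (hq0 k) (hq1 k) hj, regSum_X_pow]
  have hB : ∀ k, ∑ t ∈ Finset.Icc 1 j,
      (q k : ℂ) ^ (N + t) * (diffZero t j : ℂ) / (1 - (q k : ℂ)) ^ (t + 1) =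
      (-1) ^ (j + 1) * ((q k : ℂ) ^ N * regSum (q k : ℂ)⁻¹ (X ^ j)) := fun k => by
    rw [regSum_X_pow, aeval_powerSumPoly_inv (hq0 k) (hq1 k) hj,
      aeval_powerSumPoly_eq_sum (hq1 k) hj, Finset.mul_sum, Finset.mul_sum, Finset.mul_sum]
    refine Finset.sum_congr rfl fun t _ => ?_
    rw [pow_add]
    linear_combination -((q k : ℂ) ^ N * (q k : ℂ) ^ t * (diffZero t j : ℂ) /
      (1 - (q k : ℂ)) ^ (t + 1)) * hs
  have hC : ∑ t ∈ Finset.Icc 1 j,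
      expo ω (a + h) * (constK m ω h : ℂ) * (diffZero t j : ℂ) / (expo ω h - 1) ^ (t + 1) =
      (-1) ^ (j + 1) * (expo ω a * constK m ω h * regSum (expo ω h) (X ^ j)) := by
    have e := aeval_powerSumPoly_inv hl0 hω hj
    rw [aeval_powerSumPoly_inv_eq_sum hl0 hω hj] at e
    rw [regSum_X_pow, ← mul_left_comm, ← e, Finset.mul_sum, expo_add]
    exact Finset.sum_congr rfl fun t _ => by ring
  have hR : (j.factorial : ℂ) * expo ω a / phase ω h ^ (j + 1) =
      (-1) ^ (j + 1) * (expo ω a * regInt (phase ω h) (X ^ j)) := by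
    rw [regInt_X_pow]
    linear_combination -((j.factorial : ℂ) * expo ω a / phase ω h ^ (j + 1)) * hs
  rw [FirstEquation, solWeights, tailError_rates, hC, hR]
  simp only [hA, hB, pow_zero, mul_one, one_mul]
  have eA : ∑ k, A k * ((-1) ^ (j + 1) * regSum (q k : ℂ) (X ^ j)) =
      (-1) ^ (j + 1) * ∑ k, A k * regSum (q k : ℂ) (X ^ j) := by
    rw [Finset.mul_sum]; exact Finset.sum_congr rfl fun k _ => by ring
  have eB : ∑ k, B k * ((-1) ^ (j + 1) * ((q k : ℂ) ^ N * regSum (q k : ℂ)⁻¹ (X ^ j))) =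
      (-1) ^ (j + 1) * ∑ k, B k * (q k : ℂ) ^ N * regSum (q k : ℂ)⁻¹ (X ^ j) := by
    rw [Finset.mul_sum]; exact Finset.sum_congr rfl fun k _ => by ring
  rw [eA, eB]
  constructor
  · intro H
    refine (mul_eq_zero.mp ?_).resolve_left (left_ne_zero_of_mul_eq_one hs)
    linear_combination H
  · intro H
    linear_combination (-1) ^ (j + 1) * H

/-- Since h/(b-a) = 1/N, the outer weights are those of the binomial expansion of (X + N)^j, that
is, of X^j seen from the right end; the equation balances the two ends. -/
theorem secondEquation_iff {m N : ℕ} (hN : 1 ≤ N) {a b ω h : ℝ} (hab : a < b)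
    (hh : h = (b - a) / (N : ℝ)) (hω : expo ω h ≠ 1) {q : Fin (m - 1) → ℝ}
    (hq0 : ∀ k, (q k : ℂ) ≠ 0) (hq1 : ∀ k, (q k : ℂ) ≠ 1) (A B : Fin (m - 1) → ℂ) {j : ℕ}
    (hj : 1 ≤ j) :
    SecondEquation m N a b ω h q A B j ↔
      tailError (rates (expo ω h) fun k => (q k : ℂ)) (solWeights m N a ω h q 1 A B)
        (1 * expo ω a) (expo ω h) (phase ω h) 0 (X ^ j) =
      ∑ α ∈ Finset.Icc 1 j, ((j.choose α : ℂ) * (N : ℂ) ^ (j - α)) *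
        tailError (rates (expo ω h) fun k => (q k : ℂ)) (solWeights m N a ω h q 1 A B)
        (1 * expo ω a) (expo ω h) (phase ω h) N (X ^ α) := by
  have hN' : (N : ℝ) ≠ 0 := by exact_mod_cast (by omega : N ≠ 0)
  have hNc : (N : ℂ) ≠ 0 := by exact_mod_cast hN'
  have hba : b - a ≠ 0 := sub_ne_zero.mpr hab.ne'
  have hb : b = h * N + a := by rw [hh]; field_simp; ring
  have heb : expo ω b = expo ω h ^ N * expo ω a := by rw [hb, expo_add, expo_nat_mul]
  have hw : ∀ α ∈ Finset.Icc 1 j, ((h / (b - a) : ℝ) : ℂ) ^ ((α : ℤ) - (j : ℤ)) =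
      (N : ℂ) ^ (j - α) := fun α hα => by
    have hαj := (Finset.mem_Icc.mp hα).2
    rw [show h / (b - a) = (N : ℝ)⁻¹ by rw [hh]; field_simp,
      show ((α : ℤ) - (j : ℤ)) = -((j - α : ℕ) : ℤ) by omega]
    push_cast
    rw [zpow_neg, inv_zpow, inv_inv, zpow_natCast]
  have hA : ∀ k, ∀ i, 1 ≤ i → ∑ t ∈ Finset.Icc 1 i,
      (q k : ℂ) ^ t * (diffZero t i : ℂ) / (1 - (q k : ℂ)) ^ (t + 1) =
      regSum (q k : ℂ) (X ^ i) := fun k i hi => by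
    rw [regSum_X_pow, aeval_powerSumPoly_eq_sum (hq1 k) hi]
  have hAN : ∀ k, ∀ i, 1 ≤ i → ∑ t ∈ Finset.Icc 1 i,
      (q k : ℂ) ^ (N + t) * (diffZero t i : ℂ) / (1 - (q k : ℂ)) ^ (t + 1) =
      (q k : ℂ) ^ N * regSum (q k : ℂ) (X ^ i) := fun k i hi => by
    rw [← hA k i hi, Finset.mul_sum]
    exact Finset.sum_congr rfl fun t _ => by ring
  have hB : ∀ k, ∀ i, 1 ≤ i → ∑ t ∈ Finset.Icc 1 i,
      (q k : ℂ) * (diffZero t i : ℂ) / ((q k : ℂ) - 1) ^ (t + 1) =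
      regSum (q k : ℂ)⁻¹ (X ^ i) := fun k i hi => by
    rw [regSum_X_pow, aeval_powerSumPoly_inv_eq_sum (hq0 k) (hq1 k) hi]
  have hBN : ∀ k, ∀ i, 1 ≤ i → ∑ t ∈ Finset.Icc 1 i,
      (q k : ℂ) ^ (N + 1) * (diffZero t i : ℂ) / ((q k : ℂ) - 1) ^ (t + 1) =
      (q k : ℂ) ^ N * regSum (q k : ℂ)⁻¹ (X ^ i) := fun k i hi => by
    rw [← hB k i hi, Finset.mul_sum]
    exact Finset.sum_congr rfl fun t _ => by ring
  have hL : ∀ i, 1 ≤ i → ∑ t ∈ Finset.Icc 1 i,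
      (expo ω h / (1 - expo ω h)) ^ t * (diffZero t i : ℂ) =
      (1 - expo ω h) * regSum (expo ω h) (X ^ i) := fun i hi => by
    have h' : (1 - expo ω h) ≠ 0 := sub_ne_zero.mpr (Ne.symm hω)
    rw [regSum_X_pow, aeval_powerSumPoly_eq_sum hω hi, Finset.mul_sum]
    refine Finset.sum_congr rfl fun t _ => ?_
    rw [div_pow, pow_succ]
    field_simp
  have h' : (1 - expo ω h) ≠ 0 := sub_ne_zero.mpr (Ne.symm hω)
  have hI : ∀ α ∈ Finset.Icc 1 j, (-1 : ℂ) ^ α * (j.factorial : ℂ) * expo ω b /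
        (((j - α).factorial : ℂ) * phase ω h ^ (α + 1)) =
      -((j.choose α : ℂ) * expo ω b * regInt (phase ω h) (X ^ α)) := fun α hα => by
    have hαj := (Finset.mem_Icc.mp hα).2
    have hf : ((j - α).factorial : ℂ) ≠ 0 := by exact_mod_cast Nat.factorial_ne_zero _
    rw [regInt_X_pow, ← Nat.choose_mul_factorial_mul_factorial hαj]
    push_cast
    rw [mul_comm ((j - α).factorial : ℂ) (phase ω h ^ (α + 1)), ← div_div]
    field_simp
    ring
  have hqN : ∀ k, ((q k : ℂ)⁻¹) ^ N * (q k : ℂ) ^ N = 1 := fun k => by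
    rw [← mul_pow, inv_mul_cancel₀ (hq0 k), one_pow]
  have hsum1 : ∀ (g g' : ℕ → ℂ), (∀ i, 1 ≤ i → g i = g' i) →
      ∑ α ∈ Finset.Icc 1 j, ((h / (b - a) : ℝ) : ℂ) ^ ((α : ℤ) - (j : ℤ)) * (j.choose α : ℂ) *
        g α = ∑ α ∈ Finset.Icc 1 j, ((j.choose α : ℂ) * (N : ℂ) ^ (j - α)) * g' α :=
    fun g g' hg => Finset.sum_congr rfl fun α hα => by
      rw [hw α hα, hg α (Finset.mem_Icc.mp hα).1]; ring
  have hsum2 : ∑ α ∈ Finset.Icc 1 j, ((h / (b - a) : ℝ) : ℂ) ^ ((α : ℤ) - (j : ℤ)) *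
      ((-1) ^ α * (j.factorial : ℂ) * expo ω b /
        (((j - α).factorial : ℂ) * phase ω h ^ (α + 1))) =
      -(expo ω b * ∑ α ∈ Finset.Icc 1 j, ((j.choose α : ℂ) * (N : ℂ) ^ (j - α)) *
        regInt (phase ω h) (X ^ α)) := by
    rw [Finset.mul_sum, ← Finset.sum_neg_distrib]
    exact Finset.sum_congr rfl fun α hα => by rw [hw α hα, hI α hα]; ring
  have hT : ∑ α ∈ Finset.Icc 1 j, ((j.choose α : ℂ) * (N : ℂ) ^ (j - α)) *
        tailError (rates (expo ω h) fun k => (q k : ℂ)) (solWeights m N a ω h q 1 A B)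
        (1 * expo ω a) (expo ω h) (phase ω h) N (X ^ α) =
      constK m ω h * expo ω b * (∑ α ∈ Finset.Icc 1 j, ((j.choose α : ℂ) * (N : ℂ) ^ (j - α)) *
        regSum (expo ω h) (X ^ α)) +
      (∑ k, A k * ∑ α ∈ Finset.Icc 1 j, ((j.choose α : ℂ) * (N : ℂ) ^ (j - α)) *
        ((q k : ℂ) ^ N * regSum (q k : ℂ) (X ^ α)) +
       ∑ k, B k * ∑ α ∈ Finset.Icc 1 j, ((j.choose α : ℂ) * (N : ℂ) ^ (j - α)) *
        regSum (q k : ℂ)⁻¹ (X ^ α)) -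
      expo ω b * ∑ α ∈ Finset.Icc 1 j, ((j.choose α : ℂ) * (N : ℂ) ^ (j - α)) *
        regInt (phase ω h) (X ^ α) := by
    simp only [solWeights, tailError_rates, Finset.mul_sum]
    rw [Finset.sum_comm (s := Finset.univ), Finset.sum_comm (s := Finset.univ),
      ← Finset.sum_add_distrib, ← Finset.sum_add_distrib, ← Finset.sum_sub_distrib]
    refine Finset.sum_congr rfl fun α _ => ?_
    rw [mul_sub, mul_add, mul_add, Finset.mul_sum, Finset.mul_sum, heb]
    congr 1
    · congr 1
      · ring
      · congr 1
        · exact Finset.sum_congr rfl fun k _ => by ring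
        · refine Finset.sum_congr rfl fun k _ => ?_
          linear_combination ((j.choose α : ℂ) * (N : ℂ) ^ (j - α)) * B k *
            regSum (q k : ℂ)⁻¹ (X ^ α) * hqN k
    · ring
  rw [hT, SecondEquation, solWeights, tailError_rates, hsum2, hL j hj,
    hsum1 _ _ fun i hi => hL i hi]
  simp only [hA _ j hj, hBN _ j hj, hsum1 _ _ (hAN _), hsum1 _ _ (hB _), mul_sub,
    Finset.sum_sub_distrib, pow_zero, mul_one, one_mul]
  have e1 : ∑ α ∈ Finset.Icc 1 j, ((j.choose α : ℂ) * (N : ℂ) ^ (j - α)) *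
      ((1 - expo ω h) * regSum (expo ω h) (X ^ α)) =
      (1 - expo ω h) * ∑ α ∈ Finset.Icc 1 j, ((j.choose α : ℂ) * (N : ℂ) ^ (j - α)) *
        regSum (expo ω h) (X ^ α) := by
    rw [Finset.mul_sum]; exact Finset.sum_congr rfl fun α _ => by ring
  have e2 : ∀ c x : ℂ, c / (1 - expo ω h) * ((1 - expo ω h) * x) = c * x := fun c x => by
    field_simp
  have e3 : ∑ k, B k * ((q k : ℂ) ^ N * regSum (q k : ℂ)⁻¹ (X ^ j)) =
      ∑ k, B k * (q k : ℂ) ^ N * regSum (q k : ℂ)⁻¹ (X ^ j) :=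
    Finset.sum_congr rfl fun k _ => by ring
  have e4 : (-1 : ℂ) ^ (j + 1) * (j.factorial : ℂ) * expo ω a / phase ω h ^ (j + 1) =
      expo ω a * regInt (phase ω h) (X ^ j) := by rw [regInt_X_pow]; ring
  rw [e1, e2, e2, e3, e4]
  constructor <;> intro H <;> linear_combination H

end SystemForm

/-! ### Unique solvability of the system and the resulting coefficients -/

section Solution

open Polynomial

theorem solWeights_add (m N : ℕ) (a ω h : ℝ) (q : Fin (m - 1) → ℝ) (ε ε' : ℂ)
    (A A' B B' : Fin (m - 1) → ℂ) :
    solWeights m N a ω h q (ε + ε') (A + A') (B + B') =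
      solWeights m N a ω h q ε A B + solWeights m N a ω h q ε' A' B' := by
  rw [solWeights, solWeights, solWeights, ← weights_add, add_mul, add_mul]
  congr 1
  ext k
  simp [add_mul]

theorem solWeights_smul (m N : ℕ) (a ω h : ℝ) (q : Fin (m - 1) → ℝ) (r ε : ℂ)
    (A B : Fin (m - 1) → ℂ) :
    solWeights m N a ω h q (r * ε) (r • A) (r • B) = r • solWeights m N a ω h q ε A B := by
  rw [solWeights, solWeights, ← weights_smul, mul_assoc, mul_assoc, mul_assoc]
  congr 1
  ext k
  simp [mul_assoc]

/-- The tail error for the progressions given by `A` and `B`. -/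
noncomputable def solTail (m N : ℕ) (a ω h : ℝ) (q : Fin (m - 1) → ℝ) (ε : ℂ)
    (A B : Fin (m - 1) → ℂ) (γ : ℕ) : ℂ[X] →ₗ[ℂ] ℂ :=
  tailError (rates (expo ω h) fun k => (q k : ℂ)) (solWeights m N a ω h q ε A B)
    (ε * expo ω a) (expo ω h) (phase ω h) γ

theorem solTail_add (m N : ℕ) (a ω h : ℝ) (q : Fin (m - 1) → ℝ) (ε ε' : ℂ)
    (A A' B B' : Fin (m - 1) → ℂ) (γ : ℕ) (f : ℂ[X]) :
    solTail m N a ω h q (ε + ε') (A + A') (B + B') γ f =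
      solTail m N a ω h q ε A B γ f + solTail m N a ω h q ε' A' B' γ f := by
  rw [solTail, solTail, solTail, solWeights_add, add_mul, tailError_add]

theorem solTail_smul (m N : ℕ) (a ω h : ℝ) (q : Fin (m - 1) → ℝ) (r ε : ℂ)
    (A B : Fin (m - 1) → ℂ) (γ : ℕ) (f : ℂ[X]) :
    solTail m N a ω h q (r * ε) (r • A) (r • B) γ f = r * solTail m N a ω h q ε A B γ f := by
  rw [solTail, solTail, solWeights_smul, mul_assoc, tailError_smul]

/-- The residuals of the two families of equations. -/
noncomputable def systemResidual (m N : ℕ) (a ω h : ℝ) (q : Fin (m - 1) → ℝ) (ε : ℂ)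
    (V : (Fin (m - 1) → ℂ) × (Fin (m - 1) → ℂ)) : (Fin (m - 1) → ℂ) × (Fin (m - 1) → ℂ) :=
  (fun j => solTail m N a ω h q ε V.1 V.2 0 (X ^ ((j : ℕ) + 1)),
   fun j => solTail m N a ω h q ε V.1 V.2 0 (X ^ ((j : ℕ) + 1)) -
    ∑ α ∈ Finset.Icc 1 ((j : ℕ) + 1),
      ((((j : ℕ) + 1).choose α : ℂ) * (N : ℂ) ^ ((j : ℕ) + 1 - α)) *
        solTail m N a ω h q ε V.1 V.2 N (X ^ α))

/-- Additivity jointly in ε and the unknowns: the case ε = 0 is the linear part of the affine system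
with ε = 1. -/
theorem systemResidual_add (m N : ℕ) (a ω h : ℝ) (q : Fin (m - 1) → ℝ) (ε ε' : ℂ)
    (V V' : (Fin (m - 1) → ℂ) × (Fin (m - 1) → ℂ)) :
    systemResidual m N a ω h q (ε + ε') (V + V') =
      systemResidual m N a ω h q ε V + systemResidual m N a ω h q ε' V' := by
  ext j
  · simp [systemResidual, solTail_add]
  · simp only [systemResidual, Prod.fst_add, Prod.snd_add, solTail_add, Pi.add_apply, mul_add,
      Finset.sum_add_distrib]
    ring

theorem systemResidual_smul (m N : ℕ) (a ω h : ℝ) (q : Fin (m - 1) → ℝ) (r ε : ℂ)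
    (V : (Fin (m - 1) → ℂ) × (Fin (m - 1) → ℂ)) :
    systemResidual m N a ω h q (r * ε) (r • V) = r • systemResidual m N a ω h q ε V := by
  ext j
  · simp [systemResidual, solTail_smul]
  · simp only [systemResidual, Prod.smul_fst, Prod.smul_snd, solTail_smul, Pi.smul_apply,
      smul_eq_mul, mul_left_comm _ r, ← Finset.mul_sum]
    ring

theorem systemResidual_eq_zero_iff (m N : ℕ) (a ω h : ℝ) (q : Fin (m - 1) → ℝ) (ε : ℂ)
    (V : (Fin (m - 1) → ℂ) × (Fin (m - 1) → ℂ)) :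
    systemResidual m N a ω h q ε V = 0 ↔
      (∀ j ∈ Finset.Icc 1 (m - 1), solTail m N a ω h q ε V.1 V.2 0 (X ^ j) = 0) ∧
      ∀ j ∈ Finset.Icc 1 (m - 1), solTail m N a ω h q ε V.1 V.2 0 (X ^ j) =
        ∑ α ∈ Finset.Icc 1 j, ((j.choose α : ℂ) * (N : ℂ) ^ (j - α)) *
          solTail m N a ω h q ε V.1 V.2 N (X ^ α) := by
  have hj : ∀ P : ℕ → Prop, (∀ j : Fin (m - 1), P ((j : ℕ) + 1)) ↔
      ∀ j ∈ Finset.Icc 1 (m - 1), P j := by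
    refine fun P => ⟨fun H j hj => ?_, fun H j => H _ (Finset.mem_Icc.mpr ⟨by omega, by omega⟩)⟩
    have hj := Finset.mem_Icc.mp hj
    have := H ⟨j - 1, by omega⟩
    rwa [show ((⟨j - 1, by omega⟩ : Fin (m - 1)) : ℕ) + 1 = j from Nat.sub_add_cancel hj.1] at this
  rw [← hj, ← hj, systemResidual, Prod.mk_eq_zero, funext_iff, funext_iff]
  simp only [Pi.zero_apply, sub_eq_zero]

theorem solvesSystem_iff {m N : ℕ} (hN : 1 ≤ N) {a b ω h : ℝ} (hab : a < b)
    (hh : h = (b - a) / (N : ℝ)) (hω : expo ω h ≠ 1) {q : Fin (m - 1) → ℝ}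
    (hq0 : ∀ k, (q k : ℂ) ≠ 0) (hq1 : ∀ k, (q k : ℂ) ≠ 1) (A B : Fin (m - 1) → ℂ) :
    SolvesSystem m N a b ω h q A B ↔ systemResidual m N a ω h q 1 (A, B) = 0 := by
  rw [systemResidual_eq_zero_iff, SolvesSystem]
  unfold solTail
  exact and_congr
    (forall₂_congr fun j hj => firstEquation_iff hω hq0 hq1 A B (Finset.mem_Icc.mp hj).1)
    (forall₂_congr fun j hj =>
      secondEquation_iff hN hab hh hω hq0 hq1 A B (Finset.mem_Icc.mp hj).1)

/-- The ratios q_k and 1/q_k contribute nothing as roots of E_{2m-2}, and the progression with ratio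
l cancels the integral by the choice of K. Hence this holds for all A and B, with no equation
imposed. -/
theorem solTail_X_pow_top {m : ℕ} (hm : 1 ≤ m) (N : ℕ) (a : ℝ) {ω h : ℝ}
    (hω : ∀ n : ℤ, ω * h ≠ (n : ℝ)) {q : Fin (m - 1) → ℝ} (hq1 : ∀ k, (q k : ℂ) ≠ 1)
    (hE : ∀ k, aeval (q k : ℂ) (eulerFrobenius (2 * (m - 1))) = 0) (ε : ℂ)
    (A B : Fin (m - 1) → ℂ) (γ : ℕ) :
    solTail m N a ω h q ε A B γ (X ^ (2 * m - 1)) = 0 := by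
  have hn : 2 * m - 1 = 2 * (m - 1) + 1 := by omega
  have h1 : ∀ k, regSum (q k : ℂ) (X ^ (2 * m - 1)) = 0 := fun k => by
    rw [regSum_X_pow, hn, aeval_powerSumPoly_succ _ _ (hq1 k), hE k]; simp
  have h2 : ∀ k, regSum (q k : ℂ)⁻¹ (X ^ (2 * m - 1)) = 0 := fun k => by
    rw [regSum_X_pow, hn, aeval_powerSumPoly_succ _ _ (fun h => hq1 k (inv_eq_one.mp h)),
      aeval_eulerFrobenius_inv_eq_zero (hE k)]; simp
  have h3 := constK_mul_powerSum m hm hω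
  rw [← regSum_X_pow] at h3
  rw [solTail, solWeights, tailError_rates]
  simp only [h1, h2, mul_zero, Finset.sum_const_zero, add_zero]
  rw [regInt_X_pow, show 2 * m - 1 + 1 = 2 * m by omega, pow_mul (-1 : ℂ)]
  simp only [neg_one_sq, one_pow, one_mul]
  linear_combination ε * expo ω a * expo ω h ^ γ * h3

theorem rates_ne_one {κ : Type*} {l : ℂ} (hl : l ≠ 1) {q : κ → ℂ} (hq : ∀ k, q k ≠ 1) :
    ∀ i, rates l q i ≠ 1
  | none => hl
  | some (Sum.inl k) => hq k
  | some (Sum.inr k) => fun h => hq k (inv_eq_one.mp h)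

/-- The coefficients of the quadrature formula given by `A` and `B`. -/
noncomputable def solCoeff (m N : ℕ) (a ω h : ℝ) (q : Fin (m - 1) → ℝ) (ε : ℂ)
    (A B : Fin (m - 1) → ℂ) (β : Fin (N + 1)) : ℂ :=
  h * quadCoeff (rates (expo ω h) fun k => (q k : ℂ)) (solWeights m N a ω h q ε A B)
    (ε * expo ω a) (expo ω h) (phase ω h) N β

theorem errorKernel_solCoeff_right {m N : ℕ} (hN : 1 ≤ N) {a b ω h : ℝ} (hω0 : ω ≠ 0)
    (hh : h = (b - a) / (N : ℝ)) (hpos : 0 < h) (hω : expo ω h ≠ 1) {q : Fin (m - 1) → ℝ}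
    (hq1 : ∀ k, (q k : ℂ) ≠ 1) {ε : ℂ} {A B : Fin (m - 1) → ℂ}
    (hr : systemResidual m N a ω h q ε (A, B) = 0) {j : ℕ} (hj : j < m) :
    errorKernel ω a (node N a b) ε (solCoeff m N a ω h q ε A B) j b = 0 := by
  have hdeg : ((C (N : ℂ) - X) ^ j : ℂ[X]).natDegree < m := by
    refine lt_of_le_of_lt ?_ hj
    exact natDegree_pow_le_of_le (m := 1) j (natDegree_sub_le_of_le
      ((natDegree_C _).le.trans zero_le_one) natDegree_X_le) |>.trans
      (by omega)
  unfold solCoeff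
  rw [errorKernel_right hω0 hN hh hpos, truncError_sub_last_eq_zero (rates_ne_one hω hq1) hN
    ((systemResidual_eq_zero_iff m N a ω h q ε (A, B)).mp hr).2 hdeg, mul_zero]

theorem errorKernel_solCoeff_node {m N : ℕ} (hm : 1 ≤ m) {a b ω h : ℝ} (hω0 : ω ≠ 0)
    (hh : h = (b - a) / (N : ℝ)) (hpos : 0 < h) (hω : ∀ n : ℤ, ω * h ≠ (n : ℝ))
    {q : Fin (m - 1) → ℝ} (hq1 : ∀ k, (q k : ℂ) ≠ 1)
    (hE : ∀ k, aeval (q k : ℂ) (eulerFrobenius (2 * (m - 1))) = 0) (ε : ℂ)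
    (A B : Fin (m - 1) → ℂ) (β : Fin (N + 1)) :
    errorKernel ω a (node N a b) ε (solCoeff m N a ω h q ε A B) (2 * m - 1) (node N a b β) =
      (h : ℂ) ^ (2 * m) / ((2 * m - 1).factorial : ℂ) *
        (nodePoly (rates (expo ω h) fun k => (q k : ℂ)) (solWeights m N a ω h q ε A B)
          (ε * expo ω a) (expo ω h) (phase ω h) (2 * m - 1)).eval ((β : ℕ) : ℂ) := by
  have hβ : (β : ℕ) ≤ N := Nat.lt_succ_iff.mp β.2
  unfold solCoeff
  rw [show node N a b β = h * (β : ℕ) + a by rw [node, hh],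
    errorKernel_node hω0 hh hpos _ _ _ (by omega) hβ,
    truncError_eq_nodePoly (rates_ne_one (expo_sub_one_ne_zero hω) hq1) _ _ _ _ (by omega) hβ
      (solTail_X_pow_top hm N a hω hq1 hE ε A B β), show 2 * m - 1 + 1 = 2 * m by omega]

theorem exists_interpolant {m N : ℕ} (hm : 1 ≤ m) {a b ω h : ℝ} (hω0 : ω ≠ 0)
    (hh : h = (b - a) / (N : ℝ)) (hpos : 0 < h) (hω : ∀ n : ℤ, ω * h ≠ (n : ℝ))
    {q : Fin (m - 1) → ℝ} (hq1 : ∀ k, (q k : ℂ) ≠ 1)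
    (hE : ∀ k, aeval (q k : ℂ) (eulerFrobenius (2 * (m - 1))) = 0) {ε : ℂ}
    {A B : Fin (m - 1) → ℂ} (hr : systemResidual m N a ω h q ε (A, B) = 0) :
    ∃ p : ℂ[X], p.degree < m ∧ ∀ β,
      errorKernel ω a (node N a b) ε (solCoeff m N a ω h q ε A B) (2 * m - 1) (node N a b β) =
        p.eval (node N a b β : ℂ) := by
  set P := nodePoly (rates (expo ω h) fun k => (q k : ℂ)) (solWeights m N a ω h q ε A B)
    (ε * expo ω a) (expo ω h) (phase ω h) (2 * m - 1) with hP
  have hdeg : P.degree < m :=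
    degree_nodePoly_lt hm ((systemResidual_eq_zero_iff m N a ω h q ε (A, B)).mp hr).1
  refine ⟨((h : ℂ) ^ (2 * m) / ((2 * m - 1).factorial : ℂ)) •
    P.comp (C (h : ℂ)⁻¹ * (X - C (a : ℂ))), (degree_smul_le _ _).trans_lt ?_, fun β => ?_⟩
  · have h1 : (C (h : ℂ)⁻¹ * (X - C (a : ℂ))).natDegree ≤ 1 :=
      (natDegree_C_mul_le _ _).trans (natDegree_X_sub_C_le _)
    have h2 := natDegree_lt_of_degree_lt hm hdeg
    refine degree_le_natDegree.trans_lt (Nat.cast_lt.mpr ?_)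
    calc _ ≤ P.natDegree * _ := natDegree_comp_le
      _ ≤ P.natDegree * 1 := Nat.mul_le_mul_left _ h1
      _ < m := by omega
  · rw [errorKernel_solCoeff_node hm hω0 hh hpos hω hq1 hE, ← hP, eval_smul, smul_eq_mul,
      eval_comp]
    have hh0 : (h : ℂ) ≠ 0 := by exact_mod_cast hpos.ne'
    congr 2
    rw [node, ← hh]
    simp
    field_simp

/-- The quadrature coefficients vanish by self-orthogonality. To pass from them to the amplitudes, N
+ 1 ≥ m enters: the node polynomial, of degree < m and zero at all nodes, is zero, which frees all
end moments from the nodes. -/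
theorem eq_zero_of_residual {m N : ℕ} (hm : 1 ≤ m) (hN : 1 ≤ N) (hmN : m ≤ N + 1) {a b ω h : ℝ}
    (hab : a < b) (hω0 : ω ≠ 0) (hh : h = (b - a) / (N : ℝ)) (hpos : 0 < h)
    (hω : ∀ n : ℤ, ω * h ≠ (n : ℝ)) {q : Fin (m - 1) → ℝ} (hq : Function.Injective q)
    (hq0 : ∀ k, (q k : ℂ) ≠ 0) (hqn : ∀ k, ‖(q k : ℂ)‖ < 1)
    (hE : ∀ k, aeval (q k : ℂ) (eulerFrobenius (2 * (m - 1))) = 0)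
    {V : (Fin (m - 1) → ℂ) × (Fin (m - 1) → ℂ)} (hr : systemResidual m N a ω h q 0 V = 0) :
    V = 0 := by
  obtain ⟨A, B⟩ := V
  have hq1 : ∀ k, (q k : ℂ) ≠ 1 := fun k h => by
    have := hqn k; rw [h, norm_one] at this; exact lt_irrefl _ this
  have hl := expo_sub_one_ne_zero hω
  obtain ⟨p, hp, hpe⟩ := exists_interpolant hm hω0 hh hpos hω hq1 hE hr
  have hD : solCoeff m N a ω h q 0 A B = 0 :=
    eq_zero_of_homogeneous hω0 hab (node_mem_Icc hN hab) (node_injective hN hab) hm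
      (fun j hj => errorKernel_solCoeff_right hN hω0 hh hpos hl hq1 hr hj) hp hpe
  set P := nodePoly (rates (expo ω h) fun k => (q k : ℂ)) (solWeights m N a ω h q 0 A B)
    (0 * expo ω a) (expo ω h) (phase ω h) (2 * m - 1) with hP
  have hdeg : P.degree < m :=
    degree_nodePoly_lt hm ((systemResidual_eq_zero_iff m N a ω h q 0 (A, B)).mp hr).1
  have hP0 : P = 0 := by
    refine eq_zero_of_degree_lt_of_eval_index_eq_zero (s := (Finset.univ : Finset (Fin (N + 1))))
      (v := fun β : Fin (N + 1) => ((β : ℕ) : ℂ))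
      (fun β _ γ _ h => Fin.ext (Nat.cast_injective (R := ℂ) h)) ?_ ?_
    · rw [Finset.card_univ, Fintype.card_fin]
      exact hdeg.trans_le (by exact_mod_cast hmN)
    · intro β _
      have e := errorKernel_solCoeff_node hm hω0 hh hpos hω hq1 hE 0 A B β (b := b)
      rw [hD, ← hP] at e
      have hz : (h : ℂ) ^ (2 * m) / ((2 * m - 1).factorial : ℂ) ≠ 0 :=
        div_ne_zero (pow_ne_zero _ (by exact_mod_cast hpos.ne'))
          (by exact_mod_cast Nat.factorial_ne_zero _)
      refine (mul_eq_zero.mp (e.symm.trans ?_)).resolve_left hz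
      simp [errorKernel]
  have hinvn : ∀ k, 1 < ‖(q k : ℂ)⁻¹‖ := fun k => by
    rw [norm_inv]; exact (one_lt_inv₀ (norm_pos_iff.mpr (hq0 k))).mpr (hqn k)
  have hρ1 : ∀ i : Fin (m - 1) ⊕ Fin (m - 1), rates (expo ω h) (fun k => (q k : ℂ)) (some i) ≠ 1 :=
    fun i => rates_ne_one hl hq1 _
  have hρ0 : ∀ i : Fin (m - 1) ⊕ Fin (m - 1), rates (expo ω h) (fun k => (q k : ℂ)) (some i) ≠ 0
    | Sum.inl k => hq0 k
    | Sum.inr k => inv_ne_zero (hq0 k)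
  have hρinj : ∀ i j : Fin (m - 1) ⊕ Fin (m - 1), rates (expo ω h) (fun k => (q k : ℂ)) (some i) =
      rates (expo ω h) (fun k => (q k : ℂ)) (some j) → i = j
    | Sum.inl k, Sum.inl k', e => congrArg _ (hq (Complex.ofReal_injective e))
    | Sum.inl k, Sum.inr k', e => absurd (congrArg norm e) ((hqn k).trans (hinvn k')).ne
    | Sum.inr k, Sum.inl k', e => absurd (congrArg norm e) ((hqn k').trans (hinvn k)).ne'
    | Sum.inr k, Sum.inr k', e => congrArg _ (hq (Complex.ofReal_injective (inv_injective e)))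
  set z : Fin (m - 1) ⊕ Fin (m - 1) → ℂ := fun i =>
    rates (expo ω h) (fun k => (q k : ℂ)) (some i) /
      (1 - rates (expo ω h) (fun k => (q k : ℂ)) (some i)) with hz
  have hall := eq_zero_of_sum_powerSumPoly (z := z)
    (d := fun i => solWeights m N a ω h q 0 A B (some i)) ?_ ?_ ?_
  · refine Prod.ext (funext fun k => hall (Sum.inl k)) (funext fun k => ?_)
    exact (mul_eq_zero.mp (hall (Sum.inr k))).resolve_right (pow_ne_zero _ (hq0 k))
  · intro i j hij
    apply hρinj
    have h1 := sub_ne_zero.mpr (hρ1 i).symm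
    have h2 := sub_ne_zero.mpr (hρ1 j).symm
    simp only [hz] at hij
    rw [div_eq_div_iff h1 h2] at hij
    linear_combination hij
  · intro i
    have h1 := sub_ne_zero.mpr (hρ1 i).symm
    have e : 1 + z i = 1 / (1 - rates (expo ω h) (fun k => (q k : ℂ)) (some i)) := by
      simp only [hz]; field_simp; ring
    rw [e]
    exact mul_ne_zero (div_ne_zero (hρ0 i) h1) (one_div_ne_zero h1)
  · intro k hk
    rw [Fintype.card_sum, Fintype.card_fin] at hk
    -- The orders needed are 1, …, 2m-2, all within the available 2m-1. As ε = 0, the ratio l and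
    -- the integral drop out of these moments.
    have := endError_eq_zero_of_nodePoly (k := k + 1) (by omega) hP0
    rw [endError_X_pow _ _ _ _ _ _ (by omega), tailError_apply, Fintype.sum_option] at this
    simpa [solWeights, weights, regSum_X_pow, hz] using this

theorem exists_unique_residual {m N : ℕ} (hm : 1 ≤ m) (hN : 1 ≤ N) (hmN : m ≤ N + 1)
    {a b ω h : ℝ} (hab : a < b) (hω0 : ω ≠ 0) (hh : h = (b - a) / (N : ℝ)) (hpos : 0 < h)
    (hω : ∀ n : ℤ, ω * h ≠ (n : ℝ)) {q : Fin (m - 1) → ℝ} (hq : Function.Injective q)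
    (hq0 : ∀ k, (q k : ℂ) ≠ 0) (hqn : ∀ k, ‖(q k : ℂ)‖ < 1)
    (hE : ∀ k, aeval (q k : ℂ) (eulerFrobenius (2 * (m - 1))) = 0) :
    ∃ V, ∀ V', systemResidual m N a ω h q 1 V' = 0 ↔ V' = V := by
  -- The system is square with linear part M, so injectivity of M gives existence as well as
  -- uniqueness.
  let M : ((Fin (m - 1) → ℂ) × (Fin (m - 1) → ℂ)) →ₗ[ℂ]
      ((Fin (m - 1) → ℂ) × (Fin (m - 1) → ℂ)) :=
    { toFun := systemResidual m N a ω h q 0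
      map_add' := fun V V' => by rw [← systemResidual_add, add_zero]
      map_smul' := fun r V => by rw [RingHom.id_apply, ← systemResidual_smul, mul_zero] }
  have hM : Function.Injective M := (injective_iff_map_eq_zero M).mpr fun V hV =>
    eq_zero_of_residual hm hN hmN hab hω0 hh hpos hω hq hq0 hqn hE hV
  obtain ⟨V, hV⟩ := LinearMap.injective_iff_surjective.mp hM (-systemResidual m N a ω h q 1 0)
  refine ⟨V, fun V' => ?_⟩
  have e : systemResidual m N a ω h q 1 V' = M V' - M V := by
    have := systemResidual_add m N a ω h q 1 0 0 V'
    rw [add_zero, zero_add] at this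
    rw [this, hV, sub_neg_eq_add, add_comm]
    rfl
  rw [e, sub_eq_zero, hM.eq_iff]

/-- The amplitude of the ratio 1/q_k is b_k q_k^N, giving b_k q_k^(N-β) at node β. At the left end
each progression is corrected by 1 - 1/(1-ρ) = ρ/(ρ-1), and at the right end the weight is its
regularised tail. -/
theorem eq_solCoeff_iff {m N : ℕ} (hN : 1 ≤ N) {a b ω h : ℝ} (hh : h = (b - a) / (N : ℝ))
    (hω : expo ω h ≠ 1) {q : Fin (m - 1) → ℝ} (hq0 : ∀ k, (q k : ℂ) ≠ 0)
    (hq1 : ∀ k, (q k : ℂ) ≠ 1) (A B : Fin (m - 1) → ℂ) (D : Fin (N + 1) → ℂ) :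
    D = solCoeff m N a ω h q 1 A B ↔
      D 0 = (h : ℂ) * (expo ω (a + h) * (constK m ω h : ℂ) / (expo ω h - 1)
          - expo ω a / phase ω h
          + ∑ k, (A k * ((q k : ℂ) / ((q k : ℂ) - 1))
            + B k * ((q k : ℂ) ^ N / (1 - (q k : ℂ))))) ∧
      (∀ β : Fin (N + 1), 1 ≤ (β : ℕ) → (β : ℕ) ≤ N - 1 →
        D β = (h : ℂ) * (expo ω (h * ((β : ℕ) : ℝ) + a) * (constK m ω h : ℂ)
          + ∑ k, (A k * (q k : ℂ) ^ (β : ℕ) + B k * (q k : ℂ) ^ (N - (β : ℕ))))) ∧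
      D (Fin.last N) = (h : ℂ) * (expo ω b * (constK m ω h : ℂ) / (1 - expo ω h)
          + expo ω b / phase ω h
          + ∑ k, (A k * ((q k : ℂ) ^ N / (1 - (q k : ℂ)))
            + B k * ((q k : ℂ) / ((q k : ℂ) - 1)))) := by
  have hN' : (N : ℝ) ≠ 0 := by exact_mod_cast (by omega : N ≠ 0)
  have hb : b = h * N + a := by rw [hh]; field_simp; ring
  have h1 : (1 - expo ω h) ≠ 0 := sub_ne_zero.mpr (Ne.symm hω)
  have h2 : (expo ω h - 1) ≠ 0 := sub_ne_zero.mpr hω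
  have hk1 : ∀ k, (1 - (q k : ℂ)) ≠ 0 := fun k => sub_ne_zero.mpr (hq1 k).symm
  have hk2 : ∀ k, ((q k : ℂ) - 1) ≠ 0 := fun k => sub_ne_zero.mpr (hq1 k)
  have hinv : ∀ k, (q k : ℂ)⁻¹ ≠ 1 := fun k e => hq1 k (inv_eq_one.mp e)
  have hR : ∀ k, regSum (q k : ℂ) 1 = 1 / (1 - (q k : ℂ)) := fun k => regSum_one (hq1 k)
  have hRi : ∀ k, regSum (q k : ℂ)⁻¹ 1 = (q k : ℂ) / ((q k : ℂ) - 1) := fun k => by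
    have := hk2 k
    have := hq0 k
    have h3 : 1 - (q k : ℂ)⁻¹ ≠ 0 := sub_ne_zero.mpr (hinv k).symm
    rw [regSum_one (hinv k)]
    field_simp
  have e0 : solCoeff m N a ω h q 1 A B 0 =
      (h : ℂ) * (expo ω (a + h) * (constK m ω h : ℂ) / (expo ω h - 1) - expo ω a / phase ω h
          + ∑ k, (A k * ((q k : ℂ) / ((q k : ℂ) - 1))
            + B k * ((q k : ℂ) ^ N / (1 - (q k : ℂ))))) := by
    rw [solCoeff, quadCoeff, Fin.val_zero, if_pos rfl, solWeights, tailError_rates,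
      Fintype.sum_option, Fintype.sum_sum_type, regSum_one hω, regInt_one, expo_add,
      Finset.sum_add_distrib]
    simp only [weights, hR, hRi, pow_zero, mul_one, one_mul]
    have eA : ∑ k, A k * ((q k : ℂ) / ((q k : ℂ) - 1)) =
        ∑ k, A k - ∑ k, A k * (1 / (1 - (q k : ℂ))) := by
      rw [← Finset.sum_sub_distrib]
      refine Finset.sum_congr rfl fun k _ => ?_
      have := hk1 k
      have := hk2 k
      field_simp
      ring
    have eB : ∑ k, B k * ((q k : ℂ) ^ N / (1 - (q k : ℂ))) =
        ∑ k, B k * (q k : ℂ) ^ N - ∑ k, B k * (q k : ℂ) ^ N * ((q k : ℂ) / ((q k : ℂ) - 1)) := by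
      rw [← Finset.sum_sub_distrib]
      refine Finset.sum_congr rfl fun k _ => ?_
      have := hk1 k
      have := hk2 k
      field_simp
      ring
    have eL : expo ω a * expo ω h * (constK m ω h : ℂ) / (expo ω h - 1) =
        expo ω a * constK m ω h - expo ω a * constK m ω h * (1 / (1 - expo ω h)) := by
      field_simp
      ring
    rw [eA, eB, eL]
    ring
  have eM : ∀ β : Fin (N + 1), 1 ≤ (β : ℕ) → (β : ℕ) ≤ N - 1 →
      solCoeff m N a ω h q 1 A B β =
        (h : ℂ) * (expo ω (h * ((β : ℕ) : ℝ) + a) * (constK m ω h : ℂ)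
          + ∑ k, (A k * (q k : ℂ) ^ (β : ℕ) + B k * (q k : ℂ) ^ (N - (β : ℕ)))) := by
    intro β hβ1 hβ2
    rw [solCoeff, quadCoeff, if_neg (by omega), if_pos (by omega), solWeights,
      Fintype.sum_option, Fintype.sum_sum_type, expo_add, expo_nat_mul, Finset.sum_add_distrib]
    simp only [weights, rates, one_mul]
    have eB : ∀ k, B k * (q k : ℂ) ^ N * (q k : ℂ)⁻¹ ^ (β : ℕ) =
        B k * (q k : ℂ) ^ (N - (β : ℕ)) := fun k => by
      rw [pow_sub₀ _ (hq0 k) (by omega), inv_pow, mul_assoc]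
    simp only [eB]
    ring
  have eN : solCoeff m N a ω h q 1 A B (Fin.last N) =
      (h : ℂ) * (expo ω b * (constK m ω h : ℂ) / (1 - expo ω h) + expo ω b / phase ω h
          + ∑ k, (A k * ((q k : ℂ) ^ N / (1 - (q k : ℂ)))
            + B k * ((q k : ℂ) / ((q k : ℂ) - 1)))) := by
    rw [solCoeff, quadCoeff, Fin.val_last, if_neg (by omega), if_neg (by omega), solWeights,
      tailError_rates, regSum_one hω, regInt_one, hb, expo_add, expo_nat_mul,
      Finset.sum_add_distrib]
    simp only [hR, hRi, one_mul]
    have eA : ∀ k, A k * (q k : ℂ) ^ N * (1 / (1 - (q k : ℂ))) =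
        A k * ((q k : ℂ) ^ N / (1 - (q k : ℂ))) := fun k => by ring
    have eB : ∀ k, B k * (q k : ℂ) ^ N * (q k : ℂ)⁻¹ ^ N * ((q k : ℂ) / ((q k : ℂ) - 1)) =
        B k * ((q k : ℂ) / ((q k : ℂ) - 1)) := fun k => by
      rw [inv_pow, mul_inv_cancel_right₀ (pow_ne_zero _ (hq0 k))]
    simp only [eA, eB]
    ring
  rw [← e0, ← eN]
  constructor
  · rintro rfl
    exact ⟨rfl, eM, rfl⟩
  · rintro ⟨H0, HM, HN⟩
    funext β
    rcases Nat.eq_zero_or_pos (β : ℕ) with hβ | hβ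
    · rw [show β = 0 from Fin.ext hβ, H0]
    · rcases Nat.lt_or_ge (β : ℕ) N with hlt | hge
      · rw [HM β hβ (by omega), eM β hβ (by omega)]
      · rw [show β = Fin.last N from Fin.ext (le_antisymm (Nat.lt_succ_iff.mp β.2) hge), HN]

end Solution

/-! ### The optimal quadrature formula -/

theorem theorem9 (m N : ℕ) (hm : 1 ≤ m) (hN : 1 ≤ N) (hmN : m ≤ N + 1)
    (a b : ℝ) (hab : a < b) (ω h : ℝ) (hh : h = (b - a) / (N : ℝ))
    (hω : ∀ n : ℤ, ω * h ≠ (n : ℝ)) :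
    ∃ q : Fin (m - 1) → ℝ, StrictMono q ∧
      (∀ z : ℂ, (∃ k, (q k : ℂ) = z) ↔
        Polynomial.aeval z (eulerFrobenius (2 * m - 2)) = 0 ∧ ‖z‖ < 1) ∧
      ∃ A B : Fin (m - 1) → ℂ,
        (∀ A' B' : Fin (m - 1) → ℂ,
          SolvesSystem m N a b ω h q A' B' ↔ A' = A ∧ B' = B) ∧
        ∀ C : Fin (N + 1) → ℂ, IsSardOptimal m N a b ω C ↔
          C 0 = (h : ℂ) * (expo ω (a + h) * (constK m ω h : ℂ) / (expo ω h - 1)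
              - expo ω a / phase ω h
              + ∑ k, (A k * ((q k : ℂ) / ((q k : ℂ) - 1))
                + B k * ((q k : ℂ) ^ N / (1 - (q k : ℂ))))) ∧
          (∀ β : Fin (N + 1), 1 ≤ (β : ℕ) → (β : ℕ) ≤ N - 1 →
            C β = (h : ℂ) * (expo ω (h * ((β : ℕ) : ℝ) + a) * (constK m ω h : ℂ)
              + ∑ k, (A k * (q k : ℂ) ^ (β : ℕ) + B k * (q k : ℂ) ^ (N - (β : ℕ))))) ∧
          C (Fin.last N) = (h : ℂ) * (expo ω b * (constK m ω h : ℂ) / (1 - expo ω h)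
              + expo ω b / phase ω h
              + ∑ k, (A k * ((q k : ℂ) ^ N / (1 - (q k : ℂ)))
                + B k * ((q k : ℂ) / ((q k : ℂ) - 1)))) := by
  have hpos : 0 < h := by
    rw [hh]; exact div_pos (sub_pos.mpr hab) (by exact_mod_cast hN)
  have hω0 : ω ≠ 0 := fun h0 => hω 0 (by simp [h0])
  have hl := expo_sub_one_ne_zero hω
  obtain ⟨q, hmono, hq⟩ := exists_strictMono_roots (m - 1)
  have hroot := fun k => (hq (q k)).mp ⟨k, rfl⟩
  have hE := fun k => (hroot k).1
  have hqn := fun k => (hroot k).2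
  have hq0 : ∀ k, (q k : ℂ) ≠ 0 := fun k h0 => by
    have := hE k
    rw [h0, aeval_eulerFrobenius_zero] at this
    exact one_ne_zero this
  have hq1 : ∀ k, (q k : ℂ) ≠ 1 := fun k h1 => by
    have := hqn k
    rw [h1, norm_one] at this
    exact lt_irrefl _ this
  refine ⟨q, hmono, by rwa [show 2 * m - 2 = 2 * (m - 1) by omega], ?_⟩
  obtain ⟨⟨A, B⟩, hV⟩ := exists_unique_residual hm hN hmN hab hω0 hh hpos hω hmono.injective
    hq0 hqn hE
  refine ⟨A, B, fun A' B' => ?_, fun D => ?_⟩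
  · rw [solvesSystem_iff hN hab hh hl hq0 hq1, hV, Prod.mk.injEq]
  · have hr := (hV (A, B)).mpr rfl
    obtain ⟨p, hp, hpe⟩ := exists_interpolant hm hω0 hh hpos hω hq1 hE hr
    rw [← eq_solCoeff_iff hN hh hl hq0 hq1 A B D]
    exact isSardOptimal_iff_eq hm hN hab hω0
      (fun j hj => errorKernel_solCoeff_right hN hω0 hh hpos hl hq1 hr hj) hp hpe D
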